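/- **Setting.** Let $T\ge 0$, $A\in\mathbb R^{n\times n}$, $0\preceq Q\in\mathbb R^{n\times n}$, and for $j=1,\dots,M$ let $H_j\in\mathbb R^{m_j\times n}$ and $0\prec R_j\in\mathbb R^{m_j\times m_j}$. Put $$S_j=H_j^\top R_j^{-1}H_j,\qquad g_j(P)=PH_j^\top(H_jPH_j^\top+R_j)^{-1}H_jP .$$ An admissible deterministic schedule is a measurable $\lambda=(\lambda_1,\dots,\lambda_M)$ on $[0,T]$ whose components are a.e. nonnegative and essentially bounded. Let $W:[0,T]\to\mathbb R^{n\times n}$ be integrable with $W(t)\succeq 0$ for a.e. $t$, let $W_T\succeq 0$, and for a matrix trajectory $X$ set $$J(X)=\int_0^T\langle W(t),X(t)\rangle_F\,dt+\langle W_T,X(T)\rangle_F .$$ On a filtered probability space let $N_1,\dots,N_M$ be independent Poisson processes (with respect to the filtration) with intensities $\lambda_1,\dots,\lambda_M$, and let $P^\lambda$ be the exact covariance process of the continuous-discrete Kalman filter: an adapted càdlàg process of positive definite matrices with $$dP(t)=(AP(t)+P(t)A^\top+Q)\,dt-\sum_{j=1}^M g_j(P(t-))\,dN_j(t),\qquad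 t\in[0,T],$$ whose initial value $P(0)$ may be random. Almost surely, let the surrogate trajectories $\hat Y^\lambda$ (continuous, symmetric) and $\hat P^\lambda$ (continuous, positive semidefinite) satisfy, in the integrated sense on $[0,T]$, $$\dot{\hat Y}=-\hat YA-A^\top\hat Y-\hat YQ\hat Y+\sum_{j=1}^M\lambda_j(t)S_j,\qquad \hat Y(0)=P(0)^{-1},$$ $$\dot{\hat P}=A\hat P+\hat PA^\top+Q-\sum_{j=1}^M\lambda_j(t)g_j(\hat P),\qquad \hat P(0)=P(0).$$ **Claim.** Almost surely $\hat Y^\lambda(t)\succ0$ for all $t\in[0,T]$, the integrals defining $J((\hat Y^\lambda)^{-1})$, $J(P^\lambda)$ and $J(\hat P^\lambda)$ converge, and $J(P^\lambda)\ge 0$; moreover $J(P^\lambda)$ is a random variable (measurable up to null sets), its conditional expectation given $P(0)$ (as a nonnegative random variable) is almost surely finite, and almost surely $$J\big((\hat Y^\lambda)^{-1}\big)\;\le\;\mathbb E\big[J(P^\lambda)\,\big|\,P(0)\big]\;\le\;J\big(\hat P^\lambda\big).$$ If the entries of $P(0)$ are integrable, then $J(P^\lambda)$ is integrable, so that the same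 bounds hold for the conditional expectation in the usual $L^1$ sense. -/

import Mathlib

open MeasureTheory ProbabilityTheory Set Filter Topology
open scoped Matrix ENNReal

noncomputable section

namespace CDKF

/-- Data of a continuous-discrete Kalman filter: state dynamics `dx = A x dt + dw` with process
noise intensity `Q ⪰ 0`, and `M` sensors, the `j`-th one measuring `H j x + v` with
`v ∼ 𝒩(0, R j)`, `R j ≻ 0`. -/
structure Model (n M : ℕ) where
  A : Matrix (Fin n) (Fin n) ℝ
  Q : Matrix (Fin n) (Fin n) ℝ
  m : Fin M → ℕ
  H : (j : Fin M) → Matrix (Fin (m j)) (Fin n) ℝ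
  R : (j : Fin M) → Matrix (Fin (m j)) (Fin (m j)) ℝ
  Q_posSemidef : Q.PosSemidef
  R_posDef : ∀ j, (R j).PosDef

variable {n M : ℕ}

/-- The covariance reduction `g_j(P) = P Hⱼᵀ (Hⱼ P Hⱼᵀ + Rⱼ)⁻¹ Hⱼ P` caused by a measurement of
sensor `j`. -/
def Model.g (S : Model n M) (j : Fin M) (P : Matrix (Fin n) (Fin n) ℝ) :
    Matrix (Fin n) (Fin n) ℝ :=
  P * (S.H j)ᵀ * (S.H j * P * (S.H j)ᵀ + S.R j)⁻¹ * S.H j * P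

/-- The information gain `Sⱼ = Hⱼᵀ Rⱼ⁻¹ Hⱼ` of a measurement of sensor `j`. -/
def Model.infoGain (S : Model n M) (j : Fin M) : Matrix (Fin n) (Fin n) ℝ :=
  (S.H j)ᵀ * (S.R j)⁻¹ * S.H j

/-- The entrywise integral `∫₀ᵗ F(s) ds` of a matrix-valued function. -/
def matIntegral (F : ℝ → Matrix (Fin n) (Fin n) ℝ) (t : ℝ) : Matrix (Fin n) (Fin n) ℝ :=
  Matrix.of fun i k => ∫ s in (0 : ℝ)..t, F s i k

/-- The integral `∫_{(0,t]} F(s) dN(s)` against a counting path `N` (nondecreasing, right-continuous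
and integer-valued, hence with finitely many jumps on `(0,t]`): the sum over the jump times of the
jump size times `F`. -/
def countIntegral (N : ℝ → ℕ) (F : ℝ → Matrix (Fin n) (Fin n) ℝ) (t : ℝ) :
    Matrix (Fin n) (Fin n) ℝ :=
  ∑ᶠ s ∈ Set.Ioc (0 : ℝ) t,
    ((N s : ℝ) - Function.leftLim (fun u => (N u : ℝ)) s) • F s

/-- An admissible deterministic schedule of measurement rates on `[0,T]`: measurable, nonnegative
and componentwise essentially bounded. -/
structure IsAdmissible (T : ℝ) (lam : Fin M → ℝ → ℝ) : Prop where
  aestronglyMeasurable : ∀ j, AEStronglyMeasurable (lam j) (volume.restrict (Set.Icc 0 T))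
  nonneg : ∀ j, ∀ᵐ t ∂(volume.restrict (Set.Icc 0 T)), 0 ≤ lam j t
  essBounded : ∀ j, ∃ C : ℝ, ∀ᵐ t ∂(volume.restrict (Set.Icc 0 T)), lam j t ≤ C

/-- `N 1, …, N M` are independent Poisson processes on `[0,T]` with respect to the filtration `ℱ`,
with deterministic intensities `lam 1, …, lam M`. -/
structure IsPoissonFamily {Ω : Type*} {mΩ : MeasurableSpace Ω} (μ : Measure Ω)
    (ℱ : Filtration ℝ mΩ) (T : ℝ) (lam : Fin M → ℝ → ℝ) (N : Fin M → ℝ → Ω → ℕ) : Prop where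
  adapted : ∀ j, ∀ t ∈ Set.Icc 0 T, Measurable[ℱ t] (N j t)
  paths : ∀ j, ∀ᵐ ω ∂μ, N j 0 ω = 0 ∧ MonotoneOn (fun t => N j t ω) (Set.Icc 0 T) ∧
    ∀ t ∈ Set.Ico 0 T, ContinuousWithinAt (fun u => N j u ω) (Set.Ici t) t
  law : ∀ j, ∀ s t, 0 ≤ s → s ≤ t → t ≤ T →
    HasLaw (fun ω => N j t ω - N j s ω) (poissonMeasure (∫ u in s..t, lam j u).toNNReal) μ
  indep_sensors : ∀ s t, 0 ≤ s → s ≤ t → t ≤ T →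
    iIndepFun (fun j ω => N j t ω - N j s ω) μ
  indep_past : ∀ s t, 0 ≤ s → s ≤ t → t ≤ T →
    Indep (MeasurableSpace.comap (fun ω (j : Fin M) => N j t ω - N j s ω) inferInstance) (ℱ s) μ

/-- `P` is the exact error covariance process of the filter on `[0,T]` driven by the counting
processes `N`: a càdlàg adapted process of positive definite matrices which solves
`dP = (A P + P Aᵀ + Q) dt - ∑ⱼ gⱼ(P(t-)) dNⱼ(t)`. -/
structure IsCovarianceProcess {Ω : Type*} {mΩ : MeasurableSpace Ω} (μ : Measure Ω)
    (ℱ : Filtration ℝ mΩ) (T : ℝ) (S : Model n M) (N : Fin M → ℝ → Ω → ℕ)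
    (P : ℝ → Ω → Matrix (Fin n) (Fin n) ℝ) : Prop where
  adapted : ∀ t ∈ Set.Icc 0 T, StronglyMeasurable[ℱ t] (P t)
  posDef : ∀ᵐ ω ∂μ, ∀ t ∈ Set.Icc 0 T, (P t ω).PosDef
  right_continuous : ∀ᵐ ω ∂μ, ∀ t ∈ Set.Ico 0 T,
    ContinuousWithinAt (fun u => P u ω) (Set.Ici t) t
  left_limits : ∀ᵐ ω ∂μ, ∀ t ∈ Set.Ioc 0 T, ∃ L, Tendsto (fun u => P u ω) (𝓝[<] t) (𝓝 L)
  equation : ∀ᵐ ω ∂μ, ∀ t ∈ Set.Icc 0 T,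
    P t ω = P 0 ω
      + matIntegral (fun s => S.A * P s ω + P s ω * S.Aᵀ + S.Q) t
      - ∑ j, countIntegral (fun s => N j s ω)
          (fun s => S.g j (Function.leftLim (fun u => P u ω) s)) t

/-- `Y` is the information-form surrogate trajectory on `[0,T]` started at `Y₀`: a (Carathéodory)
solution, with values in the symmetric matrices, of
`Y' = -Y A - Aᵀ Y - Y Q Y + ∑ⱼ λⱼ(t) Sⱼ`, `Y(0) = Y₀`. -/
structure IsInfoSurrogate (T : ℝ) (S : Model n M) (lam : Fin M → ℝ → ℝ)
    (Y₀ : Matrix (Fin n) (Fin n) ℝ) (Y : ℝ → Matrix (Fin n) (Fin n) ℝ) : Prop where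
  continuousOn : ContinuousOn Y (Set.Icc 0 T)
  symm : ∀ t ∈ Set.Icc 0 T, (Y t).IsSymm
  equation : ∀ t ∈ Set.Icc 0 T,
    Y t = Y₀ + matIntegral (fun s => -(Y s * S.A) - S.Aᵀ * Y s - Y s * S.Q * Y s
      + ∑ j, lam j s • S.infoGain j) t

/-- `P` is the covariance-form surrogate trajectory on `[0,T]` started at `P₀`: a (Carathéodory)
solution, with values in the positive semidefinite matrices (where `gⱼ` is defined), of
`P' = A P + P Aᵀ + Q - ∑ⱼ λⱼ(t) gⱼ(P)`, `P(0) = P₀`. -/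
structure IsCovSurrogate (T : ℝ) (S : Model n M) (lam : Fin M → ℝ → ℝ)
    (P₀ : Matrix (Fin n) (Fin n) ℝ) (P : ℝ → Matrix (Fin n) (Fin n) ℝ) : Prop where
  continuousOn : ContinuousOn P (Set.Icc 0 T)
  posSemidef : ∀ t ∈ Set.Icc 0 T, (P t).PosSemidef
  equation : ∀ t ∈ Set.Icc 0 T,
    P t = P₀ + matIntegral (fun s => S.A * P s + P s * S.Aᵀ + S.Q
      - ∑ j, lam j s • S.g j (P s)) t

/-- The Frobenius inner product `⟨X, Y⟩ = tr(Xᵀ Y)`. -/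
def frob (X Y : Matrix (Fin n) (Fin n) ℝ) : ℝ := (Xᵀ * Y).trace

/-- The estimation cost `J(X) = ∫₀ᵀ ⟨W(t), X(t)⟩ dt + ⟨W_T, X(T)⟩` of a matrix trajectory. -/
def cost (T : ℝ) (W : ℝ → Matrix (Fin n) (Fin n) ℝ) (WT : Matrix (Fin n) (Fin n) ℝ)
    (X : ℝ → Matrix (Fin n) (Fin n) ℝ) : ℝ :=
  (∫ t in (0 : ℝ)..T, frob (W t) (X t)) + frob WT (X T)

/-- Admissible weights: `W` integrable on `[0,T]`, `W(t) ⪰ 0` for almost every `t`, `W_T ⪰ 0`. -/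
structure IsWeight (T : ℝ) (W : ℝ → Matrix (Fin n) (Fin n) ℝ)
    (WT : Matrix (Fin n) (Fin n) ℝ) : Prop where
  integrable : ∀ i k, IntegrableOn (fun t => W t i k) (Set.Icc 0 T)
  posSemidef : ∀ᵐ t ∂(volume.restrict (Set.Icc 0 T)), (W t).PosSemidef
  terminal : WT.PosSemidef

/-- The σ-algebra `σ(X)` generated by a random matrix `X`. -/
abbrev sigmaGen {Ω : Type*} (X : Ω → Matrix (Fin n) (Fin n) ℝ) : MeasurableSpace Ω :=
  MeasurableSpace.comap (fun ω (i k : Fin n) => X ω i k) MeasurableSpace.pi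

end CDKF

end

/-! Both bounds are Jensen's inequality followed by a comparison principle for matrix differential
inequalities.

Upper bound. `P - g_j(P)` is the minimum over gains `K` of `(1 - K H) P (1 - K H)ᵀ + K R Kᵀ`, which
is affine in `P`; hence `g_j` is a supremum of affine maps, and convex (`Model.le_qf_g`,
`Model.g_eq`). After compensating the Poisson integrals (`IsPoissonFamily.integral_cInt`), the mean
of `P` solves the surrogate equation with the mean of `g_j(P)`, which dominates `g_j` of the mean.
So the mean of `P` stays below the covariance surrogate (`IsCovSurrogate.exists_upper_bound`).

Lower bound. Almost surely no two measurements coincide, so by the Woodbury identity each jump just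
adds `S_j` to `Y = P⁻¹` (`IsCovPath.inv_eq`). The drift of `Y` contains `-Y Q Y`, and `Y ↦ Y Q Y` is
convex, so the mean of `Y` stays below the information surrogate
(`IsInfoSurrogate.exists_upper_bound`). Since inversion is operator convex and order reversing, the
mean of `P` lies above the inverse of that surrogate. Convexity always enters through a tangent
inequality (`qf_tangent_le_inv`, `qf_tangent_le_quadratic`), which is integrated directly.

Comparison. For a difference `D` of two paths, `lamPos_le_gronwallBound` controls the positive part
of the largest eigenvalue. Terms of the form `D G + Gᵀ D` are absorbed by moving the test vector,
and terms `V D Vᵀ` are bounded by the eigenvalue itself.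

Conditioning on `P(0)`. The surrogates are given path by path, without measurability in `ω`.
Therefore the comparison is made for integrals over an initial event `B` on which `P(0)` is within
`r` of a fixed matrix `p`: they are compared with `μ(B)` times the surrogate from `p`, up to an
error proportional to `r μ(B)`. A countable covering by small cells (`ae_of_local`) turns these
local estimates into almost sure bounds for the conditional expectation. -/

namespace CDKF

/-! ### Quadratic forms, the largest eigenvalue, and convexity of the Kalman update. -/

section LinearAlgebra

open scoped Matrix.Norms.L2Operator

variable {n M : ℕ}

/-- The quadratic form `v ↦ vᵀ X v`. -/
noncomputable def qf (X : Matrix (Fin n) (Fin n) ℝ) (v : Fin n → ℝ) : ℝ := v ⬝ᵥ (X *ᵥ v)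

/-- The Euclidean norm of a vector. -/
noncomputable def vnorm (v : Fin n → ℝ) : ℝ := ‖(WithLp.toLp 2 v : EuclideanSpace ℝ (Fin n))‖

theorem vnorm_nonneg (v : Fin n → ℝ) : 0 ≤ vnorm v := norm_nonneg _

theorem vnorm_sq (v : Fin n → ℝ) : vnorm v ^ 2 = v ⬝ᵥ v := by
  rw [vnorm, ← real_inner_self_eq_norm_sq, EuclideanSpace.inner_eq_star_dotProduct]
  simp

theorem vnorm_add_le (v w : Fin n → ℝ) : vnorm (v + w) ≤ vnorm v + vnorm w := by
  rw [vnorm, WithLp.toLp_add]; exact norm_add_le _ _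

theorem vnorm_smul (c : ℝ) (v : Fin n → ℝ) : vnorm (c • v) = |c| * vnorm v := by
  rw [vnorm, WithLp.toLp_smul, norm_smul, Real.norm_eq_abs]; rfl

theorem vnorm_mulVec_le (X : Matrix (Fin n) (Fin n) ℝ) (v : Fin n → ℝ) :
    vnorm (X *ᵥ v) ≤ ‖X‖ * vnorm v :=
  Matrix.l2_opNorm_mulVec X (WithLp.toLp 2 v)

theorem abs_dotProduct_le (v w : Fin n → ℝ) : |v ⬝ᵥ w| ≤ vnorm v * vnorm w := by
  have := abs_real_inner_le_norm (WithLp.toLp 2 w : EuclideanSpace ℝ (Fin n)) (WithLp.toLp 2 v)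
  rw [EuclideanSpace.inner_eq_star_dotProduct] at this
  simpa [vnorm, mul_comm] using this

theorem abs_bilin_le (X : Matrix (Fin n) (Fin n) ℝ) (v w : Fin n → ℝ) :
    |w ⬝ᵥ (X *ᵥ v)| ≤ ‖X‖ * vnorm w * vnorm v := by
  refine (abs_dotProduct_le _ _).trans ?_
  have := mul_le_mul_of_nonneg_left (vnorm_mulVec_le X v) (vnorm_nonneg w)
  linarith

theorem abs_qf_le (X : Matrix (Fin n) (Fin n) ℝ) (v : Fin n → ℝ) :
    |qf X v| ≤ ‖X‖ * vnorm v ^ 2 := by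
  have := abs_bilin_le X v v
  rw [qf]; nlinarith

theorem norm_transpose_eq (X : Matrix (Fin n) (Fin n) ℝ) : ‖Xᵀ‖ = ‖X‖ := by
  rw [← Matrix.l2_opNorm_conjTranspose X, Matrix.conjTranspose_eq_transpose_of_trivial]

@[simp] theorem qf_one (v : Fin n → ℝ) : qf 1 v = vnorm v ^ 2 := by simp [qf, vnorm_sq]
theorem qf_add (X Y : Matrix (Fin n) (Fin n) ℝ) (v) : qf (X + Y) v = qf X v + qf Y v := by
  simp [qf, Matrix.add_mulVec]
theorem qf_sub (X Y : Matrix (Fin n) (Fin n) ℝ) (v) : qf (X - Y) v = qf X v - qf Y v := by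
  simp [qf, Matrix.sub_mulVec]
theorem qf_neg (X : Matrix (Fin n) (Fin n) ℝ) (v) : qf (-X) v = -qf X v := by
  simp [qf, Matrix.neg_mulVec]
theorem qf_smul (c : ℝ) (X : Matrix (Fin n) (Fin n) ℝ) (v) : qf (c • X) v = c * qf X v := by
  simp [qf, Matrix.smul_mulVec]
theorem qf_sum {ι : Type*} (s : Finset ι) (X : ι → Matrix (Fin n) (Fin n) ℝ) (v) :
    qf (∑ i ∈ s, X i) v = ∑ i ∈ s, qf (X i) v := by
  simp [qf, Matrix.sum_mulVec, dotProduct_sum]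

theorem qf_transpose (X : Matrix (Fin n) (Fin n) ℝ) (v) : qf Xᵀ v = qf X v := by
  rw [qf, qf, Matrix.mulVec_transpose, Matrix.dotProduct_mulVec, dotProduct_comm]

theorem qf_conj (U X : Matrix (Fin n) (Fin n) ℝ) (v) : qf (U * X * Uᵀ) v = qf X (Uᵀ *ᵥ v) := by
  simp only [qf, ← Matrix.mulVec_mulVec]
  rw [Matrix.dotProduct_mulVec, ← Matrix.mulVec_transpose]

theorem qf_mul_left (A X : Matrix (Fin n) (Fin n) ℝ) (v) :
    qf (A * X) v = (Aᵀ *ᵥ v) ⬝ᵥ (X *ᵥ v) := by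
  simp only [qf, ← Matrix.mulVec_mulVec]
  rw [Matrix.dotProduct_mulVec, ← Matrix.mulVec_transpose]

theorem dotProduct_mulVec_symm {X : Matrix (Fin n) (Fin n) ℝ} (hX : X.IsSymm) (v w : Fin n → ℝ) :
    v ⬝ᵥ (X *ᵥ w) = w ⬝ᵥ (X *ᵥ v) := by
  rw [Matrix.dotProduct_mulVec, ← Matrix.mulVec_transpose, hX.eq, dotProduct_comm]

theorem qf_mul_right {X : Matrix (Fin n) (Fin n) ℝ} (hX : X.IsSymm) (A : Matrix (Fin n) (Fin n) ℝ)
    (v) : qf (X * A) v = ((A *ᵥ v) ⬝ᵥ (X *ᵥ v)) := by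
  rw [← qf_transpose, Matrix.transpose_mul, qf_mul_left, hX.eq, Matrix.transpose_transpose]

/-- The quadratic form at `v` as a continuous linear functional. -/
noncomputable def qfL (v : Fin n → ℝ) : Matrix (Fin n) (Fin n) ℝ →L[ℝ] ℝ :=
  LinearMap.toContinuousLinearMap
    { toFun := fun X => qf X v
      map_add' := fun X Y => qf_add X Y v
      map_smul' := fun c X => qf_smul c X v }

@[simp] theorem qfL_apply (v : Fin n → ℝ) (X : Matrix (Fin n) (Fin n) ℝ) : qfL v X = qf X v := rfl

theorem posSemidef_iff_qf {X : Matrix (Fin n) (Fin n) ℝ} :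
    X.PosSemidef ↔ X.IsSymm ∧ ∀ v, 0 ≤ qf X v := by
  rw [Matrix.posSemidef_iff_dotProduct_mulVec]
  simp [qf, Matrix.IsHermitian, Matrix.IsSymm]

theorem posDef_iff_qf {X : Matrix (Fin n) (Fin n) ℝ} :
    X.PosDef ↔ X.IsSymm ∧ ∀ v, v ≠ 0 → 0 < qf X v := by
  rw [Matrix.posDef_iff_dotProduct_mulVec]
  simp [qf, Matrix.IsHermitian, Matrix.IsSymm]

theorem _root_.Matrix.PosSemidef.isSymm {X : Matrix (Fin n) (Fin n) ℝ} (h : X.PosSemidef) :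
    X.IsSymm := (posSemidef_iff_qf.1 h).1

theorem _root_.Matrix.PosSemidef.qf_nonneg {X : Matrix (Fin n) (Fin n) ℝ} (h : X.PosSemidef) (v) :
    0 ≤ qf X v := (posSemidef_iff_qf.1 h).2 v

theorem isClosed_posSemidef : IsClosed {X : Matrix (Fin n) (Fin n) ℝ | X.PosSemidef} := by
  have : {X : Matrix (Fin n) (Fin n) ℝ | X.PosSemidef}
      = {X | Xᵀ = X} ∩ ⋂ v, {X | 0 ≤ qfL v X} := by
    ext X; simp [posSemidef_iff_qf, Matrix.IsSymm]
  rw [this]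
  refine (isClosed_eq (by fun_prop) continuous_id).inter (isClosed_iInter fun v => ?_)
  exact isClosed_le continuous_const (qfL v).continuous

/-- A positive semidefinite matrix whose quadratic form is at most `c|v|²` has norm at most `c`. -/
theorem norm_le_of_qf_le {X : Matrix (Fin n) (Fin n) ℝ} (hX : X.PosSemidef) {c : ℝ} (hc : 0 ≤ c)
    (h : ∀ v, qf X v ≤ c * vnorm v ^ 2) : ‖X‖ ≤ c := by
  obtain ⟨B, rfl⟩ : ∃ B : Matrix (Fin n) (Fin n) ℝ, X = Bᴴ * B := by
    open scoped MatrixOrder in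
    obtain ⟨B, hB⟩ := CStarAlgebra.nonneg_iff_eq_star_mul_self.mp hX.nonneg
    exact ⟨B, hB⟩
  -- By the C⋆-identity it is enough to bound the factor by `√c`, and `|B x|²` is the quadratic form
  -- of `Bᴴ B` at `x`.
  rw [Matrix.l2_opNorm_conjTranspose_mul_self]
  have hB : ‖B‖ ≤ √c := by
    rw [Matrix.cstar_norm_def]
    refine ContinuousLinearMap.opNorm_le_bound _ (Real.sqrt_nonneg _) fun x => ?_
    refine abs_le_of_sq_le_sq' ?_ (by positivity) |>.2
    have h1 := h x.ofLp
    have h2 : ‖Matrix.toEuclideanCLM (n := Fin n) (𝕜 := ℝ) B x‖ ^ 2 = qf (Bᴴ * B) x.ofLp := by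
      rw [Matrix.conjTranspose_eq_transpose_of_trivial, qf_mul_left, Matrix.transpose_transpose,
        ← vnorm_sq, vnorm]
      congr 2
    rw [h2, mul_pow, Real.sq_sqrt hc]
    exact h1
  calc ‖B‖ * ‖B‖ ≤ √c * √c := by gcongr
    _ = c := Real.mul_self_sqrt hc

theorem norm_le_norm_of_posSemidef {X Z : Matrix (Fin n) (Fin n) ℝ} (hX : X.PosSemidef)
    (h : ∀ v, qf X v ≤ qf Z v) : ‖X‖ ≤ ‖Z‖ :=
  norm_le_of_qf_le hX (norm_nonneg _) fun v =>
    (h v).trans ((le_abs_self _).trans (abs_qf_le _ _))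

/-- The largest value of the quadratic form on the unit ball, i.e. the positive part of the largest
eigenvalue of a symmetric matrix. -/
noncomputable def lamPos (D : Matrix (Fin n) (Fin n) ℝ) : ℝ := sSup (qf D '' {v | vnorm v ≤ 1})

theorem bddAbove_lamPos (D : Matrix (Fin n) (Fin n) ℝ) :
    BddAbove (qf D '' {v | vnorm v ≤ 1}) := by
  refine ⟨‖D‖, ?_⟩
  rintro _ ⟨v, hv, rfl⟩
  have h1 := (le_abs_self _).trans (abs_qf_le D v)
  have h2 : vnorm v ^ 2 ≤ 1 := pow_le_one₀ (vnorm_nonneg v) hv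
  nlinarith [norm_nonneg D]

theorem vnorm_zero : vnorm (0 : Fin n → ℝ) = 0 := by simp [vnorm]

theorem vnorm_eq_zero {v : Fin n → ℝ} : vnorm v = 0 ↔ v = 0 := by
  simp [vnorm]

theorem lamPos_nonneg (D : Matrix (Fin n) (Fin n) ℝ) : 0 ≤ lamPos D :=
  le_csSup (bddAbove_lamPos D) ⟨0, by simp [vnorm_zero], by simp [qf]⟩

theorem qf_smul_right (D : Matrix (Fin n) (Fin n) ℝ) (c : ℝ) (v) :
    qf D (c • v) = c ^ 2 * qf D v := by
  simp [qf, Matrix.mulVec_smul]; ring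

theorem qf_le_lamPos (D : Matrix (Fin n) (Fin n) ℝ) (v) : qf D v ≤ lamPos D * vnorm v ^ 2 := by
  by_cases hv : v = 0
  · simp [hv, qf, vnorm_zero]
  have h0 : 0 < vnorm v := lt_of_le_of_ne (vnorm_nonneg v) fun h => hv (vnorm_eq_zero.1 h.symm)
  have h1 : qf D ((vnorm v)⁻¹ • v) ≤ lamPos D := by
    refine le_csSup (bddAbove_lamPos D) ⟨_, ?_, rfl⟩
    simp [vnorm_smul, abs_of_pos h0, h0.ne']
  rw [qf_smul_right] at h1
  have : qf D v = (vnorm v)⁻¹ ^ 2 * qf D v * vnorm v ^ 2 := by field_simp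
  rw [this]; gcongr

theorem lamPos_le {D : Matrix (Fin n) (Fin n) ℝ} {e : ℝ} (h : ∀ v, vnorm v ≤ 1 → qf D v ≤ e) :
    lamPos D ≤ e :=
  csSup_le ⟨_, 0, by simp [vnorm_zero], rfl⟩ (by rintro _ ⟨v, hv, rfl⟩; exact h v hv)

theorem lamPos_le_of_forall {D : Matrix (Fin n) (Fin n) ℝ} {e : ℝ} (he : 0 ≤ e)
    (h : ∀ v, qf D v ≤ e * vnorm v ^ 2) : lamPos D ≤ e :=
  lamPos_le fun v hv => (h v).trans
    (mul_le_of_le_one_right he (pow_le_one₀ (vnorm_nonneg v) hv))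

theorem lamPos_le_norm (D : Matrix (Fin n) (Fin n) ℝ) : lamPos D ≤ ‖D‖ :=
  lamPos_le_of_forall (norm_nonneg _) fun v => (le_abs_self _).trans (abs_qf_le D v)

theorem lamPos_le_add (D E : Matrix (Fin n) (Fin n) ℝ) : lamPos D ≤ lamPos E + ‖D - E‖ := by
  refine lamPos_le_of_forall (add_nonneg (lamPos_nonneg _) (norm_nonneg _)) fun v => ?_
  have h1 := qf_le_lamPos E v
  have h2 := (le_abs_self _).trans (abs_qf_le (D - E) v)
  rw [qf_sub] at h2
  linarith

theorem continuous_lamPos : Continuous (lamPos : Matrix (Fin n) (Fin n) ℝ → ℝ) := by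
  refine (LipschitzWith.of_le_add_mul 1 fun D E => ?_).continuous
  rw [dist_eq_norm]; simpa using lamPos_le_add D E

/-- The Kalman gain `P Hᵀ (H P Hᵀ + R)⁻¹`. -/
noncomputable def Model.gain (S : Model n M) (j : Fin M) (P : Matrix (Fin n) (Fin n) ℝ) :
    Matrix (Fin n) (Fin (S.m j)) ℝ :=
  P * (S.H j)ᵀ * (S.H j * P * (S.H j)ᵀ + S.R j)⁻¹

variable (S : Model n M) (j : Fin M)

theorem Model.innovation_posDef {P : Matrix (Fin n) (Fin n) ℝ} (hP : P.PosSemidef) :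
    (S.H j * P * (S.H j)ᵀ + S.R j).PosDef := by
  refine Matrix.PosDef.posSemidef_add ?_ (S.R_posDef j)
  have := hP.mul_mul_conjTranspose_same (S.H j)
  rwa [Matrix.conjTranspose_eq_transpose_of_trivial] at this

theorem Model.posSemidef_g {P : Matrix (Fin n) (Fin n) ℝ} (hP : P.PosSemidef) :
    (S.g j P).PosSemidef := by
  have h := ((S.innovation_posDef j hP).inv.posSemidef).mul_mul_conjTranspose_same (P * (S.H j)ᵀ)
  rw [Matrix.conjTranspose_eq_transpose_of_trivial, Matrix.transpose_mul, hP.isSymm.eq,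
    Matrix.transpose_transpose] at h
  simpa only [Model.g, Matrix.mul_assoc] using h

theorem Model.infoGain_posSemidef : (S.infoGain j).PosSemidef := by
  have h := ((S.R_posDef j).inv.posSemidef).conjTranspose_mul_mul_same (S.H j)
  rwa [Matrix.conjTranspose_eq_transpose_of_trivial] at h

/-- The Woodbury identity. It is what makes measurements additive in information form. -/
theorem Model.inv_sub_g {P : Matrix (Fin n) (Fin n) ℝ} (hP : P.PosDef) :
    (P - S.g j P)⁻¹ = P⁻¹ + S.infoGain j := by
  have hT := S.innovation_posDef j hP.posSemidef
  have hR := S.R_posDef j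
  have hPu : IsUnit P.det := (Matrix.isUnit_iff_isUnit_det _).1 hP.isUnit
  have hRu : IsUnit (S.R j).det := (Matrix.isUnit_iff_isUnit_det _).1 hR.isUnit
  have h := Matrix.add_mul_mul_inv_eq_sub (A := P⁻¹) (U := (S.H j)ᵀ) (C := (S.R j)⁻¹) (V := S.H j)
    hP.inv.isUnit hR.inv.isUnit (by
      rw [Matrix.nonsing_inv_nonsing_inv _ hPu, Matrix.nonsing_inv_nonsing_inv _ hRu, add_comm]
      exact hT.isUnit)
  rw [Matrix.nonsing_inv_nonsing_inv _ hPu, Matrix.nonsing_inv_nonsing_inv _ hRu] at h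
  have h2 : P - S.g j P = (P⁻¹ + S.infoGain j)⁻¹ := by
    rw [Model.infoGain, h, Model.g, add_comm (S.R j)]
  rw [h2, Matrix.nonsing_inv_nonsing_inv]
  exact (Matrix.isUnit_iff_isUnit_det _).1
    (hP.inv.add_posSemidef (S.infoGain_posSemidef j)).isUnit

/-- Completing the square in `K`: the Kalman gain is the minimiser, and the defect is the innovation
covariance conjugated by the deviation of the gain. The cross terms collapse because `gain * T = P
Hᵀ`. -/
theorem Model.g_sub_eq {P : Matrix (Fin n) (Fin n) ℝ} (hP : P.PosSemidef)
    (K : Matrix (Fin n) (Fin (S.m j)) ℝ) :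
    S.g j P - (P - (1 - K * S.H j) * P * (1 - K * S.H j)ᵀ - K * S.R j * Kᵀ)
      = (S.gain j P - K) * (S.H j * P * (S.H j)ᵀ + S.R j) * (S.gain j P - K)ᵀ := by
  set T := S.H j * P * (S.H j)ᵀ + S.R j with hTdef
  have hT : T.PosDef := S.innovation_posDef j hP
  have hTu : IsUnit T.det := (Matrix.isUnit_iff_isUnit_det _).1 hT.isUnit
  have hTs : T⁻¹ᵀ = T⁻¹ := by
    rw [Matrix.transpose_nonsing_inv, hT.posSemidef.isSymm.eq]
  have hPs : Pᵀ = P := hP.isSymm.eq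
  have e1 : S.gain j P * T = P * (S.H j)ᵀ := by
    rw [Model.gain, Matrix.mul_assoc, Matrix.nonsing_inv_mul _ hTu, Matrix.mul_one]
  have e2 : T * (S.gain j P)ᵀ = S.H j * P := by
    rw [Model.gain, Matrix.transpose_mul, hTs, Matrix.transpose_mul, hPs,
      Matrix.transpose_transpose, ← Matrix.mul_assoc, Matrix.mul_nonsing_inv _ hTu, Matrix.one_mul]
  have e3 : S.g j P = S.gain j P * (S.H j * P) := by
    simp only [Model.g, Model.gain, Matrix.mul_assoc]
  have e4 : P * (S.H j)ᵀ * (S.gain j P)ᵀ = S.g j P := by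
    rw [← e1, Matrix.mul_assoc, e2, e3]
  have e5 : (S.gain j P - K) * T * (S.gain j P - K)ᵀ
      = S.g j P - P * (S.H j)ᵀ * Kᵀ - K * (S.H j * P) + K * T * Kᵀ := by
    rw [Matrix.transpose_sub, Matrix.mul_sub, Matrix.sub_mul, e1, Matrix.sub_mul, e4,
      Matrix.sub_mul, Matrix.mul_assoc K T (S.gain j P)ᵀ, e2]
    abel
  rw [e5, hTdef]
  simp only [Matrix.transpose_sub, Matrix.transpose_one, Matrix.transpose_mul, Matrix.sub_mul,
    Matrix.mul_sub, Matrix.one_mul, Matrix.mul_one, Matrix.mul_add, Matrix.add_mul,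
    Matrix.mul_assoc]
  abel

/-- Any gain `K` gives an upper bound `(1 - K H) P (1 - K H)ᵀ + K R Kᵀ` of the updated
covariance. -/
theorem Model.le_qf_g {P : Matrix (Fin n) (Fin n) ℝ} (hP : P.PosSemidef)
    (K : Matrix (Fin n) (Fin (S.m j)) ℝ) (v) :
    qf (P - (1 - K * S.H j) * P * (1 - K * S.H j)ᵀ - K * S.R j * Kᵀ) v ≤ qf (S.g j P) v := by
  have h := (S.innovation_posDef j hP).posSemidef.mul_mul_conjTranspose_same (S.gain j P - K)
  rw [Matrix.conjTranspose_eq_transpose_of_trivial, ← S.g_sub_eq j hP K] at h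
  have := h.qf_nonneg v
  rw [qf_sub (S.g j P)] at this
  linarith

/-- The Kalman gain attains the bound of `Model.le_qf_g`. -/
theorem Model.g_eq {P : Matrix (Fin n) (Fin n) ℝ} (hP : P.PosSemidef) :
    S.g j P = P - (1 - S.gain j P * S.H j) * P * (1 - S.gain j P * S.H j)ᵀ
      - S.gain j P * S.R j * (S.gain j P)ᵀ := by
  have := S.g_sub_eq j hP (S.gain j P)
  rwa [sub_self (S.gain j P), Matrix.zero_mul, Matrix.zero_mul, sub_eq_zero] at this

/-- Written with the optimal gain, `P - g_j(P)` is a sum of two positive semidefinite matrices. -/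
theorem Model.qf_g_le {P : Matrix (Fin n) (Fin n) ℝ} (hP : P.PosSemidef) (v) :
    qf (S.g j P) v ≤ qf P v := by
  rw [S.g_eq j hP, qf_sub, qf_sub]
  have h1 := (hP.mul_mul_conjTranspose_same (1 - S.gain j P * S.H j)).qf_nonneg v
  have h2 := ((S.R_posDef j).posSemidef.mul_mul_conjTranspose_same (S.gain j P)).qf_nonneg v
  rw [Matrix.conjTranspose_eq_transpose_of_trivial] at h1 h2
  linarith

theorem Model.norm_g_le {P : Matrix (Fin n) (Fin n) ℝ} (hP : P.PosSemidef) :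
    ‖S.g j P‖ ≤ ‖P‖ :=
  norm_le_norm_of_posSemidef (S.posSemidef_g j hP) (S.qf_g_le j hP)

/-- The tangent bound of the inverse: `2V - V Y V ⪯ Y⁻¹`. -/
theorem qf_tangent_le_inv {Y V : Matrix (Fin n) (Fin n) ℝ} (hY : Y.PosDef) (hV : V.IsSymm) (v) :
    qf ((2 : ℝ) • V - V * Y * V) v ≤ qf Y⁻¹ v := by
  have hYu : IsUnit Y.det := (Matrix.isUnit_iff_isUnit_det _).1 hY.isUnit
  have h := (hY.posSemidef.mul_mul_conjTranspose_same (Y⁻¹ - V)).qf_nonneg v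
  -- The gap in the tangent inequality is a congruence of `Y`, hence semidefinite.
  have e : (Y⁻¹ - V) * Y * (Y⁻¹ - V)ᴴ = Y⁻¹ - ((2 : ℝ) • V - V * Y * V) := by
    rw [Matrix.conjTranspose_eq_transpose_of_trivial, Matrix.transpose_sub, hV.eq,
      hY.inv.posSemidef.isSymm.eq, Matrix.sub_mul, Matrix.nonsing_inv_mul _ hYu, Matrix.sub_mul,
      Matrix.one_mul, Matrix.mul_sub, Matrix.mul_assoc V Y Y⁻¹, Matrix.mul_nonsing_inv _ hYu,
      Matrix.mul_one, two_smul]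
    abel
  rw [e, qf_sub] at h
  linarith

/-- The tangent bound of `Y ↦ Y Q Y`. -/
theorem qf_tangent_le_quadratic {Y Z Q : Matrix (Fin n) (Fin n) ℝ} (hQ : Q.PosSemidef)
    (hY : Y.IsSymm) (hZ : Z.IsSymm) (v) :
    qf (Y * Q * Z + Z * Q * Y - Z * Q * Z) v ≤ qf (Y * Q * Y) v := by
  have h := (hQ.mul_mul_conjTranspose_same (Y - Z)).qf_nonneg v
  have e : (Y - Z) * Q * (Y - Z)ᴴ = Y * Q * Y - (Y * Q * Z + Z * Q * Y - Z * Q * Z) := by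
    rw [Matrix.conjTranspose_eq_transpose_of_trivial, Matrix.transpose_sub, hY.eq, hZ.eq]
    noncomm_ring
  rw [e, qf_sub] at h
  linarith

theorem frob_add (W X Y : Matrix (Fin n) (Fin n) ℝ) : frob W (X + Y) = frob W X + frob W Y := by
  simp [frob, Matrix.mul_add]

theorem frob_sub (W X Y : Matrix (Fin n) (Fin n) ℝ) : frob W (X - Y) = frob W X - frob W Y := by
  simp [frob, Matrix.mul_sub]

theorem frob_smul (c : ℝ) (W X : Matrix (Fin n) (Fin n) ℝ) : frob W (c • X) = c * frob W X := by
  simp [frob]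

theorem frob_eq_sum (W X : Matrix (Fin n) (Fin n) ℝ) : frob W X = ∑ i, ∑ k, W k i * X k i := by
  simp [frob, Matrix.trace, Matrix.mul_apply]

theorem frob_nonneg {W X : Matrix (Fin n) (Fin n) ℝ} (hW : W.PosSemidef) (hX : X.PosSemidef) :
    0 ≤ frob W X := by
  obtain ⟨B, rfl⟩ : ∃ B : Matrix (Fin n) (Fin n) ℝ, W = Bᴴ * B := by
    open scoped MatrixOrder in
    obtain ⟨B, hB⟩ := CStarAlgebra.nonneg_iff_eq_star_mul_self.mp hW.nonneg
    exact ⟨B, hB⟩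
  have h := (hX.mul_mul_conjTranspose_same B).trace_nonneg
  rwa [frob, hW.isSymm.eq, Matrix.mul_assoc, Matrix.trace_mul_comm]

theorem frob_le_frob {W X Y : Matrix (Fin n) (Fin n) ℝ} (hW : W.PosSemidef) (hX : X.IsSymm)
    (hY : Y.IsSymm) (h : ∀ v, qf X v ≤ qf Y v) : frob W X ≤ frob W Y := by
  have := frob_nonneg hW (X := Y - X)
    (posSemidef_iff_qf.2 ⟨hY.sub hX, fun v => by rw [qf_sub]; linarith [h v]⟩)
  rw [frob_sub] at this
  linarith

/-- `X ↦ ⟨W, X⟩` as a continuous linear functional. -/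
noncomputable def frobL (W : Matrix (Fin n) (Fin n) ℝ) : Matrix (Fin n) (Fin n) ℝ →L[ℝ] ℝ :=
  LinearMap.toContinuousLinearMap
    { toFun := fun X => frob W X
      map_add' := fun X Y => frob_add W X Y
      map_smul' := fun c X => frob_smul c W X }

/-- The entry `X i k` as a continuous linear functional. -/
noncomputable def entryL (i k : Fin n) : Matrix (Fin n) (Fin n) ℝ →L[ℝ] ℝ :=
  LinearMap.toContinuousLinearMap
    { toFun := fun X => X i k
      map_add' := fun _ _ => rfl
      map_smul' := fun _ _ => rfl }

@[simp] theorem entryL_apply (i k : Fin n) (X : Matrix (Fin n) (Fin n) ℝ) :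
    entryL i k X = X i k := rfl

end LinearAlgebra

end CDKF

namespace CDKF

/-! ### Comparison principle for symmetric matrix paths. -/

section Comparison

open scoped Matrix.Norms.L2Operator

variable {n M : ℕ}

theorem qf_add_smul {X : Matrix (Fin n) (Fin n) ℝ} (hX : X.IsSymm) (v w : Fin n → ℝ) (h : ℝ) :
    qf X (v + h • w) = qf X v + h * (2 * (w ⬝ᵥ (X *ᵥ v))) + h ^ 2 * qf X w := by
  have := dotProduct_mulVec_symm hX v w
  simp only [qf, Matrix.mulVec_add, Matrix.mulVec_smul, dotProduct_add, add_dotProduct,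
    dotProduct_smul, smul_dotProduct, smul_eq_mul, this]
  ring

/-- One Euler step of the comparison. The term `2 h ⟨w, D v⟩` is the first-order change of the form
when `v` moves to `v + h w`, a vector of norm at most `1 + h K`; so it costs only the factor `(1 + h
K)²` on the eigenvalue and a remainder of order `h²`. Here `ω` is the oscillation of `D` over the
step. -/
theorem lamPos_step {T : ℝ} {D d : ℝ → Matrix (Fin n) (Fin n) ℝ}
    (hs : ∀ t ∈ Icc 0 T, (D t).IsSymm)
    (hint : ∀ v, IntervalIntegrable (fun u => qf (d u) v) volume 0 T)
    (hle : ∀ s t, 0 ≤ s → s ≤ t → t ≤ T → ∀ v,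
      qf (D t) v ≤ qf (D s) v + ∫ u in s..t, qf (d u) v)
    {K c ε : ℝ} (hK : 0 ≤ K) (hc : 0 ≤ c) (hε : 0 ≤ ε)
    (hb : ∀ᵐ u ∂(volume.restrict (Icc 0 T)), ∀ v, ∃ w, vnorm w ≤ K * vnorm v ∧
      qf (d u) v ≤ 2 * (w ⬝ᵥ (D u *ᵥ v)) + (c * lamPos (D u) + ε) * vnorm v ^ 2)
    {x h ω : ℝ} (hx : 0 ≤ x) (hh : 0 < h) (hxh : x + h ≤ T)
    (hω : ∀ u ∈ Icc x (x + h), ‖D u - D x‖ ≤ ω) :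
    lamPos (D (x + h)) ≤ (1 + h * K) ^ 2 * lamPos (D x) + h ^ 2 * K ^ 2 * ‖D x‖
      + h * (2 * K * ω + c * (lamPos (D x) + ω) + ε) := by
  refine lamPos_le fun v hv => ?_
  set f := lamPos (D x)
  have hf0 : 0 ≤ f := lamPos_nonneg _
  have hω0 : 0 ≤ ω := (norm_nonneg _).trans (hω x ⟨le_rfl, by linarith⟩)
  set E := (1 + h * K) ^ 2 * f - qf (D x) v + h ^ 2 * K ^ 2 * ‖D x‖
  set C := E / h + (2 * K * ω + c * (f + ω) + ε)
  have hv0 := vnorm_nonneg v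
  have hv2 : vnorm v ^ 2 ≤ 1 := pow_le_one₀ hv0 hv
  -- The vector `w` depends on `u` with no measurability, so the integrand is first bounded by a
  -- constant free of `w`.
  have key : ∀ᵐ u ∂(volume.restrict (Icc x (x + h))), qf (d u) v ≤ C := by
    have h1 := ae_restrict_of_ae_restrict_of_subset (Icc_subset_Icc hx hxh) hb
    filter_upwards [h1, ae_restrict_mem measurableSet_Icc] with u hu hmem
    obtain ⟨w, hw, hdu⟩ := hu v
    have hw1 : vnorm w ≤ K := hw.trans (mul_le_of_le_one_right hK hv)
    have hw0 := vnorm_nonneg w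
    have hDu := hω u hmem
    have e1 : w ⬝ᵥ (D u *ᵥ v) ≤ w ⬝ᵥ (D x *ᵥ v) + K * ω := by
      have h2 := (le_abs_self _).trans (abs_bilin_le (D u - D x) v w)
      rw [Matrix.sub_mulVec, dotProduct_sub] at h2
      have h3 : ‖D u - D x‖ * vnorm w * vnorm v ≤ ω * K * 1 := by gcongr
      linarith
    have e2 : lamPos (D u) ≤ f + ω := (lamPos_le_add _ _).trans (by gcongr)
    have e3 : (c * lamPos (D u) + ε) * vnorm v ^ 2 ≤ c * (f + ω) + ε := by
      have h2 : c * lamPos (D u) + ε ≤ c * (f + ω) + ε := by gcongr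
      have h3 : 0 ≤ c * lamPos (D u) + ε := by have := lamPos_nonneg (D u); positivity
      nlinarith
    -- Expand the form at `v + h w` and bound it by the largest eigenvalue; `E` retains `-qf (D x)
    -- v`, which cancels the starting value after integration.
    have e4 : h * (2 * (w ⬝ᵥ (D x *ᵥ v))) ≤ E := by
      have h2 := qf_add_smul (hs x ⟨hx, by linarith⟩) v w h
      have h3 := qf_le_lamPos (D x) (v + h • w)
      have h4 : vnorm (v + h • w) ≤ 1 + h * K := by
        refine (vnorm_add_le _ _).trans ?_
        rw [vnorm_smul, abs_of_pos hh]; gcongr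
      have h5 : lamPos (D x) * vnorm (v + h • w) ^ 2 ≤ f * (1 + h * K) ^ 2 := by
        have := vnorm_nonneg (v + h • w)
        gcongr
      have h6 := (neg_le_abs _).trans (abs_qf_le (D x) w)
      have h7 : ‖D x‖ * vnorm w ^ 2 ≤ ‖D x‖ * K ^ 2 := by gcongr
      have h8 : h ^ 2 * -(qf (D x) w) ≤ h ^ 2 * (‖D x‖ * K ^ 2) := by gcongr; linarith
      simp only [E]; linarith
    have e5 : 2 * (w ⬝ᵥ (D x *ᵥ v)) ≤ E / h := by
      rw [le_div_iff₀ hh]; linarith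
    simp only [C]; linarith
  have hi : IntervalIntegrable (fun u => qf (d u) v) volume x (x + h) :=
    (hint v).mono_set (by
      rw [uIcc_of_le (by linarith), uIcc_of_le (by linarith)]; exact Icc_subset_Icc hx hxh)
  have hI : ∫ u in x..(x + h), qf (d u) v ≤ ∫ u in x..(x + h), C :=
    intervalIntegral.integral_mono_ae_restrict (by linarith) hi (by simp) key
  rw [intervalIntegral.integral_const, smul_eq_mul, add_sub_cancel_left] at hI
  have h1 := hle x (x + h) hx (by linarith) hxh v
  have h2 : h * C = E + h * (2 * K * ω + c * (f + ω) + ε) := by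
    simp only [C]; field_simp
  simp only [E] at h2
  linarith

/-- Comparison principle for symmetric matrix paths: the largest eigenvalue of a solution of a
linear cross-positive differential inequality grows at most exponentially. -/
theorem lamPos_le_gronwallBound {T : ℝ} {D d : ℝ → Matrix (Fin n) (Fin n) ℝ}
    (hD : ContinuousOn D (Icc 0 T)) (hs : ∀ t ∈ Icc 0 T, (D t).IsSymm)
    (hint : ∀ v, IntervalIntegrable (fun u => qf (d u) v) volume 0 T)
    (hle : ∀ s t, 0 ≤ s → s ≤ t → t ≤ T → ∀ v,
      qf (D t) v ≤ qf (D s) v + ∫ u in s..t, qf (d u) v)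
    {K c ε : ℝ} (hK : 0 ≤ K) (hc : 0 ≤ c) (hε : 0 ≤ ε)
    (hb : ∀ᵐ u ∂(volume.restrict (Icc 0 T)), ∀ v, ∃ w, vnorm w ≤ K * vnorm v ∧
      qf (d u) v ≤ 2 * (w ⬝ᵥ (D u *ᵥ v)) + (c * lamPos (D u) + ε) * vnorm v ^ 2) :
    ∀ t ∈ Icc 0 T, lamPos (D t) ≤ gronwallBound (lamPos (D 0)) (2 * K + c) ε t := by
  have := le_gronwallBound_of_liminf_deriv_right_le (f := fun t => lamPos (D t))
    (f' := fun t => (2 * K + c) * lamPos (D t) + ε) (a := 0) (b := T) (δ := lamPos (D 0))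
    (K := 2 * K + c) (ε := ε)
    (continuous_lamPos.comp_continuousOn hD) ?_ le_rfl (fun _ _ => le_rfl)
  · simpa using this
  intro x hx r hr
  refine Eventually.frequently ?_
  set f := lamPos (D x)
  have hf0 : 0 ≤ f := lamPos_nonneg _
  -- The slack in the Dini derivative bound. The choices of `ω` and of the step length below make
  -- the oscillation error and the quadratic error each at most `η / 4`.
  set η := r - ((2 * K + c) * f + ε)
  have hη : 0 < η := sub_pos.2 hr
  have hcw : ContinuousWithinAt D (Icc x T) x :=
    (hD x ⟨hx.1, hx.2.le⟩).mono (Icc_subset_Icc_left hx.1)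
  set ω := η / (4 * (2 * K + c + 1))
  have hω : 0 < ω := by positivity
  obtain ⟨δ, hδ, hball⟩ := Metric.continuousWithinAt_iff.1 hcw ω hω
  set B := K ^ 2 * (f + ‖D x‖) + 1
  have hB : 0 < B := by positivity
  have hmem : Ioo x (min (min T (x + δ)) (x + η / (4 * B))) ∈ 𝓝[>] x := by
    apply Ioo_mem_nhdsGT
    have : 0 < η / (4 * B) := by positivity
    simp only [lt_min_iff]; exact ⟨⟨hx.2, by linarith⟩, by linarith⟩
  filter_upwards [hmem] with z hz
  obtain ⟨hz1, hz2⟩ := hz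
  simp only [lt_min_iff] at hz2
  obtain ⟨⟨hzT, hzδ⟩, hzη⟩ := hz2
  have hh : 0 < z - x := by linarith
  have step := lamPos_step hs hint hle hK hc hε hb (x := x) (h := z - x) (ω := ω) hx.1 hh
    (by linarith) (by
      intro u hu
      rw [← dist_eq_norm]
      refine (hball ⟨hu.1, by linarith [hu.2]⟩ ?_).le
      rw [Real.dist_eq, abs_of_nonneg (by linarith [hu.1])]; linarith [hu.2])
  rw [add_sub_cancel] at step
  set h := z - x
  have e1 : h⁻¹ * (lamPos (D z) - lamPos (D x))
      ≤ (2 * K + c) * f + ε + h * (K ^ 2 * (f + ‖D x‖)) + (2 * K + c) * ω := by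
    rw [inv_mul_le_iff₀ hh]
    nlinarith
  have e2 : h * (K ^ 2 * (f + ‖D x‖)) ≤ η / 4 := by
    have h1 : h ≤ η / (4 * B) := by simp only [h]; linarith
    calc h * (K ^ 2 * (f + ‖D x‖)) ≤ η / (4 * B) * B := by
          gcongr; simp only [B]; linarith
      _ = η / 4 := by field_simp
  have e3 : (2 * K + c) * ω ≤ η / 4 := by
    calc (2 * K + c) * ω ≤ (2 * K + c + 1) * ω :=
          mul_le_mul_of_nonneg_right (by linarith) hω.le
      _ = η / 4 := by simp only [ω]; field_simp
  have e4 : r = η + ((2 * K + c) * f + ε) := by simp only [η]; ring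
  change h⁻¹ * (lamPos (D z) - lamPos (D x)) < r
  linarith

end Comparison

end CDKF

namespace CDKF

/-! ### Comparison with the two surrogates, and positivity of the information surrogate. -/

section Surrogates

open scoped Matrix.Norms.L2Operator

variable {n M : ℕ}

theorem matIntegral_eq {F : ℝ → Matrix (Fin n) (Fin n) ℝ} {t : ℝ}
    (hF : IntervalIntegrable F volume 0 t) : matIntegral F t = ∫ s in (0 : ℝ)..t, F s := by
  ext i k
  exact ((entryL i k).intervalIntegral_comp_comm hF)

theorem intervalIntegrable_mono {E : Type*} [NormedAddCommGroup E] {f : ℝ → E} {T s t : ℝ}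
    (hf : IntervalIntegrable f volume 0 T) (hs : 0 ≤ s) (hst : s ≤ t) (ht : t ≤ T) :
    IntervalIntegrable f volume s t :=
  hf.mono_set (by
    rw [uIcc_of_le hst, uIcc_of_le (hs.trans (hst.trans ht))]; exact Icc_subset_Icc hs ht)

theorem eq_add_integral {F X : ℝ → Matrix (Fin n) (Fin n) ℝ} {X₀ : Matrix (Fin n) (Fin n) ℝ}
    {T : ℝ} (hF : IntervalIntegrable F volume 0 T)
    (hX : ∀ t ∈ Icc 0 T, X t = X₀ + matIntegral F t) {s t : ℝ} (hs : 0 ≤ s) (hst : s ≤ t)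
    (ht : t ≤ T) : X t = X s + ∫ u in s..t, F u := by
  have h0s := intervalIntegrable_mono hF le_rfl hs (hst.trans ht)
  have hst' := intervalIntegrable_mono hF hs hst ht
  rw [hX t ⟨hs.trans hst, ht⟩, hX s ⟨hs, hst.trans ht⟩, matIntegral_eq h0s,
    matIntegral_eq (h0s.trans hst'), ← intervalIntegral.integral_add_adjacent_intervals h0s hst',
    add_assoc]

theorem qf_integral {F : ℝ → Matrix (Fin n) (Fin n) ℝ} {s t : ℝ}
    (hF : IntervalIntegrable F volume s t) (v : Fin n → ℝ) :
    qf (∫ u in s..t, F u) v = ∫ u in s..t, qf (F u) v :=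
  ((qfL v).intervalIntegral_comp_comm hF).symm

theorem _root_.IntervalIntegrable.qf {F : ℝ → Matrix (Fin n) (Fin n) ℝ} {s t : ℝ}
    (hF : IntervalIntegrable F volume s t) (v : Fin n → ℝ) :
    IntervalIntegrable (fun u => qf (F u) v) volume s t :=
  ⟨(qfL v).integrable_comp hF.1, (qfL v).integrable_comp hF.2⟩

theorem continuousAt_matrix_inv {m : ℕ} {X : Matrix (Fin m) (Fin m) ℝ} (hX : IsUnit X) :
    ContinuousAt (fun Y : Matrix (Fin m) (Fin m) ℝ => Y⁻¹) X := by
  have h1 : (fun Y : Matrix (Fin m) (Fin m) ℝ => Y⁻¹)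
      = fun Y => Ring.inverse Y.det • Y.adjugate := by ext1 Y; exact Matrix.inv_def Y
  have h2 : X.det ≠ 0 := ((Matrix.isUnit_iff_isUnit_det _).1 hX).ne_zero
  rw [h1]
  simp only [Ring.inverse_eq_inv']
  have hd : Continuous fun Y : Matrix (Fin m) (Fin m) ℝ => Y.det :=
    Continuous.matrix_det continuous_id
  have ha : Continuous fun Y : Matrix (Fin m) (Fin m) ℝ => Y.adjugate :=
    Continuous.matrix_adjugate continuous_id
  exact (hd.continuousAt.inv₀ h2).smul ha.continuousAt

theorem Model.continuousAt_gain (S : Model n M) (j : Fin M) {P : Matrix (Fin n) (Fin n) ℝ}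
    (hP : P.PosSemidef) : ContinuousAt (S.gain j) P := by
  have h1 : Continuous fun P : Matrix (Fin n) (Fin n) ℝ => S.H j * P * (S.H j)ᵀ + S.R j := by fun_prop
  have h2 : ContinuousAt (fun P : Matrix (Fin n) (Fin n) ℝ => (S.H j * P * (S.H j)ᵀ + S.R j)⁻¹) P :=
    ContinuousAt.comp (f := fun P : Matrix (Fin n) (Fin n) ℝ => S.H j * P * (S.H j)ᵀ + S.R j)
       (g := fun Y => Y⁻¹)
      (continuousAt_matrix_inv (S.innovation_posDef j hP).isUnit) h1.continuousAt
  have h3 : Continuous fun q : Matrix (Fin n) (Fin (S.m j)) ℝ × Matrix (Fin (S.m j)) (Fin (S.m j)) ℝ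
      => q.1 * q.2 := continuous_fst.matrix_mul continuous_snd
  have h4 : ContinuousAt (fun P : Matrix (Fin n) (Fin n) ℝ => P * (S.H j)ᵀ) P := by fun_prop
  exact h3.continuousAt.comp (f := fun P : Matrix (Fin n) (Fin n) ℝ =>
    (P * (S.H j)ᵀ, (S.H j * P * (S.H j)ᵀ + S.R j)⁻¹))
    (h4.prodMk h2)

theorem Model.continuousAt_g (S : Model n M) (j : Fin M) {P : Matrix (Fin n) (Fin n) ℝ}
    (hP : P.PosSemidef) : ContinuousAt (S.g j) P := by
  have h3 : Continuous fun q : Matrix (Fin n) (Fin (S.m j)) ℝ × Matrix (Fin n) (Fin n) ℝ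
      => q.1 * S.H j * q.2 :=
    (continuous_fst.matrix_mul continuous_const).matrix_mul continuous_snd
  exact h3.continuousAt.comp (f := fun P => (S.gain j P, P))
    ((S.continuousAt_gain j hP).prodMk continuousAt_id)

theorem IsAdmissible.integrableOn {T : ℝ} {lam : Fin M → ℝ → ℝ} (h : IsAdmissible T lam)
    (j : Fin M) : IntegrableOn (lam j) (Icc 0 T) := by
  obtain ⟨C, hC⟩ := h.essBounded j
  refine Integrable.of_bound (h.aestronglyMeasurable j) C ?_
  filter_upwards [hC, h.nonneg j] with t h1 h2
  rwa [Real.norm_eq_abs, abs_of_nonneg h2]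

theorem IsAdmissible.intervalIntegrable {T : ℝ} {lam : Fin M → ℝ → ℝ} (h : IsAdmissible T lam)
    (hT : 0 ≤ T) (j : Fin M) : IntervalIntegrable (lam j) volume 0 T := by
  rw [intervalIntegrable_iff_integrableOn_Icc_of_le hT]
  exact h.integrableOn j

theorem IsAdmissible.exists_bound {T : ℝ} {lam : Fin M → ℝ → ℝ} (h : IsAdmissible T lam) :
    ∃ L : ℝ, 0 ≤ L ∧ ∀ᵐ t ∂(volume.restrict (Icc 0 T)), ∀ j, 0 ≤ lam j t ∧ lam j t ≤ L := by
  choose C hC using h.essBounded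
  refine ⟨∑ j, |C j|, Finset.sum_nonneg fun j _ => abs_nonneg _, ?_⟩
  filter_upwards [ae_all_iff.2 hC, ae_all_iff.2 h.nonneg] with t h1 h2 j
  refine ⟨h2 j, (h1 j).trans ((le_abs_self _).trans ?_)⟩
  exact Finset.single_le_sum (f := fun j => |C j|) (fun j _ => abs_nonneg _) (Finset.mem_univ j)

theorem ContinuousOn.intervalIntegrable_Icc {E : Type*} [NormedAddCommGroup E] {f : ℝ → E} {T : ℝ}
    (hT : 0 ≤ T) (hf : ContinuousOn f (Icc 0 T)) : IntervalIntegrable f volume 0 T := by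
  refine ContinuousOn.intervalIntegrable ?_
  rwa [uIcc_of_le hT]

theorem IsAdmissible.intervalIntegrable_smul {E : Type*} [NormedAddCommGroup E] [NormedSpace ℝ E]
    {T : ℝ} {lam : Fin M → ℝ → ℝ}
    (h : IsAdmissible T lam) (hT : 0 ≤ T) (j : Fin M) {f : ℝ → E}
    (hf : ContinuousOn f (Icc 0 T)) : IntervalIntegrable (fun u => lam j u • f u) volume 0 T :=
  (h.intervalIntegrable hT j).smul_continuousOn (by rwa [uIcc_of_le hT])

theorem intervalIntegrable_finset_sum {ι E : Type*} [NormedAddCommGroup E]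
    {f : ι → ℝ → E} {s : Finset ι} {a b : ℝ}
    (h : ∀ i ∈ s, IntervalIntegrable (f i) volume a b) :
    IntervalIntegrable (fun u => ∑ i ∈ s, f i u) volume a b := by
  have := IntervalIntegrable.sum s h
  rwa [Finset.sum_fn] at this

theorem exists_norm_bound {E : Type*} [NormedAddCommGroup E] {f : ℝ → E} {T : ℝ}
    (hf : ContinuousOn f (Icc 0 T)) : ∃ C : ℝ, 0 ≤ C ∧ ∀ t ∈ Icc 0 T, ‖f t‖ ≤ C := by
  obtain ⟨C, hC⟩ := isCompact_Icc.exists_bound_of_continuousOn hf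
  exact ⟨max C 0, le_max_right _ _, fun t ht => (hC t ht).trans (le_max_left _ _)⟩

theorem IsCovSurrogate.continuousOn_g {S : Model n M} {T : ℝ} {lam : Fin M → ℝ → ℝ}
    {p : Matrix (Fin n) (Fin n) ℝ} {Z : ℝ → Matrix (Fin n) (Fin n) ℝ}
    (h : IsCovSurrogate T S lam p Z) (j : Fin M) : ContinuousOn (fun t => S.g j (Z t)) (Icc 0 T) :=
  fun t ht => (S.continuousAt_g j (h.posSemidef t ht)).comp_continuousWithinAt (h.continuousOn t ht)

theorem IsCovSurrogate.continuousOn_gain {S : Model n M} {T : ℝ} {lam : Fin M → ℝ → ℝ}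
    {p : Matrix (Fin n) (Fin n) ℝ} {Z : ℝ → Matrix (Fin n) (Fin n) ℝ}
    (h : IsCovSurrogate T S lam p Z) (j : Fin M) :
    ContinuousOn (fun t => S.gain j (Z t)) (Icc 0 T) :=
  fun t ht => (S.continuousAt_gain j (h.posSemidef t ht)).comp_continuousWithinAt
    (h.continuousOn t ht)

/-- Every concave majorant of the averaged covariance dynamics stays below the surrogate. -/
theorem IsCovSurrogate.exists_upper_bound {S : Model n M} {T : ℝ} (hT : 0 ≤ T)
    {lam : Fin M → ℝ → ℝ} (hlam : IsAdmissible T lam)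
    {p : Matrix (Fin n) (Fin n) ℝ} {Z : ℝ → Matrix (Fin n) (Fin n) ℝ}
    (hZ : IsCovSurrogate T S lam p Z) :
    ∃ C : ℝ, 0 ≤ C ∧ ∀ (b : ℝ), 0 ≤ b → ∀ (X : ℝ → Matrix (Fin n) (Fin n) ℝ)
      (γ : Fin M → ℝ → Matrix (Fin n) (Fin n) ℝ),
      ContinuousOn X (Icc 0 T) → (∀ t ∈ Icc 0 T, (X t).IsSymm) →
      (∀ j, ContinuousOn (γ j) (Icc 0 T)) →
      (∀ t ∈ Icc 0 T, X t = X 0 + ∫ u in (0 : ℝ)..t,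
        (S.A * X u + X u * S.Aᵀ + b • S.Q - ∑ j, lam j u • γ j u)) →
      (∀ j, ∀ u ∈ Icc 0 T, ∀ (K : Matrix (Fin n) (Fin (S.m j)) ℝ) v,
        qf (X u - (1 - K * S.H j) * X u * (1 - K * S.H j)ᵀ - b • (K * S.R j * Kᵀ)) v
          ≤ qf (γ j u) v) →
      ∀ t ∈ Icc 0 T, ∀ v, qf (X t) v ≤ b * qf (Z t) v + C * lamPos (X 0 - b • p) * vnorm v ^ 2 := by
  obtain ⟨L, hL0, hL⟩ := hlam.exists_bound
  have hV : ∀ j, ∃ k : ℝ, 0 ≤ k ∧ ∀ t ∈ Icc 0 T, ‖1 - S.gain j (Z t) * S.H j‖ ≤ k := fun j =>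
    exists_norm_bound (continuousOn_const.sub
      (((continuous_id.matrix_mul continuous_const : Continuous fun
        K : Matrix (Fin n) (Fin (S.m j)) ℝ => K * S.H j)).comp_continuousOn (hZ.continuousOn_gain j)))
  choose k hk0 hk using hV
  -- `Kc` bounds the displacement `Aᵀ v - ½ (∑ λ_j) v` relative to `v`; `c` bounds the feedback of
  -- the conjugations by `1 - gain * H`.
  set Kc := ‖S.A‖ + 1 / 2 * (M * L)
  set c := ∑ j, L * k j ^ 2
  have hKc : 0 ≤ Kc := by positivity
  have hc : 0 ≤ c := Finset.sum_nonneg fun j _ => by have := hk0 j; positivity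
  refine ⟨Real.exp ((2 * Kc + c) * T), (Real.exp_pos _).le, ?_⟩
  intro b hb X γ hX hXs hγ hXeq hγle t ht v
  set FX : ℝ → Matrix (Fin n) (Fin n) ℝ := fun u =>
    S.A * X u + X u * S.Aᵀ + b • S.Q - ∑ j, lam j u • γ j u
  set FZ : ℝ → Matrix (Fin n) (Fin n) ℝ := fun u =>
    S.A * Z u + Z u * S.Aᵀ + S.Q - ∑ j, lam j u • S.g j (Z u)
  have hFX : IntervalIntegrable FX volume 0 T := by
    refine IntervalIntegrable.sub (ContinuousOn.intervalIntegrable_Icc hT ?_)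
      (intervalIntegrable_finset_sum fun j _ => hlam.intervalIntegrable_smul hT j (hγ j))
    exact ((continuousOn_const.mul hX).add (hX.mul continuousOn_const)).add continuousOn_const
  have hFZ : IntervalIntegrable FZ volume 0 T := by
    refine IntervalIntegrable.sub (ContinuousOn.intervalIntegrable_Icc hT ?_)
      (intervalIntegrable_finset_sum fun j _ => hlam.intervalIntegrable_smul hT j (hZ.continuousOn_g j))
    exact ((continuousOn_const.mul hZ.continuousOn).add
      (hZ.continuousOn.mul continuousOn_const)).add continuousOn_const
  have hXeq' : ∀ t ∈ Icc 0 T, X t = X 0 + matIntegral FX t := fun t ht => by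
    rw [matIntegral_eq (intervalIntegrable_mono hFX le_rfl ht.1 ht.2)]; exact hXeq t ht
  have hFd : IntervalIntegrable (fun u => FX u - b • FZ u) volume 0 T := hFX.sub (hFZ.smul b)
  have main := lamPos_le_gronwallBound (T := T) (D := fun t => X t - b • Z t)
    (d := fun u => FX u - b • FZ u) (K := Kc) (c := c) (ε := 0)
    (hX.sub (hZ.continuousOn.const_smul b))
    (fun t ht => (hXs t ht).sub ((hZ.posSemidef t ht).isSymm.smul b))
    (fun v => hFd.qf v) ?_ hKc hc le_rfl ?_ t ht
  · rw [gronwallBound_ε0] at main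
    have h0 : Z 0 = p := by
      have := hZ.equation 0 ⟨le_rfl, hT⟩
      rw [this]; ext i k; simp [matIntegral]
    rw [h0] at main
    have h1 := qf_le_lamPos (X t - b • Z t) v
    rw [qf_sub, qf_smul] at h1
    have h2 : lamPos (X t - b • Z t) ≤ Real.exp ((2 * Kc + c) * T) * lamPos (X 0 - b • p) := by
      refine main.trans ?_
      rw [mul_comm]
      have := lamPos_nonneg (X 0 - b • p)
      have := ht.2
      gcongr
    have h3 := mul_le_mul_of_nonneg_right h2 (sq_nonneg (vnorm v))
    linarith
  · intro s t hs hst htT v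
    have e1 := eq_add_integral hFX hXeq' hs hst htT
    have e2 := eq_add_integral hFZ hZ.equation hs hst htT
    have i1 := intervalIntegrable_mono hFX hs hst htT
    have i2 := intervalIntegrable_mono hFZ hs hst htT
    have i3 : IntervalIntegrable (fun u => b • FZ u) volume s t := i2.smul b
    rw [← qf_integral (i1.sub i3), ← qf_add]
    refine le_of_eq (congrArg (fun Y => qf Y v) ?_)
    rw [intervalIntegral.integral_sub i1 i3, intervalIntegral.integral_smul, e1, e2,
      smul_add]
    abel
  · filter_upwards [hL, ae_restrict_mem measurableSet_Icc] with u hu hmem v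
    set D := X u - b • Z u
    have hDs : D.IsSymm := (hXs u hmem).sub ((hZ.posSemidef u hmem).isSymm.smul b)
    -- The second summand produces `-(∑ λ_j) qf D v`. This cannot be bounded through `lamPos D`,
    -- which says nothing about very negative values of the form, so it has to be moved into the
    -- displacement.
    refine ⟨S.Aᵀ *ᵥ v - (1 / 2 * ∑ j, lam j u) • v, ?_, ?_⟩
    · rw [sub_eq_add_neg, ← neg_smul]
      refine (vnorm_add_le _ _).trans ?_
      rw [vnorm_smul, abs_neg, add_mul]
      have h1 := vnorm_mulVec_le S.Aᵀ v
      rw [norm_transpose_eq] at h1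
      have h2 : ∑ j, lam j u ≤ M * L := by
        have := Finset.sum_le_card_nsmul Finset.univ (fun j => lam j u) L fun j _ => (hu j).2
        simpa using this
      have h3 : 0 ≤ ∑ j, lam j u := Finset.sum_nonneg fun j _ => (hu j).1
      rw [abs_of_nonneg (by positivity)]
      have := vnorm_nonneg v
      gcongr
    -- Insert the Kalman gain of the surrogate: it is optimal for `Z` and merely admissible for `γ`.
    -- Subtracting, the noise terms cancel and `D - V D Vᵀ` remains.
    · have key : ∀ j, lam j u * (qf D v - lamPos D * (k j ^ 2 * vnorm v ^ 2))
          ≤ lam j u * (qf (γ j u) v - b * qf (S.g j (Z u)) v) := by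
        intro j
        refine mul_le_mul_of_nonneg_left ?_ (hu j).1
        have h1 := hγle j u hmem (S.gain j (Z u)) v
        rw [S.g_eq j (hZ.posSemidef u hmem)]
        set V := 1 - S.gain j (Z u) * S.H j
        have h2 := qf_le_lamPos D (Vᵀ *ᵥ v)
        rw [← qf_conj] at h2
        have h3 : vnorm (Vᵀ *ᵥ v) ≤ k j * vnorm v := by
          refine (vnorm_mulVec_le _ _).trans ?_
          rw [norm_transpose_eq]
          exact mul_le_mul_of_nonneg_right (hk j u hmem) (vnorm_nonneg v)
        have h4 : lamPos D * vnorm (Vᵀ *ᵥ v) ^ 2 ≤ lamPos D * (k j ^ 2 * vnorm v ^ 2) := by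
          rw [← mul_pow]
          have := vnorm_nonneg (Vᵀ *ᵥ v)
          have := lamPos_nonneg D
          gcongr
        have h5 : qf (V * D * Vᵀ) v = qf (V * X u * Vᵀ) v - b * qf (V * Z u * Vᵀ) v := by
          rw [← qf_smul, ← qf_sub]
          congr 1
          simp [D, Matrix.mul_sub, Matrix.sub_mul]
        have h6 : qf D v = qf (X u) v - b * qf (Z u) v := by rw [qf_sub, qf_smul]
        simp only [qf_sub, qf_smul] at h1 ⊢
        linarith
      have h7 : qf (FX u - b • FZ u) v = 2 * ((S.Aᵀ *ᵥ v) ⬝ᵥ (D *ᵥ v))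
          - ∑ j, lam j u * (qf (γ j u) v - b * qf (S.g j (Z u)) v) := by
        have e : FX u - b • FZ u = S.A * D + D * S.Aᵀ
            - ∑ j, lam j u • (γ j u - b • S.g j (Z u)) := by
          have e2 : ∑ j, lam j u • (γ j u - b • S.g j (Z u))
              = ∑ j, lam j u • γ j u - b • ∑ j, lam j u • S.g j (Z u) := by
            rw [Finset.smul_sum, ← Finset.sum_sub_distrib]
            exact Finset.sum_congr rfl fun j _ => by rw [smul_sub, smul_comm b]
          rw [e2]
          simp only [FX, FZ, D, Matrix.mul_sub, Matrix.sub_mul, smul_sub, smul_add,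
            Matrix.mul_smul, Matrix.smul_mul]
          abel
        rw [e, qf_sub, qf_add, qf_mul_left, qf_mul_right hDs, qf_sum]
        simp only [qf_smul, qf_sub]
        ring
      rw [h7]
      have h8 := Finset.sum_le_sum fun j (_ : j ∈ Finset.univ) => key j
      have h9 : ∑ j, lam j u * (qf D v - lamPos D * (k j ^ 2 * vnorm v ^ 2))
          = (∑ j, lam j u) * qf D v - (∑ j, lam j u * k j ^ 2) * lamPos D * vnorm v ^ 2 := by
        simp only [Finset.sum_mul, ← Finset.sum_sub_distrib]
        exact Finset.sum_congr rfl fun j _ => by ring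
      have h10 : ∑ j, lam j u * k j ^ 2 ≤ c := Finset.sum_le_sum fun j _ => by
        have := (hu j).2; gcongr
      have h11 : (∑ j, lam j u * k j ^ 2) * lamPos D * vnorm v ^ 2 ≤ c * lamPos D * vnorm v ^ 2 := by
        have := lamPos_nonneg D; gcongr
      rw [sub_dotProduct, smul_dotProduct, smul_eq_mul]
      change _ ≤ 2 * (_ - _ * qf D v) + _
      linarith

/-- Every minorant of the information dynamics, linearised along the surrogate, stays below the
surrogate. -/
theorem IsInfoSurrogate.exists_upper_bound {S : Model n M} {T : ℝ} (hT : 0 ≤ T)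
    {lam : Fin M → ℝ → ℝ} (hlam : IsAdmissible T lam)
    {y : Matrix (Fin n) (Fin n) ℝ} {Z : ℝ → Matrix (Fin n) (Fin n) ℝ}
    (hZ : IsInfoSurrogate T S lam y Z) :
    ∃ C : ℝ, 0 ≤ C ∧ ∀ (b : ℝ), 0 ≤ b → ∀ (X : ℝ → Matrix (Fin n) (Fin n) ℝ),
      ContinuousOn X (Icc 0 T) → (∀ t ∈ Icc 0 T, (X t).IsSymm) →
      (∀ s t, 0 ≤ s → s ≤ t → t ≤ T → ∀ v, qf (X t) v ≤ qf (X s) v + ∫ u in s..t,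
        qf (-(X u * (S.A + S.Q * Z u)) - (S.A + S.Q * Z u)ᵀ * X u + b • (Z u * S.Q * Z u)
          + b • ∑ j, lam j u • S.infoGain j) v) →
      ∀ t ∈ Icc 0 T, ∀ v, qf (X t) v ≤ b * qf (Z t) v + C * lamPos (X 0 - b • y) * vnorm v ^ 2 := by
  have hGc : ContinuousOn (fun u => S.A + S.Q * Z u) (Icc 0 T) :=
    continuousOn_const.add (continuousOn_const.mul hZ.continuousOn)
  obtain ⟨Kc, hKc, hG⟩ := exists_norm_bound hGc
  refine ⟨Real.exp (2 * Kc * T), (Real.exp_pos _).le, ?_⟩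
  intro b hb X hX hXs hXle t ht v
  have hSum : IntervalIntegrable (fun u => ∑ j, lam j u • S.infoGain j) volume 0 T :=
    intervalIntegrable_finset_sum fun j _ => hlam.intervalIntegrable_smul hT j continuousOn_const
  set FX : ℝ → Matrix (Fin n) (Fin n) ℝ := fun u =>
    -(X u * (S.A + S.Q * Z u)) - (S.A + S.Q * Z u)ᵀ * X u + b • (Z u * S.Q * Z u)
          + b • ∑ j, lam j u • S.infoGain j
  set FZ : ℝ → Matrix (Fin n) (Fin n) ℝ := fun u =>
    -(Z u * S.A) - S.Aᵀ * Z u - Z u * S.Q * Z u + ∑ j, lam j u • S.infoGain j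
  have hZc := hZ.continuousOn
  have hFX : IntervalIntegrable FX volume 0 T := by
    refine IntervalIntegrable.add (ContinuousOn.intervalIntegrable_Icc hT ?_) (hSum.smul b)
    have hGt : ContinuousOn (fun u => (S.A + S.Q * Z u)ᵀ) (Icc 0 T) :=
      (continuous_id.matrix_transpose).comp_continuousOn hGc
    exact ((hX.mul hGc).neg.sub (hGt.mul hX)).add
      (((hZc.mul continuousOn_const).mul hZc).const_smul b)
  have hFZ : IntervalIntegrable FZ volume 0 T := by
    refine IntervalIntegrable.add (ContinuousOn.intervalIntegrable_Icc hT ?_) hSum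
    exact ((hZc.mul continuousOn_const).neg.sub (continuousOn_const.mul hZc)).sub
      ((hZc.mul continuousOn_const).mul hZc)
  have hFd : IntervalIntegrable (fun u => FX u - b • FZ u) volume 0 T := hFX.sub (hFZ.smul b)
  have main := lamPos_le_gronwallBound (T := T) (D := fun t => X t - b • Z t)
    (d := fun u => FX u - b • FZ u) (K := Kc) (c := 0) (ε := 0)
    (hX.sub (hZ.continuousOn.const_smul b))
    (fun t ht => (hXs t ht).sub ((hZ.symm t ht).smul b))
    (fun v => hFd.qf v) ?_ hKc le_rfl le_rfl ?_ t ht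
  · rw [gronwallBound_ε0, add_zero] at main
    have h0 : Z 0 = y := by
      have := hZ.equation 0 ⟨le_rfl, hT⟩
      rw [this]; ext i k; simp [matIntegral]
    rw [h0] at main
    have h1 := qf_le_lamPos (X t - b • Z t) v
    rw [qf_sub, qf_smul] at h1
    have h2 : lamPos (X t - b • Z t) ≤ Real.exp (2 * Kc * T) * lamPos (X 0 - b • y) := by
      refine main.trans ?_
      rw [mul_comm]
      have := lamPos_nonneg (X 0 - b • y)
      have := ht.2
      gcongr
    have h3 := mul_le_mul_of_nonneg_right h2 (sq_nonneg (vnorm v))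
    linarith
  · intro s t hs hst htT v
    have e1 := hXle s t hs hst htT v
    have e2 := eq_add_integral hFZ hZ.equation hs hst htT
    have i1 := intervalIntegrable_mono hFX hs hst htT
    have i2 := intervalIntegrable_mono hFZ hs hst htT
    rw [← qf_integral i1] at e1
    have i3 : IntervalIntegrable (fun u => b • FZ u) volume s t := i2.smul b
    rw [← qf_integral (i1.sub i3), intervalIntegral.integral_sub i1 i3,
      intervalIntegral.integral_smul, e2]
    simp only [qf_sub, qf_smul, qf_add]
    linarith
  · filter_upwards [ae_restrict_mem measurableSet_Icc] with u hmem v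
    set D := X u - b • Z u
    have hDs : D.IsSymm := (hXs u hmem).sub ((hZ.symm u hmem).smul b)
    set G := S.A + S.Q * Z u
    -- With the quadratic term linearised along `Z` itself, the difference obeys exactly `D' = -D G
    -- - Gᵀ D` with `G = A + Q Z`, so displacing `v` along `-G v` accounts for everything.
    refine ⟨-(G *ᵥ v), ?_, ?_⟩
    · rw [← neg_one_smul ℝ, vnorm_smul]
      simp only [abs_neg, abs_one, one_mul]
      exact (vnorm_mulVec_le _ _).trans
        (mul_le_mul_of_nonneg_right (hG u hmem) (vnorm_nonneg v))
    · have e : FX u - b • FZ u = -(D * G) - Gᵀ * D := by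
        simp only [FX, FZ, D, G, Matrix.mul_sub, Matrix.sub_mul, smul_sub, smul_add,
          Matrix.mul_smul, Matrix.smul_mul, Matrix.mul_add, Matrix.add_mul, Matrix.transpose_add,
          Matrix.transpose_mul, (hZ.symm u hmem).eq, S.Q_posSemidef.isSymm.eq, Matrix.mul_assoc,
          smul_neg]
        abel
      rw [e, qf_sub, qf_neg, qf_mul_right hDs, qf_mul_left, Matrix.transpose_transpose,
        neg_dotProduct]
      simp only [zero_mul, add_zero]
      linarith

/-- The tangent inequality for the inverse of `Y⁻¹` at `V = c • 1` gives `Y ⪰ 2c - c² Y⁻¹`, and `c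
‖Y⁻¹‖ ≤ 1` leaves at least `c`. -/
theorem exists_pos_le_qf {Y : Matrix (Fin n) (Fin n) ℝ} (hY : Y.PosDef) :
    ∃ ε : ℝ, 0 < ε ∧ ∀ v, ε * vnorm v ^ 2 ≤ qf Y v := by
  set N := ‖Y⁻¹‖
  set c := (N + 1)⁻¹
  have hN : 0 ≤ N := norm_nonneg _
  have hc : 0 < c := by positivity
  refine ⟨c, hc, fun v => ?_⟩
  have h := qf_tangent_le_inv hY.inv (V := c • (1 : Matrix (Fin n) (Fin n) ℝ))
    (Matrix.isSymm_one.smul c) v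
  rw [Matrix.nonsing_inv_nonsing_inv _ ((Matrix.isUnit_iff_isUnit_det _).1 hY.isUnit)] at h
  simp only [qf_sub, qf_smul, qf_one, Matrix.smul_mul, Matrix.mul_smul, Matrix.one_mul,
    Matrix.mul_one] at h
  have h1 := (le_abs_self _).trans (abs_qf_le Y⁻¹ v)
  have h2 : c * (c * qf Y⁻¹ v) ≤ c * (c * (N * vnorm v ^ 2)) := by gcongr
  have h3 : c * N ≤ 1 := by
    have : c * (N + 1) = 1 := inv_mul_cancel₀ (by positivity)
    linarith
  have h4 : c * N * (c * vnorm v ^ 2) ≤ 1 * (c * vnorm v ^ 2) := by gcongr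
  linarith

/-- The information surrogate stays positive definite. -/
theorem IsInfoSurrogate.posDef {S : Model n M} {T : ℝ} (hT : 0 ≤ T)
    {lam : Fin M → ℝ → ℝ} (hlam : IsAdmissible T lam)
    {y : Matrix (Fin n) (Fin n) ℝ} {Z : ℝ → Matrix (Fin n) (Fin n) ℝ}
    (hZ : IsInfoSurrogate T S lam y Z) (hy : y.PosDef) : ∀ t ∈ Icc 0 T, (Z t).PosDef := by
  obtain ⟨L, hL0, hL⟩ := hlam.exists_bound
  obtain ⟨ε, hε, hεy⟩ := exists_pos_le_qf hy
  have hZc := hZ.continuousOn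
  -- The factor one half splits `Z Q Z` evenly, so that with `G = A + ½ Q Z` the drift is `-Z G - Gᵀ
  -- Z` plus a semidefinite source.
  have hGc : ContinuousOn (fun u => S.A + (1 / 2 : ℝ) • (S.Q * Z u)) (Icc 0 T) := by
    fun_prop
  obtain ⟨Kc, hKc, hG⟩ := exists_norm_bound hGc
  have hSum : IntervalIntegrable (fun u => ∑ j, lam j u • S.infoGain j) volume 0 T :=
    intervalIntegrable_finset_sum fun j _ => hlam.intervalIntegrable_smul hT j continuousOn_const
  set FZ : ℝ → Matrix (Fin n) (Fin n) ℝ := fun u =>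
    -(Z u * S.A) - S.Aᵀ * Z u - Z u * S.Q * Z u + ∑ j, lam j u • S.infoGain j
  have hFZ : IntervalIntegrable FZ volume 0 T := by
    refine IntervalIntegrable.add (ContinuousOn.intervalIntegrable_Icc hT ?_) hSum
    exact ((hZc.mul continuousOn_const).neg.sub (continuousOn_const.mul hZc)).sub
      ((hZc.mul continuousOn_const).mul hZc)
  -- An exponentially decaying barrier: its rate `2 Kc` dominates the worst contraction by `G`, so
  -- `e 1 - Z` starts and remains nonpositive.
  set e : ℝ → ℝ := fun t => ε * Real.exp (-(2 * Kc) * t)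
  set e' : ℝ → ℝ := fun t => -(2 * Kc) * e t
  have he : ∀ t, HasDerivAt e (e' t) t := fun t => by
    have := (((hasDerivAt_id t).const_mul (-(2 * Kc))).exp).const_mul ε
    refine HasDerivAt.congr_deriv (f := e) this ?_
    simp only [e', e, id]; ring
  have hec : Continuous e := by fun_prop
  have he'c : Continuous e' := by fun_prop
  have he0 : ∀ t, 0 < e t := fun t => by positivity
  have i0 : ∀ s t, IntervalIntegrable (fun u => e' u • (1 : Matrix (Fin n) (Fin n) ℝ)) volume s t :=
    fun s t => (he'c.smul continuous_const).intervalIntegrable s t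
  intro t ht
  have main := lamPos_le_gronwallBound (T := T)
    (D := fun t => e t • (1 : Matrix (Fin n) (Fin n) ℝ) - Z t)
    (d := fun u => e' u • (1 : Matrix (Fin n) (Fin n) ℝ) - FZ u) (K := Kc) (c := 0) (ε := 0)
    ((hec.continuousOn.smul continuousOn_const).sub hZc)
    (fun t ht => (Matrix.isSymm_one.smul _).sub (hZ.symm t ht))
    (fun v => ((i0 0 T).sub hFZ).qf v) ?_ hKc le_rfl le_rfl ?_ t ht
  · rw [gronwallBound_ε0, add_zero] at main
    have h0 : Z 0 = y := by
      have := hZ.equation 0 ⟨le_rfl, hT⟩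
      rw [this]; ext i k; simp [matIntegral]
    have h00 : lamPos (e 0 • (1 : Matrix (Fin n) (Fin n) ℝ) - Z 0) ≤ 0 := by
      refine lamPos_le_of_forall le_rfl fun v => ?_
      rw [qf_sub, qf_smul, qf_one, h0]
      simpa [e] using hεy v
    have h1 : lamPos (e t • (1 : Matrix (Fin n) (Fin n) ℝ) - Z t) ≤ 0 :=
      main.trans (mul_nonpos_of_nonpos_of_nonneg h00 (Real.exp_pos _).le)
    refine posDef_iff_qf.2 ⟨hZ.symm t ht, fun v hv => ?_⟩
    have h2 := qf_le_lamPos (e t • (1 : Matrix (Fin n) (Fin n) ℝ) - Z t) v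
    rw [qf_sub, qf_smul, qf_one] at h2
    have h3 : 0 < vnorm v := lt_of_le_of_ne (vnorm_nonneg v) fun h => hv (vnorm_eq_zero.1 h.symm)
    have h4 : 0 < e t * vnorm v ^ 2 := by have := he0 t; positivity
    nlinarith [sq_nonneg (vnorm v)]
  · intro s t hs hst htT v
    have e2 := eq_add_integral hFZ hZ.equation hs hst htT
    have i2 := intervalIntegrable_mono hFZ hs hst htT
    rw [← qf_integral ((i0 s t).sub i2), intervalIntegral.integral_sub (i0 s t) i2, e2,
      intervalIntegral.integral_smul_const,
      intervalIntegral.integral_eq_sub_of_hasDerivAt (fun x _ => he x)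
        (he'c.intervalIntegrable s t)]
    simp only [qf_sub, qf_smul, qf_add]
    linarith
  · filter_upwards [ae_restrict_mem measurableSet_Icc, hL] with u hmem hu v
    set G := S.A + (1 / 2 : ℝ) • (S.Q * Z u)
    set D := e u • (1 : Matrix (Fin n) (Fin n) ℝ) - Z u
    refine ⟨-(G *ᵥ v), ?_, ?_⟩
    · rw [← neg_one_smul ℝ, vnorm_smul]
      simp only [abs_neg, abs_one, one_mul]
      exact (vnorm_mulVec_le _ _).trans
        (mul_le_mul_of_nonneg_right (hG u hmem) (vnorm_nonneg v))
    · have h1 : FZ u = -(Z u * G) - Gᵀ * Z u + ∑ j, lam j u • S.infoGain j := by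
        have h2 : (Z u * S.Q * Z u) = (1 / 2 : ℝ) • (Z u * S.Q * Z u)
            + (1 / 2 : ℝ) • (Z u * S.Q * Z u) := by rw [← add_smul]; norm_num
        simp only [FZ, G]
        rw [h2]
        simp only [Matrix.mul_add, Matrix.add_mul, Matrix.transpose_add, Matrix.transpose_smul,
          Matrix.transpose_mul, (hZ.symm u hmem).eq, S.Q_posSemidef.isSymm.eq, Matrix.mul_assoc,
          Matrix.mul_smul, Matrix.smul_mul]
        abel
      have h3 : 0 ≤ qf (∑ j, lam j u • S.infoGain j) v := by
        rw [qf_sum]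
        refine Finset.sum_nonneg fun j _ => ?_
        rw [qf_smul]
        exact mul_nonneg (hu j).1 ((S.infoGain_posSemidef j).qf_nonneg v)
      have h4 : (G *ᵥ v) ⬝ᵥ (D *ᵥ v) = e u * ((G *ᵥ v) ⬝ᵥ v) - (G *ᵥ v) ⬝ᵥ (Z u *ᵥ v) := by
        simp [D, Matrix.sub_mulVec, Matrix.smul_mulVec]
      have h5 : (G *ᵥ v) ⬝ᵥ v ≤ Kc * vnorm v ^ 2 := by
        have h6 := (le_abs_self _).trans (abs_dotProduct_le (G *ᵥ v) v)
        have h7 := (vnorm_mulVec_le G v).trans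
          (mul_le_mul_of_nonneg_right (hG u hmem) (vnorm_nonneg v))
        nlinarith [vnorm_nonneg v]
      have h6 : e u * ((G *ᵥ v) ⬝ᵥ v) ≤ e u * (Kc * vnorm v ^ 2) :=
        mul_le_mul_of_nonneg_left h5 (he0 u).le
      rw [h1, qf_sub, qf_smul, qf_one, qf_add, qf_sub, qf_neg,
        qf_mul_right (hZ.symm u hmem), qf_mul_left, Matrix.transpose_transpose, neg_dotProduct, h4]
      simp only [e']
      linarith

end Surrogates

end CDKF

namespace CDKF

/-! ### Counting paths and integrals against them. -/

section CountingPaths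

variable {E : Type*} [NormedAddCommGroup E] [NormedSpace ℝ E]

/-- The jump of a counting path. -/
noncomputable def jump (N : ℝ → ℕ) (s : ℝ) : ℝ := (N s : ℝ) - Function.leftLim (fun u => (N u : ℝ)) s

/-- A counting path on `[0,T]`: nondecreasing and right-continuous. -/
structure IsCountingPath (T : ℝ) (N : ℝ → ℕ) : Prop where
  mono : MonotoneOn N (Icc 0 T)
  rc : ∀ t ∈ Ico 0 T, ContinuousWithinAt N (Ici t) t

variable {T : ℝ} {N : ℝ → ℕ}

/-- A bounded set of naturals attains its supremum, so a monotone path is constant from the point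
where the supremum over `[0, t)` is reached. -/
theorem IsCountingPath.exists_left (h : IsCountingPath T N) {t : ℝ} (ht : t ∈ Ioc 0 T) :
    ∃ a ∈ Ico 0 t, ∀ u ∈ Ico a t, N u = N a := by
  have hne : (N '' Ico 0 t).Nonempty := ⟨N 0, 0, ⟨le_rfl, ht.1⟩, rfl⟩
  have hbd : BddAbove (N '' Ico 0 t) := by
    refine ⟨N t, ?_⟩
    rintro _ ⟨u, hu, rfl⟩
    exact h.mono ⟨hu.1, hu.2.le.trans ht.2⟩ ⟨ht.1.le, ht.2⟩ hu.2.le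
  obtain ⟨a, ha, hsup⟩ := Nat.sSup_mem hne hbd
  refine ⟨a, ha, fun u hu => le_antisymm ?_ ?_⟩
  · rw [hsup]; exact le_csSup hbd ⟨u, ⟨ha.1.trans hu.1, hu.2⟩, rfl⟩
  · exact h.mono ⟨ha.1, ha.2.le.trans ht.2⟩ ⟨ha.1.trans hu.1, hu.2.le.trans ht.2⟩ hu.1

theorem jump_eq_of_left {t a : ℝ} (hat : a < t) (h : ∀ u ∈ Ico a t, N u = N a) :
    jump N t = (N t : ℝ) - N a := by
  have : Tendsto (fun u => (N u : ℝ)) (𝓝[<] t) (𝓝 (N a : ℝ)) := by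
    refine tendsto_const_nhds.congr' ?_
    filter_upwards [Ico_mem_nhdsLT hat] with u hu
    rw [h u hu]
  rw [jump, leftLim_eq_of_tendsto this]

theorem IsCountingPath.exists_right (h : IsCountingPath T N) {t : ℝ} (ht : t ∈ Ico 0 T) :
    ∃ b ∈ Ioc t T, ∀ u ∈ Ico t b, N u = N t := by
  have h1 : ∀ᶠ u in 𝓝[≥] t, N u = N t := by
    have := (h.rc t ht).tendsto.eventually (p := fun k => k = N t)
      (by rw [nhds_discrete]; simp)
    exact this
  obtain ⟨b, hb, hb2⟩ := (mem_nhdsGE_iff_exists_Ico_subset' ht.2).1 h1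
  exact ⟨min b T, ⟨lt_min hb ht.2, min_le_right _ _⟩,
    fun u hu => hb2 ⟨hu.1, hu.2.trans_le (min_le_left _ _)⟩⟩

theorem IsCountingPath.jump_nonneg (h : IsCountingPath T N) {t : ℝ} (ht : t ∈ Ioc 0 T) :
    0 ≤ jump N t := by
  obtain ⟨a, ha, hc⟩ := h.exists_left ht
  rw [jump_eq_of_left ha.2 hc, sub_nonneg, Nat.cast_le]
  exact h.mono ⟨ha.1, ha.2.le.trans ht.2⟩ ⟨ht.1.le, ht.2⟩ ha.2.le

theorem jump_eq_zero {s t b : ℝ} (h : ∀ u ∈ Ico t b, N u = N t) (hs : s ∈ Ioo t b) :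
    jump N s = 0 := by
  have : ∀ u ∈ Ico t s, N u = N t := fun u hu => h u ⟨hu.1, hu.2.trans hs.2⟩
  rw [jump_eq_of_left hs.1 this, h s ⟨hs.1.le, hs.2⟩, sub_self]

/-- At a jump time the path strictly exceeds all its earlier values. So `N` is injective on jump
times, with values below `N T`. -/
theorem IsCountingPath.finite_jumps (h : IsCountingPath T N) :
    {s ∈ Ioc 0 T | jump N s ≠ 0}.Finite := by
  refine Set.Finite.of_finite_image (f := N) ((Set.finite_Iic (N T)).subset ?_) ?_
  · rintro _ ⟨s, hs, rfl⟩
    exact h.mono ⟨hs.1.1.le, hs.1.2⟩ ⟨hs.1.1.le.trans hs.1.2, le_rfl⟩ hs.1.2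
  · have key : ∀ s ∈ {s ∈ Ioc 0 T | jump N s ≠ 0}, ∀ r, 0 ≤ r → r < s → N r < N s := by
      intro s hs r hr hrs
      obtain ⟨a, ha, hc⟩ := h.exists_left hs.1
      have h1 := hs.2
      rw [jump_eq_of_left ha.2 hc] at h1
      have h2 : N a < N s := by
        refine lt_of_le_of_ne
          (h.mono ⟨ha.1, ha.2.le.trans hs.1.2⟩ ⟨hs.1.1.le, hs.1.2⟩ ha.2.le) fun h3 => h1 ?_
        rw [h3, sub_self]
      have h3 : N (max a r) = N a := hc _ ⟨le_max_left _ _, max_lt ha.2 hrs⟩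
      have h4 : N r ≤ N (max a r) := h.mono ⟨hr, hrs.le.trans hs.1.2⟩
        ⟨hr.trans (le_max_right _ _), (max_lt ha.2 hrs).le.trans hs.1.2⟩ (le_max_right _ _)
      omega
    intro s hs t ht hst
    rcases lt_trichotomy s t with h1 | h1 | h1
    · exact absurd hst (key t ht s hs.1.1.le h1).ne
    · exact h1
    · exact absurd hst (key s hs t ht.1.1.le h1).ne'

/-- The integral of `F` against a counting path. -/
noncomputable def cInt (N : ℝ → ℕ) (F : ℝ → E) (t : ℝ) : E := ∑ᶠ s ∈ Ioc (0 : ℝ) t, jump N s • F s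

theorem IsCountingPath.finite_support (h : IsCountingPath T N) (F : ℝ → E) {s t : ℝ} (hs : 0 ≤ s)
    (ht : t ≤ T) : (Ioc s t ∩ Function.support fun u => jump N u • F u).Finite := by
  refine h.finite_jumps.subset fun u hu => ⟨⟨hs.trans_lt hu.1.1, hu.1.2.trans ht⟩, fun h0 => hu.2 ?_⟩
  simp [h0]

theorem IsCountingPath.cInt_add (h : IsCountingPath T N) (F : ℝ → E) {s t : ℝ} (hs : 0 ≤ s)
    (hst : s ≤ t) (ht : t ≤ T) : cInt N F t = cInt N F s + ∑ᶠ u ∈ Ioc s t, jump N u • F u := by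
  rw [cInt, cInt, ← Ioc_union_Ioc_eq_Ioc hs hst]
  refine finsum_mem_union' ?_ (h.finite_support F le_rfl (hst.trans ht)) (h.finite_support F hs ht)
  exact Set.disjoint_left.2 fun u hu1 hu2 => not_lt.2 hu1.2 hu2.1

theorem cInt_zero (F : ℝ → E) : cInt N F 0 = 0 := by simp [cInt]

theorem IsCountingPath.cInt_right (h : IsCountingPath T N) (F : ℝ → E) {t : ℝ} (ht : t ∈ Ico 0 T) :
    ∃ b ∈ Ioc t T, ∀ u ∈ Ico t b, N u = N t ∧ cInt N F u = cInt N F t := by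
  obtain ⟨b, hb, hc⟩ := h.exists_right ht
  refine ⟨b, hb, fun u hu => ⟨hc u hu, ?_⟩⟩
  rw [h.cInt_add F ht.1 hu.1 (hu.2.le.trans hb.2), finsum_mem_eq_zero_of_forall_eq_zero, add_zero]
  intro s hs
  rw [jump_eq_zero hc ⟨hs.1, hs.2.trans_lt hu.2⟩, zero_smul]

/-- Just before `t` the path is constant, so the only jump that can contribute to the last piece is
the one at `t`. -/
theorem IsCountingPath.cInt_left (h : IsCountingPath T N) (F : ℝ → E) {t : ℝ} (ht : t ∈ Ioc 0 T) :
    ∃ a ∈ Ico 0 t, (∀ u ∈ Ico a t, N u = N a) ∧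
      ∀ u ∈ Ico a t, cInt N F t = cInt N F u + jump N t • F t := by
  obtain ⟨a, ha, hc⟩ := h.exists_left ht
  refine ⟨a, ha, hc, fun u hu => ?_⟩
  rw [h.cInt_add F (ha.1.trans hu.1) hu.2.le ht.2]
  congr 1
  rw [← finsum_mem_singleton (f := fun s => jump N s • F s) (a := t)]
  refine finsum_mem_inter_support_eq' _ _ _ fun s hs => ?_
  simp only [mem_Ioc, mem_singleton_iff]
  refine ⟨fun h1 => ?_, fun h1 => by rw [h1]; exact ⟨hu.2, le_rfl⟩⟩
  by_contra h2
  refine hs ?_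
  have h3 : ∀ r ∈ Ico a s, N r = N a := fun r hr => hc r ⟨hr.1, hr.2.trans_le h1.2⟩
  have h4 : s < t := lt_of_le_of_ne h1.2 h2
  change jump N s • F s = 0
  rw [jump_eq_of_left (hu.1.trans_lt h1.1) h3, hc s ⟨hu.1.trans h1.1.le, h4⟩, sub_self, zero_smul]

theorem continuousWithinAt_Icc_of_left_right {X : Type*} [TopologicalSpace X] {f : ℝ → X} {T t : ℝ}
    (hl : 0 < t → Tendsto f (𝓝[<] t) (𝓝 (f t))) (hr : t < T → ContinuousWithinAt f (Ici t) t)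
    (ht : t ∈ Icc 0 T) : ContinuousWithinAt f (Icc 0 T) t := by
  have h1 : ContinuousWithinAt f (Icc 0 t) t := by
    rcases ht.1.eq_or_lt with h | h
    · rw [← h, Icc_self]; exact continuousWithinAt_singleton
    · have h2 : ContinuousWithinAt f (Iio t) t := hl h
      refine (continuousWithinAt_insert_self.2 h2).mono fun u hu => ?_
      rcases hu.2.eq_or_lt with h3 | h3
      · exact Or.inl h3
      · exact Or.inr h3
  have h2 : ContinuousWithinAt f (Icc t T) t := by
    rcases ht.2.eq_or_lt with h | h
    · rw [h, Icc_self]; exact continuousWithinAt_singleton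
    · exact (hr h).mono Icc_subset_Ici_self
  rw [← Icc_union_Icc_eq_Icc ht.1 ht.2]
  exact h1.union h2

/-- Increments of a counting path are sums of jumps. -/
theorem IsCountingPath.sub_eq_finsum (h : IsCountingPath T N) {s t : ℝ} (hs : 0 ≤ s)
    (hst : s ≤ t) (ht : t ≤ T) : (N t : ℝ) - N s = ∑ᶠ u ∈ Ioc s t, jump N u := by
  -- The path minus its sum of jumps is continuous and locally constant to the right, hence
  -- constant.
  have key : ∀ x ∈ Icc 0 T, (N x : ℝ) - cInt N (fun _ => (1 : ℝ)) x
      = N 0 - cInt N (fun _ => (1 : ℝ)) 0 := by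
    refine constant_of_has_deriv_right_zero (f := fun x => (N x : ℝ) - cInt N (fun _ => (1 : ℝ)) x)
      (fun x hx => ?_) fun x hx => ?_
    · refine continuousWithinAt_Icc_of_left_right (fun h0 => ?_) (fun h1 => ?_) hx
      · obtain ⟨a, ha, hc, hc2⟩ := h.cInt_left (fun _ => (1 : ℝ)) ⟨h0, hx.2⟩
        refine tendsto_const_nhds.congr' ?_
        filter_upwards [Ico_mem_nhdsLT ha.2] with u hu
        rw [hc2 u hu, jump_eq_of_left ha.2 hc, hc u hu]
        simp only [smul_eq_mul, mul_one]
        ring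
      · obtain ⟨b, hb, hc⟩ := h.cInt_right (fun _ => (1 : ℝ)) ⟨hx.1, h1⟩
        refine tendsto_const_nhds.congr' ?_
        filter_upwards [Ico_mem_nhdsGE hb.1] with u hu
        rw [(hc u hu).1, (hc u hu).2]
    · obtain ⟨b, hb, hc⟩ := h.cInt_right (fun _ => (1 : ℝ)) hx
      refine (hasDerivWithinAt_const x (Ici x)
        ((N x : ℝ) - cInt N (fun _ => (1 : ℝ)) x)).congr_of_eventuallyEq ?_ rfl
      filter_upwards [Ico_mem_nhdsGE hb.1] with u hu
      rw [(hc u hu).1, (hc u hu).2]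
  have h1 := key s ⟨hs, hst.trans ht⟩
  have h2 := key t ⟨hs.trans hst, ht⟩
  have h3 := h.cInt_add (fun _ => (1 : ℝ)) hs hst ht
  simp only [smul_eq_mul, mul_one] at h3
  linarith

end CountingPaths

/-! ### Càdlàg paths: boundedness, measurability, Grönwall's inequality. -/

section Cadlag

variable {E : Type*} [NormedAddCommGroup E] {T : ℝ}

/-- A path which is right-continuous with left limits on `[0,T]`. -/
structure IsCadlag {E : Type*} [TopologicalSpace E] (T : ℝ) (f : ℝ → E) : Prop where
  rc : ∀ t ∈ Ico 0 T, ContinuousWithinAt f (Ici t) t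
  ll : ∀ t ∈ Ioc 0 T, ∃ L, Tendsto f (𝓝[<] t) (𝓝 L)

/-- One-sided limits make the path bounded near every point; compactness of `[0,T]` does the rest.
-/
theorem IsCadlag.exists_norm_bound {f : ℝ → E} (h : IsCadlag T f) :
    ∃ C : ℝ, 0 ≤ C ∧ ∀ t ∈ Icc 0 T, ‖f t‖ ≤ C := by
  suffices ∃ C : ℝ, ∀ t ∈ Icc 0 T, ‖f t‖ ≤ C by
    obtain ⟨C, hC⟩ := this
    exact ⟨max C 0, le_max_right _ _, fun t ht => (hC t ht).trans (le_max_left _ _)⟩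
  refine isCompact_Icc.induction_on (p := fun s => ∃ C : ℝ, ∀ t ∈ s, ‖f t‖ ≤ C) ⟨0, by simp⟩
    (fun s t hst ⟨C, hC⟩ => ⟨C, fun x hx => hC x (hst hx)⟩)
    (fun s t ⟨C, hC⟩ ⟨D, hD⟩ => ⟨max C D, fun x hx => hx.elim
      (fun h => (hC x h).trans (le_max_left _ _)) (fun h => (hD x h).trans (le_max_right _ _))⟩) ?_
  intro t ht
  have hl : ∃ C : ℝ, ∀ᶠ u in 𝓝[<] t, u ∈ Icc 0 T → ‖f u‖ ≤ C := by
    rcases ht.1.eq_or_lt with h0 | h0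
    · refine ⟨0, ?_⟩
      filter_upwards [self_mem_nhdsWithin] with u hu hu2
      exact absurd hu2.1 (by rw [h0]; exact not_le.2 hu)
    · obtain ⟨L, hL⟩ := h.ll t ⟨h0, ht.2⟩
      refine ⟨‖L‖ + 1, ?_⟩
      filter_upwards [hL.norm.eventually_le_const (lt_add_one ‖L‖)] with u hu _ using hu
  have hr : ∃ C : ℝ, ∀ᶠ u in 𝓝[≥] t, u ∈ Icc 0 T → ‖f u‖ ≤ C := by
    rcases ht.2.eq_or_lt with h0 | h0
    · refine ⟨‖f T‖, ?_⟩
      filter_upwards [self_mem_nhdsWithin] with u hu hu2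
      rw [le_antisymm hu2.2 (h0 ▸ hu)]
    · refine ⟨‖f t‖ + 1, ?_⟩
      filter_upwards [(h.rc t ⟨ht.1, h0⟩).norm.eventually_le_const (lt_add_one ‖f t‖)] with u hu _
        using hu
  obtain ⟨C, hC⟩ := hl
  obtain ⟨D, hD⟩ := hr
  have h3 : ∀ᶠ u in 𝓝 t, u ∈ Icc 0 T → ‖f u‖ ≤ max C D := by
    rw [← nhdsLT_sup_nhdsGE]
    refine eventually_sup.2 ⟨?_, ?_⟩
    · filter_upwards [hC] with u hu h using (hu h).trans (le_max_left _ _)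
    · filter_upwards [hD] with u hu h using (hu h).trans (le_max_right _ _)
  exact ⟨_, mem_nhdsWithin_iff_eventually.2 (h3.mono fun u hu h => (⟨h, hu h⟩ :
    u ∈ {u | u ∈ Icc 0 T ∧ ‖f u‖ ≤ max C D})), max C D, fun x hx => hx.2⟩

/-- Right grid approximation of `s` in `[0,T]` with mesh `1/(k+1)`. -/
noncomputable def gridRight (T : ℝ) (k : ℕ) (i : ℤ) : ℝ := max 0 (min T ((i + 1) / (k + 1)))

theorem gridRight_mem (hT : 0 ≤ T) (k : ℕ) (i : ℤ) : gridRight T k i ∈ Icc 0 T :=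
  ⟨le_max_left _ _, max_le hT (min_le_left _ _)⟩

theorem tendsto_gridRight {s : ℝ} (hs : s ∈ Ico 0 T) :
    Tendsto (fun k : ℕ => gridRight T k ⌊s * (k + 1)⌋) atTop (𝓝[≥] s) := by
  have hlow : ∀ k : ℕ, s ≤ ((⌊s * (k + 1)⌋ : ℤ) + 1 : ℝ) / (k + 1) := fun k => by
    rw [le_div_iff₀ (by positivity)]; exact (Int.lt_floor_add_one _).le
  have hup : ∀ k : ℕ, ((⌊s * (k + 1)⌋ : ℤ) + 1 : ℝ) / (k + 1) ≤ s + 1 / ((k : ℝ) + 1) := fun k => by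
    rw [div_le_iff₀ (by positivity)]
    have := Int.floor_le (s * (k + 1))
    field_simp
    linarith
  have hlow' : ∀ k : ℕ, s ≤ gridRight T k ⌊s * (k + 1)⌋ := fun k =>
    le_max_of_le_right (le_min hs.2.le (hlow k))
  refine tendsto_nhdsWithin_iff.2 ⟨?_, Eventually.of_forall hlow'⟩
  have h1 : Tendsto (fun k : ℕ => s + 1 / ((k : ℝ) + 1)) atTop (𝓝 s) := by
    simpa using (tendsto_one_div_add_atTop_nhds_zero_nat (𝕜 := ℝ)).const_add s
  refine tendsto_of_tendsto_of_tendsto_of_le_of_le tendsto_const_nhds h1 hlow' fun k => ?_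
  refine max_le ?_ ((min_le_right _ _).trans (hup k))
  have : (0 : ℝ) < 1 / ((k : ℝ) + 1) := by positivity
  linarith [hs.1]

theorem ae_restrict_Icc_mem_Ico : ∀ᵐ s ∂(volume.restrict (Icc 0 T)), s ∈ Ico 0 T := by
  rw [← restrict_Ico_eq_restrict_Icc]
  exact ae_restrict_mem measurableSet_Ico

/-- A right-continuous process is jointly measurable up to null sets. -/
theorem aestronglyMeasurable_prod_of_rc {Ω : Type*} {mΩ : MeasurableSpace Ω} {μ : Measure Ω}
    [SFinite μ] [SecondCountableTopology E] (hT : 0 ≤ T) {X : ℝ → Ω → E}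
    (hm : ∀ t ∈ Icc 0 T, StronglyMeasurable (X t))
    (hrc : ∀ᵐ ω ∂μ, ∀ t ∈ Ico 0 T, ContinuousWithinAt (fun u => X u ω) (Ici t) t) :
    AEStronglyMeasurable (fun z : ℝ × Ω => X z.1 z.2) ((volume.restrict (Icc 0 T)).prod μ) := by
  borelize E
  refine aestronglyMeasurable_of_tendsto_ae atTop
    -- Sampling at grid points to the right leaves only countably many times, which gives joint
    -- measurability, and right-continuity gives convergence. The grid is clamped to `[0,T]`, where
    -- `X` is known to be measurable.
    (f := fun (k : ℕ) (z : ℝ × Ω) => X (gridRight T k ⌊z.1 * (k + 1)⌋) z.2) (fun k => ?_) ?_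
  · have h1 : Measurable fun q : ℤ × Ω => X (gridRight T k q.1) q.2 :=
      measurable_from_prod_countable_right fun i => (hm _ (gridRight_mem hT k i)).measurable
    have h2 : Measurable fun z : ℝ × Ω => ((⌊z.1 * (k + 1)⌋ : ℤ), z.2) := by fun_prop
    exact (h1.comp h2).aestronglyMeasurable
  · have h1 : ∀ᵐ z ∂((volume.restrict (Icc 0 T)).prod μ), z.1 ∈ Ico 0 T :=
      Measure.quasiMeasurePreserving_fst.ae ae_restrict_Icc_mem_Ico
    have h2 := (Measure.quasiMeasurePreserving_snd (μ := volume.restrict (Icc 0 T)) (ν := μ)).ae hrc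
    filter_upwards [h1, h2] with z hz1 hz2
    exact (hz2 z.1 hz1).tendsto.comp (tendsto_gridRight hz1)

theorem IsCadlag.aestronglyMeasurable {f : ℝ → E} (h : IsCadlag T f) :
    AEStronglyMeasurable f (volume.restrict (Icc 0 T)) := by
  refine aestronglyMeasurable_of_tendsto_ae atTop
    (f := fun (k : ℕ) (s : ℝ) => f (gridRight T k ⌊s * (k + 1)⌋)) (fun k => ?_) ?_
  · have h1 : StronglyMeasurable fun i : ℤ => f (gridRight T k i) := StronglyMeasurable.of_discrete
    have h2 : Measurable fun s : ℝ => (⌊s * (k + 1)⌋ : ℤ) := by fun_prop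
    exact (h1.comp_measurable h2).aestronglyMeasurable
  · filter_upwards [ae_restrict_Icc_mem_Ico] with s hs
    exact (h.rc s hs).tendsto.comp (tendsto_gridRight hs)

theorem IsCadlag.intervalIntegrable {f : ℝ → E} (hT : 0 ≤ T) (h : IsCadlag T f) :
    IntervalIntegrable f volume 0 T := by
  rw [intervalIntegrable_iff_integrableOn_Icc_of_le hT]
  obtain ⟨C, -, hC⟩ := h.exists_norm_bound
  exact Integrable.of_bound h.aestronglyMeasurable C ((ae_restrict_mem measurableSet_Icc).mono hC)

theorem IsCadlag.hasDerivWithinAt_integral [NormedSpace ℝ E] [CompleteSpace E] {f : ℝ → E}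
    (hT : 0 ≤ T) (h : IsCadlag T f) {t : ℝ} (ht : t ∈ Ico 0 T) :
    HasDerivWithinAt (fun u => ∫ s in (0 : ℝ)..u, f s) (f t) (Ici t) t := by
  refine intervalIntegral.integral_hasDerivWithinAt_right (s := Ici t) (t := Ioi t)
    (intervalIntegrable_mono (h.intervalIntegrable hT) le_rfl ht.1 ht.2.le) ?_
    ((h.rc t ht).mono Ioi_subset_Ici_self)
  refine AEStronglyMeasurable.stronglyMeasurableAtFilter_of_mem (s := Ioo t T) ?_
    (Ioo_mem_nhdsGT ht.2)
  exact h.aestronglyMeasurable.mono_measure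
    (Measure.restrict_mono (fun u hu => ⟨ht.1.trans hu.1.le, hu.2.le⟩ : Ioo t T ⊆ Icc 0 T) le_rfl)

theorem IsCadlag.comp {E F : Type*} [TopologicalSpace E] [TopologicalSpace F] {f : ℝ → E}
    (h : IsCadlag T f) {φ : E → F} (hr : ∀ t ∈ Ico 0 T, ContinuousAt φ (f t))
    (hl : ∀ t ∈ Ioc 0 T, ∀ L, Tendsto f (𝓝[<] t) (𝓝 L) → ContinuousAt φ L) :
    IsCadlag T (fun t => φ (f t)) where
  rc t ht := (hr t ht).comp_continuousWithinAt (h.rc t ht)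
  ll t ht := by
    obtain ⟨L, hL⟩ := h.ll t ht
    exact ⟨φ L, (hl t ht L hL).tendsto.comp hL⟩

/-- Integral form of Grönwall's inequality for càdlàg functions. -/
theorem IsCadlag.le_gronwallBound {f : ℝ → ℝ} (hT : 0 ≤ T) (h : IsCadlag T f) {δ K ε : ℝ}
    (hK : 0 ≤ K) (hle : ∀ t ∈ Icc 0 T, f t ≤ δ + ∫ s in (0 : ℝ)..t, (K * f s + ε)) :
    ∀ t ∈ Icc 0 T, f t ≤ gronwallBound δ K ε t := by
  have h' : IsCadlag T (fun t => K * f t + ε) :=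
    h.comp (φ := fun x => K * x + ε) (fun t _ => by fun_prop) (fun t _ L _ => by fun_prop)
  intro t ht
  refine (hle t ht).trans ?_
  -- Grönwall is applied to the integral majorant, which is continuous and right differentiable
  -- although `f` may jump.
  have := le_gronwallBound_of_liminf_deriv_right_le (K := K) (ε := ε)
    (f := fun t => δ + ∫ s in (0 : ℝ)..t, (K * f s + ε)) (f' := fun t => K * f t + ε)
    (a := 0) (b := T) (δ := δ) ?_ ?_ (by simp) ?_ t ht
  · simpa using this
  · refine continuousOn_const.add ?_
    have := intervalIntegral.continuousOn_primitive_interval'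
      (h'.intervalIntegrable hT) left_mem_uIcc
    rwa [uIcc_of_le hT] at this
  · intro x hx r hr
    exact ((h'.hasDerivWithinAt_integral hT hx).const_add δ).liminf_right_slope_le hr
  · intro x hx
    have := hle x ⟨hx.1, hx.2.le⟩
    gcongr

end Cadlag

end CDKF

namespace CDKF

/-! ### Pathwise analysis of the covariance process and of its inverse. -/

section CovariancePaths

open scoped Matrix.Norms.L2Operator

variable {n M : ℕ}

/-- A path of the covariance process driven by counting paths. -/
structure IsCovPath (T : ℝ) (S : Model n M) (N : Fin M → ℝ → ℕ)
    (P : ℝ → Matrix (Fin n) (Fin n) ℝ) : Prop where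
  counting : ∀ j, IsCountingPath T (N j)
  posDef : ∀ t ∈ Icc 0 T, (P t).PosDef
  cadlag : IsCadlag T P
  equation : ∀ t ∈ Icc 0 T,
    P t = P 0 + matIntegral (fun s => S.A * P s + P s * S.Aᵀ + S.Q) t
      - ∑ j, countIntegral (N j) (fun s => S.g j (Function.leftLim P s)) t

variable {T : ℝ} {S : Model n M} {N : Fin M → ℝ → ℕ} {P : ℝ → Matrix (Fin n) (Fin n) ℝ}

theorem IsCovPath.tendsto_leftLim (h : IsCovPath T S N P) {t : ℝ} (ht : t ∈ Ioc 0 T) :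
    Tendsto P (𝓝[<] t) (𝓝 (Function.leftLim P t)) := by
  obtain ⟨L, hL⟩ := h.cadlag.ll t ht
  rwa [leftLim_eq_of_tendsto hL]

theorem IsCovPath.leftLim_posSemidef (h : IsCovPath T S N P) {t : ℝ} (ht : t ∈ Ioc 0 T) :
    (Function.leftLim P t).PosSemidef := by
  refine isClosed_posSemidef.mem_of_tendsto (h.tendsto_leftLim ht) ?_
  filter_upwards [Ico_mem_nhdsLT ht.1] with u hu
  exact (h.posDef u ⟨hu.1, hu.2.le.trans ht.2⟩).posSemidef

theorem IsCovPath.cadlag_drift (h : IsCovPath T S N P) :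
    IsCadlag T (fun s => S.A * P s + P s * S.Aᵀ + S.Q) :=
  h.cadlag.comp (φ := fun X => S.A * X + X * S.Aᵀ + S.Q) (fun _ _ => by fun_prop)
    (fun _ _ _ _ => by fun_prop)

theorem IsCovPath.eq_integral (hT : 0 ≤ T) (h : IsCovPath T S N P) {t : ℝ} (ht : t ∈ Icc 0 T) :
    P t = P 0 + (∫ s in (0 : ℝ)..t, (S.A * P s + P s * S.Aᵀ + S.Q))
      - ∑ j, cInt (N j) (fun s => S.g j (Function.leftLim P s)) t := by
  rw [← matIntegral_eq (intervalIntegrable_mono (h.cadlag_drift.intervalIntegrable hT)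
    le_rfl ht.1 ht.2)]
  exact h.equation t ht

/-- Subtract the integral equation at `u < t` from the one at `t` and let `u` increase to `t`: the
drift vanishes and only the jump at `t` survives. -/
theorem IsCovPath.eq_leftLim_sub (hT : 0 ≤ T) (h : IsCovPath T S N P) {t : ℝ}
    (ht : t ∈ Ioc 0 T) :
    P t = Function.leftLim P t - ∑ j, jump (N j) t • S.g j (Function.leftLim P t) := by
  have hi := h.cadlag_drift.intervalIntegrable hT
  have hc : ContinuousOn (fun u => ∫ s in (0 : ℝ)..u, (S.A * P s + P s * S.Aᵀ + S.Q)) (Icc 0 T) := by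
    have := intervalIntegral.continuousOn_primitive_interval' hi left_mem_uIcc
    rwa [uIcc_of_le hT] at this
  set I := fun u => ∫ s in (0 : ℝ)..u, (S.A * P s + P s * S.Aᵀ + S.Q)
  have hcl : Tendsto I (𝓝[<] t) (𝓝 (I t)) := by
    refine (hc t ⟨ht.1.le, ht.2⟩).tendsto.mono_left ?_
    rw [← nhdsWithin_Ico_eq_nhdsLT ht.1]
    exact nhdsWithin_mono _ fun u hu => ⟨hu.1, hu.2.le.trans ht.2⟩
  have h1 : Tendsto (fun u => P u + (I t - I u)
      - ∑ j, jump (N j) t • S.g j (Function.leftLim P t)) (𝓝[<] t)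
      (𝓝 (Function.leftLim P t + (I t - I t)
        - ∑ j, jump (N j) t • S.g j (Function.leftLim P t))) :=
    ((h.tendsto_leftLim ht).add (hcl.const_sub _)).sub_const _
  rw [sub_self, add_zero] at h1
  refine tendsto_nhds_unique (f := fun _ => P t) tendsto_const_nhds (h1.congr' ?_)
  have h2 : ∀ j, ∀ᶠ u in 𝓝[<] t, cInt (N j) (fun s => S.g j (Function.leftLim P s)) t
      = cInt (N j) (fun s => S.g j (Function.leftLim P s)) u
        + jump (N j) t • S.g j (Function.leftLim P t) := fun j => by
    obtain ⟨a, ha, -, hc⟩ := (h.counting j).cInt_left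
      (fun s => S.g j (Function.leftLim P s)) ht
    filter_upwards [Ico_mem_nhdsLT ha.2] with u hu using hc u hu
  filter_upwards [eventually_all.2 h2, Ico_mem_nhdsLT ht.1] with u hu hu0
  rw [h.eq_integral hT ⟨ht.1.le, ht.2⟩, h.eq_integral hT ⟨hu0.1, hu0.2.le.trans ht.2⟩,
    Finset.sum_congr rfl fun j _ => hu j, Finset.sum_add_distrib]
  simp only [I]
  abel

/-- A limit of positive definite matrices is only semidefinite, but here the left limit is the
positive definite `P t` plus semidefinite reductions. Definiteness is needed to invert it. -/
theorem IsCovPath.leftLim_posDef (hT : 0 ≤ T) (h : IsCovPath T S N P) {t : ℝ}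
    (ht : t ∈ Ioc 0 T) : (Function.leftLim P t).PosDef := by
  have h0 := h.leftLim_posSemidef ht
  have h1 : Function.leftLim P t
      = P t + ∑ j, jump (N j) t • S.g j (Function.leftLim P t) := by
    rw [h.eq_leftLim_sub hT ht]; simp only [sub_add_cancel]
  rw [h1]
  refine (h.posDef t ⟨ht.1.le, ht.2⟩).add_posSemidef (Matrix.posSemidef_sum _ fun j _ => ?_)
  exact (S.posSemidef_g j h0).smul ((h.counting j).jump_nonneg ht)

theorem IsCovPath.tendsto_left_of_jump_eq_zero (hT : 0 ≤ T) (h : IsCovPath T S N P) {t : ℝ}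
    (ht : t ∈ Ioc 0 T) (hj : ∀ j, jump (N j) t = 0) : Tendsto P (𝓝[<] t) (𝓝 (P t)) := by
  have h1 := h.eq_leftLim_sub hT ht
  simp only [hj, zero_smul, Finset.sum_const_zero, sub_zero] at h1
  rw [h1]; exact h.tendsto_leftLim ht

theorem IsCovPath.continuousWithinAt (hT : 0 ≤ T) (h : IsCovPath T S N P) {t : ℝ}
    (ht : t ∈ Icc 0 T) (hj : 0 < t → ∀ j, jump (N j) t = 0) :
    ContinuousWithinAt P (Icc 0 T) t :=
  continuousWithinAt_Icc_of_left_right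
    (fun h0 => h.tendsto_left_of_jump_eq_zero hT ⟨h0, ht.2⟩ (hj h0))
    (fun h1 => h.cadlag.rc t ⟨ht.1, h1⟩) ht

theorem IsCovPath.hasDerivWithinAt (hT : 0 ≤ T) (h : IsCovPath T S N P) {t : ℝ}
    (ht : t ∈ Ico 0 T) : HasDerivWithinAt P (S.A * P t + P t * S.Aᵀ + S.Q) (Ici t) t := by
  have h2 : ∀ j, ∀ᶠ u in 𝓝[≥] t, cInt (N j) (fun s => S.g j (Function.leftLim P s)) u
      = cInt (N j) (fun s => S.g j (Function.leftLim P s)) t := fun j => by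
    obtain ⟨b, hb, hc⟩ := (h.counting j).cInt_right (fun s => S.g j (Function.leftLim P s)) ht
    filter_upwards [Ico_mem_nhdsGE hb.1] with u hu using (hc u hu).2
  have h3 := ((h.cadlag_drift.hasDerivWithinAt_integral hT ht).const_add (P 0)).sub_const
    (∑ j, cInt (N j) (fun s => S.g j (Function.leftLim P s)) t)
  refine h3.congr_of_eventuallyEq ?_ (h.eq_integral hT ⟨ht.1, ht.2.le⟩)
  filter_upwards [eventually_all.2 h2, Ico_mem_nhdsGE ht.2] with u hu hu0
  rw [h.eq_integral hT ⟨ht.1.trans hu0.1, hu0.2.le⟩, Finset.sum_congr rfl fun j _ => hu j]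

theorem norm_drift_le (A X Q : Matrix (Fin n) (Fin n) ℝ) :
    ‖A * X + X * Aᵀ + Q‖ ≤ 2 * ‖A‖ * ‖X‖ + ‖Q‖ := by
  have h1 := norm_mul_le A X
  have h2 := norm_mul_le X Aᵀ
  rw [norm_transpose_eq] at h2
  have h3 := norm_add₃_le (a := A * X) (b := X * Aᵀ) (c := Q)
  linarith

theorem IsCadlag.norm {E : Type*} [NormedAddCommGroup E] {f : ℝ → E} (h : IsCadlag T f) :
    IsCadlag T (fun t => ‖f t‖) :=
  h.comp (φ := fun x => ‖x‖) (fun _ _ => by fun_prop) (fun _ _ _ _ => by fun_prop)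

theorem norm_integral_le_integral {f : ℝ → Matrix (Fin n) (Fin n) ℝ} {φ : ℝ → ℝ}
    {t : ℝ} (ht : 0 ≤ t) (hφ : IntervalIntegrable φ volume 0 t) (h : ∀ s, ‖f s‖ ≤ φ s) :
    ‖∫ s in (0 : ℝ)..t, f s‖ ≤ ∫ s in (0 : ℝ)..t, φ s :=
  intervalIntegral.norm_integral_le_of_norm_le ht (Eventually.of_forall fun s _ => h s) hφ

/-- Measurements only reduce the covariance, so the jump terms may be dropped in the semidefinite
order and Grönwall applied to the drift. The bound does not depend on the jumps. -/
theorem IsCovPath.norm_le (hT : 0 ≤ T) (h : IsCovPath T S N P) {t : ℝ} (ht : t ∈ Icc 0 T) :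
    ‖P t‖ ≤ gronwallBound ‖P 0‖ (2 * ‖S.A‖) ‖S.Q‖ t := by
  refine h.cadlag.norm.le_gronwallBound hT (by positivity) (fun t ht => ?_) t ht
  have h1 : ‖P t‖ ≤ ‖P 0 + ∫ s in (0 : ℝ)..t, (S.A * P s + P s * S.Aᵀ + S.Q)‖ := by
    refine norm_le_norm_of_posSemidef (h.posDef t ht).posSemidef fun v => ?_
    rw [h.eq_integral hT ht, qf_sub, qf_sum]
    have : 0 ≤ ∑ j, qf (cInt (N j) (fun s => S.g j (Function.leftLim P s)) t) v := by
      refine Finset.sum_nonneg fun j _ => ?_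
      have hfin := (h.counting j).finite_support (fun s => S.g j (Function.leftLim P s))
        (le_refl (0 : ℝ)) ht.2
      rw [cInt, ← finsum_mem_inter_support, finsum_mem_eq_finite_toFinset_sum _ hfin, qf_sum]
      refine Finset.sum_nonneg fun s hs => ?_
      rw [Set.Finite.mem_toFinset] at hs
      have hs' : s ∈ Ioc 0 T := ⟨hs.1.1, hs.1.2.trans ht.2⟩
      rw [qf_smul]
      exact mul_nonneg ((h.counting j).jump_nonneg hs')
        ((S.posSemidef_g j (h.leftLim_posSemidef hs')).qf_nonneg v)
    linarith
  refine h1.trans ((norm_add_le _ _).trans (add_le_add_right ?_ _))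
  have hφ : IsCadlag T (fun s => 2 * ‖S.A‖ * ‖P s‖ + ‖S.Q‖) :=
    h.cadlag.norm.comp (φ := fun x => 2 * ‖S.A‖ * x + ‖S.Q‖) (fun _ _ => by fun_prop)
      (fun _ _ _ _ => by fun_prop)
  exact norm_integral_le_integral ht.1
    (intervalIntegrable_mono (hφ.intervalIntegrable hT) le_rfl ht.1 ht.2)
    fun s => norm_drift_le _ _ _

theorem hasDerivWithinAt_matrix_inv {P : ℝ → Matrix (Fin n) (Fin n) ℝ}
    {P' : Matrix (Fin n) (Fin n) ℝ} {s : Set ℝ} {t : ℝ} (h : HasDerivWithinAt P P' s t)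
    (hu : IsUnit (P t)) : HasDerivWithinAt (fun u => (P u)⁻¹) (-((P t)⁻¹ * P' * (P t)⁻¹)) s t := by
  obtain ⟨U, hU⟩ := hu
  have : CompleteSpace (Matrix (Fin n) (Fin n) ℝ) := FiniteDimensional.complete ℝ _
  have h1 := hasFDerivAt_ringInverse (𝕜 := ℝ) U
  rw [hU] at h1
  have h2 := h1.comp_hasDerivWithinAt t h
  have h3 : (Ring.inverse ∘ P) = fun u => (P u)⁻¹ := by
    ext1 u; simp [Matrix.nonsing_inv_eq_ringInverse]
  rw [h3] at h2
  refine h2.congr_deriv ?_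
  have h4 : (P t)⁻¹ = ↑U⁻¹ := by rw [← hU, Matrix.coe_units_inv]
  simp [h4]

theorem IsCovPath.cadlag_inv (hT : 0 ≤ T) (h : IsCovPath T S N P) :
    IsCadlag T (fun t => (P t)⁻¹) := by
  refine h.cadlag.comp (φ := fun X => X⁻¹)
    (fun t ht => continuousAt_matrix_inv (h.posDef t ⟨ht.1, ht.2.le⟩).isUnit) fun t ht L hL => ?_
  rw [← leftLim_eq_of_tendsto hL]
  exact continuousAt_matrix_inv (h.leftLim_posDef hT ht).isUnit

theorem IsCovPath.cadlag_inv_drift (hT : 0 ≤ T) (h : IsCovPath T S N P) :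
    IsCadlag T (fun s => -((P s)⁻¹ * S.A) - S.Aᵀ * (P s)⁻¹ - (P s)⁻¹ * S.Q * (P s)⁻¹) :=
  (h.cadlag_inv hT).comp (φ := fun X => -(X * S.A) - S.Aᵀ * X - X * S.Q * X)
    (fun _ _ => by fun_prop) (fun _ _ _ _ => by fun_prop)

/-- The sensors never fire simultaneously, and never twice at the same time. -/
def NoDoubleJump (T : ℝ) (N : Fin M → ℝ → ℕ) : Prop :=
  ∀ t ∈ Ioc 0 T, ∃ u ∈ Ico 0 t, ∑ j, N j t ≤ ∑ j, N j u + 1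

/-- At most one sensor fires at `t`, and at most once, so the Woodbury identity applies to a single
update. For simultaneous firings the sum of the reductions would not correspond to added
information. -/
theorem IsCovPath.inv_eq_leftLim_add (hT : 0 ≤ T) (h : IsCovPath T S N P)
    (hN : NoDoubleJump T N) {t : ℝ} (ht : t ∈ Ioc 0 T) :
    (P t)⁻¹ = (Function.leftLim P t)⁻¹ + ∑ j, jump (N j) t • S.infoGain j := by
  choose a ha hc using fun j => (h.counting j).exists_left ht
  obtain ⟨u, hu, hu2⟩ := hN t ht
  have hj : ∀ j, ∃ k : ℕ, jump (N j) t = k ∧ N j t = N j (a j) + k := fun j => by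
    have h1 : N j (a j) ≤ N j t := (h.counting j).mono ⟨(ha j).1, (ha j).2.le.trans ht.2⟩
      ⟨ht.1.le, ht.2⟩ (ha j).2.le
    refine ⟨N j t - N j (a j), ?_, by omega⟩
    rw [jump_eq_of_left (ha j).2 (hc j), Nat.cast_sub h1]
  choose k hk1 hk2 using hj
  have hsum : ∑ j, k j ≤ 1 := by
    have h1 : ∀ j, N j u ≤ N j (a j) := fun j => by
      rcases le_total u (a j) with h2 | h2
      · exact (h.counting j).mono ⟨hu.1, hu.2.le.trans ht.2⟩ ⟨(ha j).1, (ha j).2.le.trans ht.2⟩ h2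
      · exact (hc j u ⟨h2, hu.2⟩).le
    have h2 := Finset.sum_le_sum fun j (_ : j ∈ Finset.univ) => h1 j
    have h3 : ∑ j, N j t = ∑ j, N j (a j) + ∑ j, k j := by
      rw [← Finset.sum_add_distrib]; exact Finset.sum_congr rfl fun j _ => hk2 j
    omega
  have e := h.eq_leftLim_sub hT ht
  simp only [hk1] at e ⊢
  by_cases hall : ∀ j, k j = 0
  · simp only [hall, Nat.cast_zero, zero_smul, Finset.sum_const_zero, sub_zero, add_zero] at e ⊢
    rw [← e]
  · push Not at hall
    obtain ⟨i, hi⟩ := hall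
    have h4 := Finset.add_sum_erase Finset.univ k (Finset.mem_univ i)
    have h5 : ∀ j, j ≠ i → k j = 0 := fun j hj => by
      have := Finset.single_le_sum (f := k) (fun _ _ => Nat.zero_le _)
        (Finset.mem_erase.2 ⟨hj, Finset.mem_univ j⟩)
      omega
    have h6 : k i = 1 := by omega
    have h7 : ∀ X : Fin M → Matrix (Fin n) (Fin n) ℝ, ∑ j, (k j : ℝ) • X j = X i := fun X => by
      rw [Finset.sum_eq_single i (fun j _ hj => by rw [h5 j hj]; simp) (by simp), h6]
      simp
    rw [h7 fun j => S.g j (Function.leftLim P t)] at e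
    rw [h7, e, S.inv_sub_g i (h.leftLim_posDef hT ht)]

/-- The information matrix `P⁻¹` follows the information form of the filter. -/
theorem IsCovPath.inv_eq (hT : 0 ≤ T) (h : IsCovPath T S N P) (hN : NoDoubleJump T N) {t : ℝ}
    (ht : t ∈ Icc 0 T) :
    (P t)⁻¹ = (P 0)⁻¹ + (∫ s in (0 : ℝ)..t,
        (-((P s)⁻¹ * S.A) - S.Aᵀ * (P s)⁻¹ - (P s)⁻¹ * S.Q * (P s)⁻¹))
      + ∑ j, ((N j t : ℝ) - N j 0) • S.infoGain j := by
  have hd := h.cadlag_inv_drift hT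
  set I := fun t => ∫ s in (0 : ℝ)..t,
    (-((P s)⁻¹ * S.A) - S.Aᵀ * (P s)⁻¹ - (P s)⁻¹ * S.Q * (P s)⁻¹)
  have hIc : ContinuousOn I (Icc 0 T) := by
    have := intervalIntegral.continuousOn_primitive_interval' (hd.intervalIntegrable hT)
      left_mem_uIcc
    rwa [uIcc_of_le hT] at this
  set J := fun t => ∑ j, (N j t : ℝ) • S.infoGain j
  have hJr : ∀ t ∈ Ico 0 T, ∀ᶠ u in 𝓝[≥] t, J u = J t := fun t ht => by
    have h2 : ∀ j, ∀ᶠ u in 𝓝[≥] t, N j u = N j t := fun j => by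
      obtain ⟨b, hb, hc⟩ := (h.counting j).exists_right ht
      filter_upwards [Ico_mem_nhdsGE hb.1] with u hu using hc u hu
    filter_upwards [eventually_all.2 h2] with u hu
    exact Finset.sum_congr rfl fun j _ => by rw [hu j]
  have hJl : ∀ t ∈ Ioc 0 T, ∀ᶠ u in 𝓝[<] t, J u = J t - ∑ j, jump (N j) t • S.infoGain j :=
    fun t ht => by
    have h2 : ∀ j, ∀ᶠ u in 𝓝[<] t, (N j u : ℝ) = N j t - jump (N j) t := fun j => by
      obtain ⟨a, ha, hc⟩ := (h.counting j).exists_left ht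
      filter_upwards [Ico_mem_nhdsLT ha.2] with u hu
      rw [hc u hu, jump_eq_of_left ha.2 hc]; ring
    filter_upwards [eventually_all.2 h2] with u hu
    simp only [J]
    rw [← Finset.sum_sub_distrib]
    exact Finset.sum_congr rfl fun j _ => by rw [hu j, sub_smul]
  -- The jumps of `P⁻¹` and `J` cancel, so this difference is continuous; its right derivative is
  -- zero by the derivative of the inverse, hence it is constant.
  have key : ∀ x ∈ Icc 0 T, (P x)⁻¹ - I x - J x = (P 0)⁻¹ - I 0 - J 0 := by
    refine constant_of_has_deriv_right_zero (f := fun x => (P x)⁻¹ - I x - J x)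
      (fun x hx => ?_) fun x hx => ?_
    · refine continuousWithinAt_Icc_of_left_right (fun h0 => ?_) (fun h1 => ?_) hx
      · have hx' : x ∈ Ioc 0 T := ⟨h0, hx.2⟩
        have h2 : Tendsto (fun u => (P u)⁻¹) (𝓝[<] x) (𝓝 (Function.leftLim P x)⁻¹) :=
          (continuousAt_matrix_inv (h.leftLim_posDef hT hx').isUnit).tendsto.comp
            (h.tendsto_leftLim hx')
        have h3 : Tendsto I (𝓝[<] x) (𝓝 (I x)) := by
          refine (hIc x hx).tendsto.mono_left ?_
          rw [← nhdsWithin_Ico_eq_nhdsLT h0]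
          exact nhdsWithin_mono _ fun u hu => ⟨hu.1, hu.2.le.trans hx.2⟩
        have h4 : Tendsto J (𝓝[<] x) (𝓝 (J x - ∑ j, jump (N j) x • S.infoGain j)) :=
          tendsto_const_nhds.congr' ((hJl x hx').mono fun u hu => hu.symm)
        have h5 := (h2.sub h3).sub h4
        rw [h.inv_eq_leftLim_add hT hN hx']
        have h6 : ∀ Y Z I' J' : Matrix (Fin n) (Fin n) ℝ,
            Y + Z - I' - J' = Y - I' - (J' - Z) := fun _ _ _ _ => by abel
        rw [h6]
        exact h5
      · have hx' : x ∈ Ico 0 T := ⟨hx.1, h1⟩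
        have h2 := (h.cadlag_inv hT).rc x hx'
        have h3 : ContinuousWithinAt I (Ici x) x :=
          (hd.hasDerivWithinAt_integral hT hx').continuousWithinAt
        have h4 : ContinuousWithinAt J (Ici x) x :=
          tendsto_const_nhds.congr' ((hJr x hx').mono fun u hu => hu.symm)
        exact (h2.sub h3).sub h4
    · have h1 := hasDerivWithinAt_matrix_inv (h.hasDerivWithinAt hT hx)
        (h.posDef x ⟨hx.1, hx.2.le⟩).isUnit
      have h2 := hd.hasDerivWithinAt_integral hT hx
      have h3 : HasDerivWithinAt J 0 (Ici x) x :=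
        (hasDerivWithinAt_const x (Ici x) (J x)).congr_of_eventuallyEq (hJr x hx) rfl
      have h4 := (h1.sub h2).sub h3
      refine h4.congr_deriv ?_
      have hu : IsUnit (P x).det :=
        (Matrix.isUnit_iff_isUnit_det _).1 (h.posDef x ⟨hx.1, hx.2.le⟩).isUnit
      rw [Matrix.mul_add, Matrix.mul_add, Matrix.add_mul, Matrix.add_mul,
        Matrix.mul_assoc (P x)⁻¹ (S.A * P x), Matrix.mul_assoc S.A, Matrix.mul_nonsing_inv _ hu,
        Matrix.mul_one, ← Matrix.mul_assoc (P x)⁻¹ (P x), Matrix.nonsing_inv_mul _ hu,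
        Matrix.one_mul]
      abel
  have h1 := key t ht
  have h2 : I 0 = 0 := by simp [I]
  rw [h2, sub_zero] at h1
  have h3 : ∑ j, ((N j t : ℝ) - N j 0) • S.infoGain j = J t - J 0 := by
    simp only [J, sub_smul, Finset.sum_sub_distrib]
  rw [h3, ← sub_add_cancel ((P t)⁻¹) (I t), ← sub_add_cancel ((P t)⁻¹ - I t) (J t), h1]
  abel

/-- The quadratic drift `-Y Q Y` is negative semidefinite and may be dropped; the accumulated
information is at most that of the final counts. The resulting bound is random but integrable for a
bounded initial information. -/
theorem IsCovPath.norm_inv_le (hT : 0 ≤ T) (h : IsCovPath T S N P) (hN : NoDoubleJump T N)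
    {t : ℝ} (ht : t ∈ Icc 0 T) :
    ‖(P t)⁻¹‖ ≤ (‖(P 0)⁻¹‖ + ∑ j, ((N j T : ℝ) - N j 0) * ‖S.infoGain j‖)
      * Real.exp (2 * ‖S.A‖ * t) := by
  rw [← gronwallBound_ε0]
  have hYc := h.cadlag_inv hT
  refine hYc.norm.le_gronwallBound hT (by positivity) (fun t ht => ?_) t ht
  have hlin : IsCadlag T (fun s => -((P s)⁻¹ * S.A) - S.Aᵀ * (P s)⁻¹) :=
    hYc.comp (φ := fun X => -(X * S.A) - S.Aᵀ * X) (fun _ _ => by fun_prop)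
      (fun _ _ _ _ => by fun_prop)
  have hquad : IsCadlag T (fun s => (P s)⁻¹ * S.Q * (P s)⁻¹) :=
    hYc.comp (φ := fun X => X * S.Q * X) (fun _ _ => by fun_prop) (fun _ _ _ _ => by fun_prop)
  have i1 := intervalIntegrable_mono (hlin.intervalIntegrable hT) le_rfl ht.1 ht.2
  have i2 := intervalIntegrable_mono (hquad.intervalIntegrable hT) le_rfl ht.1 ht.2
  have hquad0 : ∀ v, 0 ≤ ∫ s in (0 : ℝ)..t, qf ((P s)⁻¹ * S.Q * (P s)⁻¹) v := fun v => by
    refine intervalIntegral.integral_nonneg ht.1 fun s hs => ?_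
    have hs' := (h.posDef s ⟨hs.1, hs.2.trans ht.2⟩).inv.posSemidef.isSymm
    have := (S.Q_posSemidef.mul_mul_conjTranspose_same (P s)⁻¹).qf_nonneg v
    rwa [Matrix.conjTranspose_eq_transpose_of_trivial, hs'.eq] at this
  have h1 : ‖(P t)⁻¹‖ ≤ ‖(P 0)⁻¹ + (∫ s in (0 : ℝ)..t, (-((P s)⁻¹ * S.A) - S.Aᵀ * (P s)⁻¹))
      + ∑ j, ((N j t : ℝ) - N j 0) • S.infoGain j‖ := by
    refine norm_le_norm_of_posSemidef (h.posDef t ht).inv.posSemidef fun v => ?_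
    rw [h.inv_eq hT hN ht, intervalIntegral.integral_sub i1 i2]
    simp only [qf_add, qf_sub, qf_integral i2]
    linarith [hquad0 v]
  have h2 : ‖∑ j, ((N j t : ℝ) - N j 0) • S.infoGain j‖
      ≤ ∑ j, ((N j T : ℝ) - N j 0) * ‖S.infoGain j‖ := by
    refine (norm_sum_le _ _).trans (Finset.sum_le_sum fun j _ => ?_)
    have e1 : (N j 0 : ℝ) ≤ N j t := by
      exact_mod_cast (h.counting j).mono ⟨le_rfl, hT⟩ ht ht.1
    have e2 : (N j t : ℝ) ≤ N j T := by
      exact_mod_cast (h.counting j).mono ht ⟨hT, le_rfl⟩ ht.2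
    rw [norm_smul, Real.norm_eq_abs, abs_of_nonneg (by linarith)]
    gcongr
  have h3 : ‖∫ s in (0 : ℝ)..t, (-((P s)⁻¹ * S.A) - S.Aᵀ * (P s)⁻¹)‖
      ≤ ∫ s in (0 : ℝ)..t, (2 * ‖S.A‖ * ‖(P s)⁻¹‖ + 0) := by
    have hφ : IsCadlag T (fun s => 2 * ‖S.A‖ * ‖(P s)⁻¹‖ + 0) :=
      hYc.norm.comp (φ := fun x => 2 * ‖S.A‖ * x + 0) (fun _ _ => by fun_prop)
        (fun _ _ _ _ => by fun_prop)
    refine norm_integral_le_integral ht.1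
      (intervalIntegrable_mono (hφ.intervalIntegrable hT) le_rfl ht.1 ht.2) fun s => ?_
    have e1 := norm_sub_le (-((P s)⁻¹ * S.A)) (S.Aᵀ * (P s)⁻¹)
    have e2 := norm_mul_le (P s)⁻¹ S.A
    have e3 := norm_mul_le S.Aᵀ (P s)⁻¹
    rw [norm_neg] at e1
    rw [norm_transpose_eq] at e3
    linarith
  have h4 := norm_add₃_le (a := (P 0)⁻¹)
    (b := ∫ s in (0 : ℝ)..t, (-((P s)⁻¹ * S.A) - S.Aᵀ * (P s)⁻¹))
    (c := ∑ j, ((N j t : ℝ) - N j 0) • S.infoGain j)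
  linarith

end CovariancePaths

end CDKF

namespace CDKF

/-! ### Moments and tails of the Poisson law. -/

section Poisson

open scoped NNReal

theorem integrable_natCast_poissonMeasure (r : ℝ≥0) :
    HasSum (fun k : ℕ => Real.exp (-r) * (r : ℝ) ^ k / k.factorial * (k : ℝ)) r := by
  rw [← hasSum_nat_add_iff' 1]
  have h := (hasSum_one_poissonMeasure r).mul_left (r : ℝ)
  simp only [Finset.range_one, Finset.sum_singleton, Nat.cast_zero, mul_zero, sub_zero]
  rw [mul_one] at h
  have e : (fun k : ℕ => Real.exp (-r) * (r : ℝ) ^ (k + 1) / (k + 1).factorial * ((k + 1 : ℕ) : ℝ))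
      = fun k : ℕ => (r : ℝ) * (Real.exp (-r) * (r : ℝ) ^ k / k.factorial) := by
    ext k
    rw [Nat.factorial_succ]
    push_cast
    field_simp
    ring
  rw [e]
  exact h

theorem integrable_poissonMeasure_natCast (r : ℝ≥0) :
    Integrable (fun k : ℕ => (k : ℝ)) (poissonMeasure r) := by
  rw [integrable_poissonMeasure_iff]
  simpa using (integrable_natCast_poissonMeasure r).summable

theorem integral_poissonMeasure_natCast (r : ℝ≥0) :
    ∫ k : ℕ, (k : ℝ) ∂(poissonMeasure r) = r := by
  rw [integral_poissonMeasure]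
  simpa using (integrable_natCast_poissonMeasure r).tsum_eq

theorem poissonMeasure_one_le (r : ℝ≥0) :
    poissonMeasure r {k | 1 ≤ k} ≤ ENNReal.ofReal r := by
  have h : ({k | 1 ≤ k} : Set ℕ) = {0}ᶜ := by ext k; simp [Nat.one_le_iff_ne_zero]
  rw [h, prob_compl_eq_one_sub (measurableSet_singleton 0), poissonMeasure_singleton,
    ← ENNReal.ofReal_one, ← ENNReal.ofReal_sub _ (by positivity)]
  refine ENNReal.ofReal_le_ofReal ?_
  have := Real.add_one_le_exp (-(r : ℝ))
  simp only [pow_zero, mul_one, Nat.factorial_zero, Nat.cast_one, div_one]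
  linarith

/-- The tail is `1 - (1 + r) e^{-r}`, and `e^{-r} ≥ 1 - r`. The quadratic order is what excludes
double jumps in the limit of fine grids. -/
theorem poissonMeasure_two_le (r : ℝ≥0) :
    poissonMeasure r {k | 2 ≤ k} ≤ ENNReal.ofReal ((r : ℝ) ^ 2) := by
  have h : ({k | 2 ≤ k} : Set ℕ) = ({0} ∪ {1})ᶜ := by
    ext k; simp only [mem_ofPred_eq, mem_compl_iff, mem_union, mem_singleton_iff]; omega
  rw [h, prob_compl_eq_one_sub (by measurability),
    measure_union (by simp) (measurableSet_singleton 1), poissonMeasure_singleton,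
    poissonMeasure_singleton, ← ENNReal.ofReal_add (by positivity) (by positivity),
    ← ENNReal.ofReal_one, ← ENNReal.ofReal_sub _ (by positivity)]
  refine ENNReal.ofReal_le_ofReal ?_
  have := Real.add_one_le_exp (-(r : ℝ))
  simp only [pow_zero, mul_one, Nat.factorial_zero, Nat.cast_one, div_one, pow_one,
    Nat.factorial_one]
  have hr : (0 : ℝ) ≤ r := r.2
  nlinarith

end Poisson

/-! ### Poisson increments, absence of double jumps, and grids. -/

section PoissonFamily

variable {M : ℕ} {Ω : Type*} {mΩ : MeasurableSpace Ω} {μ : Measure Ω}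
  {ℱ : Filtration ℝ mΩ} {T : ℝ} {lam : Fin M → ℝ → ℝ} {N : Fin M → ℝ → Ω → ℕ}

theorem IsPoissonFamily.ae_counting (hN : IsPoissonFamily μ ℱ T lam N) :
    ∀ᵐ ω ∂μ, ∀ j, IsCountingPath T (fun t => N j t ω) ∧ N j 0 ω = 0 := by
  filter_upwards [ae_all_iff.2 hN.paths] with ω h j
  exact ⟨⟨(h j).2.1, (h j).2.2⟩, (h j).1⟩

theorem IsPoissonFamily.measurable (hN : IsPoissonFamily μ ℱ T lam N) (j : Fin M) {t : ℝ}
    (ht : t ∈ Icc 0 T) : Measurable (N j t) := (hN.adapted j t ht).mono (ℱ.le t) le_rfl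

theorem IsAdmissible.integral_mem {T : ℝ} {lam : Fin M → ℝ → ℝ} (h : IsAdmissible T lam) {L : ℝ}
    (hL : ∀ᵐ t ∂(volume.restrict (Icc 0 T)), ∀ j, 0 ≤ lam j t ∧ lam j t ≤ L) (j : Fin M) {s t : ℝ}
    (hs : 0 ≤ s) (hst : s ≤ t) (ht : t ≤ T) :
    0 ≤ ∫ u in s..t, lam j u ∧ ∫ u in s..t, lam j u ≤ L * (t - s) := by
  have hi := intervalIntegrable_mono (h.intervalIntegrable (hs.trans (hst.trans ht)) j) hs hst ht
  have hL' := ae_restrict_of_ae_restrict_of_subset (Icc_subset_Icc hs ht) hL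
  constructor
  · exact intervalIntegral.integral_nonneg_of_ae_restrict hst (hL'.mono fun u hu => (hu j).1)
  · have := intervalIntegral.integral_mono_ae_restrict hst hi (by simp)
      (hL'.mono fun u hu => (hu j).2 : lam j ≤ᵐ[volume.restrict (Icc s t)] fun _ => L)
    rw [intervalIntegral.integral_const, smul_eq_mul, mul_comm] at this
    exact this

/-- The laws are stated for truncated subtraction of naturals; monotone paths make it agree with the
real difference. -/
theorem IsPoissonFamily.ae_cast_sub (hN : IsPoissonFamily μ ℱ T lam N) (j : Fin M) {s t : ℝ}
    (hs : 0 ≤ s) (hst : s ≤ t) (ht : t ≤ T) :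
    (fun ω => (N j t ω : ℝ) - N j s ω) =ᵐ[μ] fun ω => ((N j t ω - N j s ω : ℕ) : ℝ) := by
  filter_upwards [hN.ae_counting] with ω h
  rw [Nat.cast_sub ((h j).1.mono ⟨hs, hst.trans ht⟩ ⟨hs.trans hst, ht⟩ hst)]

theorem IsPoissonFamily.integrable_sub (hN : IsPoissonFamily μ ℱ T lam N) (j : Fin M) {s t : ℝ}
    (hs : 0 ≤ s) (hst : s ≤ t) (ht : t ≤ T) :
    Integrable (fun ω => (N j t ω : ℝ) - N j s ω) μ := by
  rw [integrable_congr (hN.ae_cast_sub j hs hst ht)]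
  have hl := hN.law j s t hs hst ht
  have h := integrable_poissonMeasure_natCast (∫ u in s..t, lam j u).toNNReal
  rw [← hl.map_eq] at h
  exact (integrable_map_measure h.aestronglyMeasurable hl.aemeasurable).1 h

theorem IsPoissonFamily.integral_sub (hlam : IsAdmissible T lam)
    (hN : IsPoissonFamily μ ℱ T lam N) (j : Fin M) {s t : ℝ}
    (hs : 0 ≤ s) (hst : s ≤ t) (ht : t ≤ T) :
    ∫ ω, ((N j t ω : ℝ) - N j s ω) ∂μ = ∫ u in s..t, lam j u := by
  obtain ⟨L, -, hL⟩ := hlam.exists_bound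
  rw [integral_congr_ae (hN.ae_cast_sub j hs hst ht)]
  have hl := hN.law j s t hs hst ht
  have h := integrable_poissonMeasure_natCast (∫ u in s..t, lam j u).toNNReal
  have h2 := hl.integral_comp (f := fun k : ℕ => (k : ℝ)) h.aestronglyMeasurable
  rw [integral_poissonMeasure_natCast, Real.coe_toNNReal _
    (hlam.integral_mem hL j hs hst ht).1] at h2
  exact h2

theorem IsPoissonFamily.indepFun_past (hN : IsPoissonFamily μ ℱ T lam N) (j : Fin M) {s t : ℝ}
    (hs : 0 ≤ s) (hst : s ≤ t) (ht : t ≤ T) {Z : Ω → ℝ} (hZ : Measurable[ℱ s] Z) :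
    IndepFun Z (fun ω => N j t ω - N j s ω) μ := by
  rw [IndepFun_iff_Indep]
  refine (indep_of_indep_of_le (hN.indep_past s t hs hst ht) ?_ hZ.comap_le).symm
  have : (fun ω => N j t ω - N j s ω)
      = (fun x : Fin M → ℕ => x j) ∘ (fun ω (j : Fin M) => N j t ω - N j s ω) := rfl
  rw [this, ← MeasurableSpace.comap_comp]
  exact MeasurableSpace.comap_mono (measurable_pi_apply j).comap_le

theorem IsPoissonFamily.integral_mul_sub (hlam : IsAdmissible T lam)
    (hN : IsPoissonFamily μ ℱ T lam N) (j : Fin M) {s t : ℝ}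
    (hs : 0 ≤ s) (hst : s ≤ t) (ht : t ≤ T) {Z : Ω → ℝ} (hZ : Measurable[ℱ s] Z) :
    ∫ ω, Z ω * ((N j t ω : ℝ) - N j s ω) ∂μ = (∫ ω, Z ω ∂μ) * ∫ u in s..t, lam j u := by
  have h1 : (fun ω => Z ω * ((N j t ω : ℝ) - N j s ω))
      =ᵐ[μ] fun ω => Z ω * ((N j t ω - N j s ω : ℕ) : ℝ) := by
    filter_upwards [hN.ae_cast_sub j hs hst ht] with ω h
    rw [h]
  rw [integral_congr_ae h1, (hN.indepFun_past j hs hst ht hZ).integral_fun_comp_mul_comp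
    (f := fun x => x) (g := fun k : ℕ => (k : ℝ)) (hZ.mono (ℱ.le s) le_rfl).aemeasurable
    (hN.law j s t hs hst ht).aemeasurable aestronglyMeasurable_id
    StronglyMeasurable.of_discrete.aestronglyMeasurable,
    ← integral_congr_ae (hN.ae_cast_sub j hs hst ht), hN.integral_sub hlam j hs hst ht]

theorem IsPoissonFamily.measure_one_le (hlam : IsAdmissible T lam)
    (hN : IsPoissonFamily μ ℱ T lam N) {L : ℝ}
    (hL : ∀ᵐ t ∂(volume.restrict (Icc 0 T)), ∀ j, 0 ≤ lam j t ∧ lam j t ≤ L) (j : Fin M) {s t : ℝ}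
    (hs : 0 ≤ s) (hst : s ≤ t) (ht : t ≤ T) :
    μ {ω | 1 ≤ N j t ω - N j s ω} ≤ ENNReal.ofReal (L * (t - s)) := by
  rw [(hN.law j s t hs hst ht).measure_eq (p := fun k => 1 ≤ k) (MeasurableSet.of_discrete)]
  refine (poissonMeasure_one_le _).trans (ENNReal.ofReal_le_ofReal ?_)
  have := hlam.integral_mem hL j hs hst ht
  rw [Real.coe_toNNReal _ this.1]
  exact this.2

theorem IsPoissonFamily.measure_two_le (hlam : IsAdmissible T lam)
    (hN : IsPoissonFamily μ ℱ T lam N) {L : ℝ}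
    (hL : ∀ᵐ t ∂(volume.restrict (Icc 0 T)), ∀ j, 0 ≤ lam j t ∧ lam j t ≤ L) (j : Fin M) {s t : ℝ}
    (hs : 0 ≤ s) (hst : s ≤ t) (ht : t ≤ T) :
    μ {ω | 2 ≤ N j t ω - N j s ω} ≤ ENNReal.ofReal ((L * (t - s)) ^ 2) := by
  rw [(hN.law j s t hs hst ht).measure_eq (p := fun k => 2 ≤ k) (MeasurableSet.of_discrete)]
  refine (poissonMeasure_two_le _).trans (ENNReal.ofReal_le_ofReal ?_)
  have := hlam.integral_mem hL j hs hst ht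
  rw [Real.coe_toNNReal _ this.1]
  exact pow_le_pow_left₀ this.1 this.2 2

/-- Two events in total mean either two from one sensor or one from each of two distinct sensors.
Each of the `M * M` cases has probability at most `(L (t - s))²`, the mixed ones by independence. -/
theorem IsPoissonFamily.measure_sum_two_le (hlam : IsAdmissible T lam)
    (hN : IsPoissonFamily μ ℱ T lam N) {L : ℝ} (hL0 : 0 ≤ L)
    (hL : ∀ᵐ t ∂(volume.restrict (Icc 0 T)), ∀ j, 0 ≤ lam j t ∧ lam j t ≤ L) {s t : ℝ}
    (hs : 0 ≤ s) (hst : s ≤ t) (ht : t ≤ T) :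
    μ {ω | 2 ≤ ∑ j, (N j t ω - N j s ω)} ≤ ENNReal.ofReal (M * M * (L * (t - s)) ^ 2) := by
  classical
  set B : Fin M → Fin M → Set Ω := fun i j => if i = j then {ω | 2 ≤ N j t ω - N j s ω}
    else {ω | 1 ≤ N i t ω - N i s ω} ∩ {ω | 1 ≤ N j t ω - N j s ω}
  have hsub : {ω | 2 ≤ ∑ j, (N j t ω - N j s ω)} ⊆ ⋃ i, ⋃ j, B i j := by
    intro ω hω
    rw [mem_ofPred_eq] at hω
    obtain ⟨i, hi⟩ : ∃ i, N i t ω - N i s ω ≠ 0 := by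
      by_contra! h
      rw [Finset.sum_eq_zero fun j _ => h j] at hω
      omega
    simp only [mem_iUnion]
    by_cases h2 : 2 ≤ N i t ω - N i s ω
    · exact ⟨i, i, by simpa [B] using h2⟩
    · have h4 := Finset.add_sum_erase Finset.univ (fun j => N j t ω - N j s ω) (Finset.mem_univ i)
      obtain ⟨j, hj, hj2⟩ : ∃ j ∈ Finset.univ.erase i, N j t ω - N j s ω ≠ 0 := by
        by_contra! h
        rw [Finset.sum_eq_zero h] at h4
        omega
      refine ⟨i, j, ?_⟩
      have hne : i ≠ j := (Finset.ne_of_mem_erase hj).symm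
      simp only [B, if_neg hne, mem_inter_iff, mem_ofPred_eq]
      omega
  have hB : ∀ i j, μ (B i j) ≤ ENNReal.ofReal ((L * (t - s)) ^ 2) := by
    intro i j
    by_cases hij : i = j
    · simp only [B, if_pos hij]; exact hN.measure_two_le hlam hL j hs hst ht
    · simp only [B, if_neg hij]
      have h1 := ((hN.indep_sensors s t hs hst ht).indepFun hij).measure_inter_preimage_eq_mul
        {k | 1 ≤ k} {k | 1 ≤ k} MeasurableSet.of_discrete MeasurableSet.of_discrete
      simp only [preimage_ofPred_eq] at h1
      rw [h1, sq, ENNReal.ofReal_mul (mul_nonneg hL0 (sub_nonneg.2 hst))]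
      exact mul_le_mul' (hN.measure_one_le hlam hL i hs hst ht)
        (hN.measure_one_le hlam hL j hs hst ht)
  calc μ {ω | 2 ≤ ∑ j, (N j t ω - N j s ω)} ≤ μ (⋃ i, ⋃ j, B i j) := measure_mono hsub
    _ ≤ ∑ i, μ (⋃ j, B i j) := measure_iUnion_fintype_le _ _
    _ ≤ ∑ i : Fin M, ∑ j : Fin M, ENNReal.ofReal ((L * (t - s)) ^ 2) :=
        Finset.sum_le_sum fun i _ => (measure_iUnion_fintype_le _ _).trans
          (Finset.sum_le_sum fun j _ => hB i j)
    _ = ENNReal.ofReal (M * M * (L * (t - s)) ^ 2) := by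
        simp only [Finset.sum_const, Finset.card_univ, Fintype.card_fin, nsmul_eq_mul]
        rw [ENNReal.ofReal_mul (by positivity), ENNReal.ofReal_mul (by positivity),
          ENNReal.ofReal_natCast, mul_assoc]

/-- The `i`-th point of the grid of `[0,t]` with `K + 1` cells. -/
noncomputable def gridPt (t : ℝ) (K i : ℕ) : ℝ := i * t / (K + 1)

theorem gridPt_succ_sub (t : ℝ) (K i : ℕ) : gridPt t K (i + 1) - gridPt t K i = t / (K + 1) := by
  simp only [gridPt]; push_cast; ring

theorem gridPt_mono {t : ℝ} (ht : 0 ≤ t) (K : ℕ) : Monotone (gridPt t K) := fun i j hij => by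
  simp only [gridPt]; gcongr

theorem gridPt_nonneg {t : ℝ} (ht : 0 ≤ t) (K i : ℕ) : 0 ≤ gridPt t K i := by
  simp only [gridPt]; positivity

theorem gridPt_zero (t : ℝ) (K : ℕ) : gridPt t K 0 = 0 := by simp [gridPt]

theorem gridPt_last (t : ℝ) (K : ℕ) : gridPt t K (K + 1) = t := by
  simp only [gridPt]; push_cast; field_simp

theorem gridPt_le {t : ℝ} (ht : 0 ≤ t) {K i : ℕ} (hi : i ≤ K + 1) : gridPt t K i ≤ t := by
  calc gridPt t K i ≤ gridPt t K (K + 1) := gridPt_mono ht K hi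
    _ = t := gridPt_last t K

/-- The index of the grid cell `(tᵢ, tᵢ₊₁]` containing `s`. -/
noncomputable def gridIdx (t : ℝ) (K : ℕ) (s : ℝ) : ℕ := ⌈s * (K + 1) / t⌉₊ - 1

/-- Cells are open on the left, so the left grid point lies strictly before `s` and sampling there
produces left limits. -/
theorem mem_gridCell_iff {t : ℝ} (ht : 0 < t) {K i : ℕ} {s : ℝ} (hs : 0 < s) :
    s ∈ Ioc (gridPt t K i) (gridPt t K (i + 1)) ↔ gridIdx t K s = i := by
  have h1 : ⌈s * (K + 1) / t⌉₊ = i + 1 ↔ (i : ℝ) < s * (K + 1) / t ∧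
      s * (K + 1) / t ≤ (i + 1 : ℕ) := by
    rw [Nat.ceil_eq_iff (by omega)]; simp
  have h2 : 0 < ⌈s * (K + 1) / t⌉₊ := Nat.ceil_pos.2 (by positivity)
  have h3 : gridIdx t K s = i ↔ ⌈s * (K + 1) / t⌉₊ = i + 1 := by
    simp only [gridIdx]; omega
  rw [h3, h1, mem_Ioc, gridPt, gridPt, lt_div_iff₀ ht, div_lt_iff₀ (by positivity),
    div_le_iff₀ ht, le_div_iff₀ (by positivity)]

theorem gridIdx_lt {t : ℝ} (ht : 0 < t) {K : ℕ} {s : ℝ} (hs : s ∈ Ioc 0 t) :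
    gridIdx t K s < K + 1 := by
  have h2 : ⌈s * (K + 1) / t⌉₊ ≤ K + 1 := by
    rw [Nat.ceil_le, div_le_iff₀ ht]
    push_cast
    nlinarith [hs.2]
  simp only [gridIdx]; omega

theorem tendsto_gridPt_gridIdx {t : ℝ} (ht : 0 < t) {s : ℝ} (hs : s ∈ Ioc 0 t) :
    Tendsto (fun K => gridPt t K (gridIdx t K s)) atTop (𝓝[<] s) := by
  have hmem : ∀ K, s ∈ Ioc (gridPt t K (gridIdx t K s)) (gridPt t K (gridIdx t K s + 1)) :=
    fun K => (mem_gridCell_iff ht hs.1).2 rfl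
  refine tendsto_nhdsWithin_iff.2 ⟨?_, Eventually.of_forall fun K => (hmem K).1⟩
  have h1 : Tendsto (fun K : ℕ => s - t * (1 / ((K : ℝ) + 1))) atTop (𝓝 s) := by
    simpa using ((tendsto_one_div_add_atTop_nhds_zero_nat (𝕜 := ℝ)).const_mul t).const_sub s
  refine tendsto_of_tendsto_of_tendsto_of_le_of_le h1 tendsto_const_nhds (fun K => ?_)
    fun K => (hmem K).1.le
  have h2 := gridPt_succ_sub t K (gridIdx t K s)
  have h3 := (hmem K).2
  have h4 : t * (1 / ((K : ℝ) + 1)) = t / (K + 1) := by ring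
  simp only [h4]
  linarith

theorem measure_eq_zero_of_le_div {s : Set Ω} {C : ℝ}
    (h : ∀ K : ℕ, μ s ≤ ENNReal.ofReal (C * (1 / ((K : ℝ) + 1)))) : μ s = 0 := by
  have h1 : Tendsto (fun K : ℕ => ENNReal.ofReal (C * (1 / ((K : ℝ) + 1)))) atTop (𝓝 0) := by
    have := (tendsto_one_div_add_atTop_nhds_zero_nat (𝕜 := ℝ)).const_mul C
    rw [mul_zero] at this
    simpa using ENNReal.tendsto_ofReal this
  exact le_antisymm (ge_of_tendsto' h1 h) bot_le

/-- With `K + 1` cells of length `T / (K + 1)`, some cell carries two events with probability `O(1 /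
(K + 1))`. So almost surely some grid has at most one event per cell, and the left end of the cell
of `t` serves as the earlier time. -/
theorem IsPoissonFamily.ae_noDoubleJump (hlam : IsAdmissible T lam)
    (hN : IsPoissonFamily μ ℱ T lam N) :
    ∀ᵐ ω ∂μ, NoDoubleJump T (fun j t => N j t ω) := by
  rcases le_or_gt T 0 with hT | hT
  · exact Eventually.of_forall fun ω t ht => absurd (ht.1.trans_le ht.2) (not_lt.2 hT)
  obtain ⟨L, hL0, hL⟩ := hlam.exists_bound
  set A : ℕ → Set Ω := fun K => ⋃ i ∈ Finset.range (K + 1),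
    {ω | 2 ≤ ∑ j, (N j (gridPt T K (i + 1)) ω - N j (gridPt T K i) ω)}
  have hA : ∀ K, μ (A K) ≤ ENNReal.ofReal ((M * M * (L * T) ^ 2) * (1 / ((K : ℝ) + 1))) := by
    intro K
    refine (measure_biUnion_finset_le _ _).trans ?_
    refine (Finset.sum_le_sum (g := fun _ => ENNReal.ofReal (M * M * (L * (T / (K + 1))) ^ 2))
      fun i hi => ?_).trans ?_
    · have := hN.measure_sum_two_le hlam hL0 hL (gridPt_nonneg hT.le K i)
        (gridPt_mono hT.le K (Nat.le_succ i)) (gridPt_le hT.le (Finset.mem_range.1 hi))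
      rwa [gridPt_succ_sub] at this
    · rw [Finset.sum_const, Finset.card_range, nsmul_eq_mul, ← ENNReal.ofReal_natCast,
        ← ENNReal.ofReal_mul (by positivity)]
      refine ENNReal.ofReal_le_ofReal (le_of_eq ?_)
      push_cast; field_simp
  have h0 : μ (⋂ K, A K) = 0 :=
    measure_eq_zero_of_le_div fun K => (measure_mono (iInter_subset _ K)).trans (hA K)
  filter_upwards [measure_eq_zero_iff_ae_notMem.1 h0, hN.ae_counting] with ω hω hc t ht
  simp only [mem_iInter, not_forall] at hω
  obtain ⟨K, hK⟩ := hω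
  simp only [A, mem_iUnion, not_exists, Finset.mem_range, mem_ofPred_eq, not_le] at hK
  set i := gridIdx T K t
  have hi : i < K + 1 := gridIdx_lt hT ht
  have hmem : t ∈ Ioc (gridPt T K i) (gridPt T K (i + 1)) := (mem_gridCell_iff hT ht.1).2 rfl
  have g0 := gridPt_nonneg hT.le K i
  have g1 : gridPt T K (i + 1) ≤ T := gridPt_le hT.le hi
  refine ⟨gridPt T K i, ⟨g0, hmem.1⟩, ?_⟩
  have h1 := hK i hi
  have h2 : ∑ j, N j (gridPt T K (i + 1)) ω = ∑ j, N j (gridPt T K i) ω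
      + ∑ j, (N j (gridPt T K (i + 1)) ω - N j (gridPt T K i) ω) := by
    rw [← Finset.sum_add_distrib]
    refine Finset.sum_congr rfl fun j _ => ?_
    have h3 : N j (gridPt T K i) ω ≤ N j (gridPt T K (i + 1)) ω :=
      (hc j).1.mono ⟨g0, hmem.1.le.trans ht.2⟩ ⟨ht.1.le.trans hmem.2, g1⟩
      (hmem.1.le.trans hmem.2)
    omega
  have h3 : ∑ j, N j t ω ≤ ∑ j, N j (gridPt T K (i + 1)) ω := Finset.sum_le_sum fun j _ =>
    (hc j).1.mono ⟨ht.1.le, ht.2⟩ ⟨ht.1.le.trans hmem.2, g1⟩ hmem.2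
  change ∑ j, N j t ω ≤ ∑ j, N j (gridPt T K i) ω + 1
  omega

/-- A fixed time is almost surely not a jump time: the probability of an event in `(a K, t]` tends
to zero with the length of the interval. -/
theorem IsPoissonFamily.ae_jump_eq_zero (hlam : IsAdmissible T lam)
    (hN : IsPoissonFamily μ ℱ T lam N) {t : ℝ} (ht : t ∈ Ioc 0 T) :
    ∀ᵐ ω ∂μ, ∀ j, jump (fun u => N j u ω) t = 0 := by
  obtain ⟨L, hL0, hL⟩ := hlam.exists_bound
  refine ae_all_iff.2 fun j => ?_
  set a : ℕ → ℝ := fun K => t - t * (1 / ((K : ℝ) + 1))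
  have ha : ∀ K, 0 ≤ a K ∧ a K < t := fun K => by
    have h1 : 0 < 1 / ((K : ℝ) + 1) := by positivity
    have h2 : 1 / ((K : ℝ) + 1) ≤ 1 := by
      rw [div_le_one (by positivity)]; linarith [(Nat.cast_nonneg K : (0 : ℝ) ≤ K)]
    simp only [a]
    constructor
    · nlinarith [ht.1]
    · nlinarith [ht.1, mul_pos ht.1 h1]
  have h0 : μ (⋂ K, {ω | 1 ≤ N j t ω - N j (a K) ω}) = 0 := by
    refine measure_eq_zero_of_le_div (C := L * t) fun K => ?_
    refine (measure_mono (iInter_subset _ K)).trans ?_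
    refine (hN.measure_one_le hlam hL j (ha K).1 (ha K).2.le ht.2).trans (le_of_eq ?_)
    simp only [a]; congr 1; ring
  filter_upwards [measure_eq_zero_iff_ae_notMem.1 h0, hN.ae_counting] with ω hω hc
  simp only [mem_iInter, not_forall, mem_ofPred_eq, not_le] at hω
  obtain ⟨K, hK⟩ := hω
  have hT : a K ≤ T := (ha K).2.le.trans ht.2
  have h1 : ∀ u ∈ Ico (a K) t, N j u ω = N j (a K) ω := fun u hu => by
    have h2 : N j (a K) ω ≤ N j u ω := (hc j).1.mono ⟨(ha K).1, hT⟩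
      ⟨(ha K).1.trans hu.1, hu.2.le.trans ht.2⟩ hu.1
    have h3 : N j u ω ≤ N j t ω := (hc j).1.mono ⟨(ha K).1.trans hu.1, hu.2.le.trans ht.2⟩
      ⟨ht.1.le, ht.2⟩ hu.2.le
    omega
  rw [jump_eq_of_left (N := fun u => N j u ω) (ha K).2 h1]
  have h2 : N j (a K) ω ≤ N j t ω := (hc j).1.mono ⟨(ha K).1, hT⟩ ⟨ht.1.le, ht.2⟩ (ha K).2.le
  have h3 : N j t ω = N j (a K) ω := by omega
  simp only [h3, sub_self]

end PoissonFamily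

end CDKF

namespace CDKF

/-! ### The compensation formula for Poisson integrals. -/

section Compensator

variable {M : ℕ} {Ω : Type*} {mΩ : MeasurableSpace Ω} {μ : Measure Ω} [IsProbabilityMeasure μ]
  {ℱ : Filtration ℝ mΩ} {T : ℝ} {lam : Fin M → ℝ → ℝ} {N : Fin M → ℝ → Ω → ℕ}

theorem gridCell_subset {t : ℝ} (ht : 0 ≤ t) {K i : ℕ} (hi : i < K + 1) :
    Ioc (gridPt t K i) (gridPt t K (i + 1)) ⊆ Ioc 0 t := fun _ hu =>
  ⟨(gridPt_nonneg ht K i).trans_lt hu.1, hu.2.trans (gridPt_le ht hi)⟩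

/-- Riemann sums against a counting path as finite sums over its jumps. -/
theorem IsCountingPath.riemannSum_eq {T : ℝ} {N : ℝ → ℕ} (h : IsCountingPath T N) {t : ℝ}
    (ht : 0 < t) (htT : t ≤ T) (K : ℕ) (F : ℝ → ℝ) {J : Finset ℝ}
    (hJ : ∀ u, u ∈ J ↔ u ∈ Ioc 0 t ∧ jump N u ≠ 0) :
    ∑ i ∈ Finset.range (K + 1), F (gridPt t K i) * ((N (gridPt t K (i + 1)) : ℝ) - N (gridPt t K i))
      = ∑ u ∈ J, F (gridPt t K (gridIdx t K u)) * jump N u := by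
  classical
  -- Write each increment as its sum of jumps and exchange the sums: each jump time lies in exactly
  -- one cell.
  have h1 : ∀ i ∈ Finset.range (K + 1),
      F (gridPt t K i) * ((N (gridPt t K (i + 1)) : ℝ) - N (gridPt t K i))
        = ∑ u ∈ J, if gridIdx t K u = i then F (gridPt t K i) * jump N u else 0 := by
    intro i hi
    have hi' := Finset.mem_range.1 hi
    rw [h.sub_eq_finsum (gridPt_nonneg ht.le K i) (gridPt_mono ht.le K (Nat.le_succ i))
      ((gridPt_le ht.le hi').trans htT),
      finsum_mem_eq_sum_of_inter_support_eq (t := J.filter fun u => gridIdx t K u = i),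
      Finset.mul_sum, Finset.sum_filter]
    ext u
    simp only [mem_inter_iff, Function.mem_support, Finset.coe_filter, mem_ofPred_eq]
    constructor
    · rintro ⟨hu, hj⟩
      have hu0 := gridCell_subset ht.le hi' hu
      exact ⟨⟨(hJ u).2 ⟨hu0, hj⟩, (mem_gridCell_iff ht hu0.1).1 hu⟩, hj⟩
    · rintro ⟨⟨hu, hidx⟩, hj⟩
      exact ⟨(mem_gridCell_iff ht ((hJ u).1 hu).1.1).2 hidx, hj⟩
  rw [Finset.sum_congr rfl h1, Finset.sum_comm]
  refine Finset.sum_congr rfl fun u hu => ?_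
  rw [Finset.sum_ite_eq, if_pos (Finset.mem_range.2 (gridIdx_lt ht ((hJ u).1 hu).1))]

theorem IsCountingPath.tendsto_riemannSum {T : ℝ} {N : ℝ → ℕ} (h : IsCountingPath T N) {t : ℝ}
    (ht : 0 < t) (htT : t ≤ T) {F Fl : ℝ → ℝ}
    (hF : ∀ u ∈ Ioc 0 T, Tendsto F (𝓝[<] u) (𝓝 (Fl u))) :
    Tendsto (fun K => ∑ i ∈ Finset.range (K + 1),
      F (gridPt t K i) * ((N (gridPt t K (i + 1)) : ℝ) - N (gridPt t K i))) atTop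
      (𝓝 (cInt N Fl t)) := by
  have hfin : {u ∈ Ioc 0 t | jump N u ≠ 0}.Finite :=
    h.finite_jumps.subset fun u hu => ⟨⟨hu.1.1, hu.1.2.trans htT⟩, hu.2⟩
  have hJ : ∀ u, u ∈ hfin.toFinset ↔ u ∈ Ioc 0 t ∧ jump N u ≠ 0 := fun u => by simp
  have h2 : cInt N Fl t = ∑ u ∈ hfin.toFinset, Fl u * jump N u := by
    rw [cInt, finsum_mem_eq_sum_of_inter_support_eq (t := hfin.toFinset)]
    · exact Finset.sum_congr rfl fun u _ => by rw [smul_eq_mul, mul_comm]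
    · ext u
      simp only [mem_inter_iff, Function.mem_support, Finset.mem_coe, hJ]
      constructor
      · rintro ⟨hu, hj⟩
        exact ⟨⟨hu, fun h0 => hj (by simp [h0])⟩, hj⟩
      · rintro ⟨⟨hu, -⟩, hj⟩
        exact ⟨hu, hj⟩
  rw [h2]
  simp only [h.riemannSum_eq ht htT _ F hJ]
  refine tendsto_finsetSum _ fun u hu => ?_
  have hu' := ((hJ u).1 hu).1
  exact ((hF u ⟨hu'.1, hu'.2.trans htT⟩).comp (tendsto_gridPt_gridIdx ht hu')).mul_const _

/-- Riemann sums of a bounded continuous function against a rate. -/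
theorem tendsto_riemannSum_rate {lam : ℝ → ℝ} {t : ℝ} (ht : 0 < t)
    (hl : IntervalIntegrable lam volume 0 t) {f : ℝ → ℝ} {C : ℝ}
    (hfC : ∀ u ∈ Icc 0 t, |f u| ≤ C) (hf : ∀ u ∈ Ioc 0 t, Tendsto f (𝓝[<] u) (𝓝 (f u))) :
    Tendsto (fun K => ∑ i ∈ Finset.range (K + 1),
      f (gridPt t K i) * ∫ u in gridPt t K i..gridPt t K (i + 1), lam u) atTop
      (𝓝 (∫ u in (0 : ℝ)..t, f u * lam u)) := by
  have hcell : ∀ K, ∀ i < K + 1, IntervalIntegrable lam volume (gridPt t K i) (gridPt t K (i + 1)) :=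
    fun K i hi => intervalIntegrable_mono hl (gridPt_nonneg ht.le K i)
      (gridPt_mono ht.le K (Nat.le_succ i)) (gridPt_le ht.le hi)
  -- The Riemann sum is the integral of a step function multiplied by the rate; dominated
  -- convergence then applies although `lam` is only integrable.
  have heq : ∀ K, ∀ i < K + 1, ∀ u ∈ Set.uIoc (gridPt t K i) (gridPt t K (i + 1)),
      f (gridPt t K i) * lam u = f (gridPt t K (gridIdx t K u)) * lam u := by
    intro K i hi u hu
    rw [uIoc_of_le (gridPt_mono ht.le K (Nat.le_succ i))] at hu
    rw [(mem_gridCell_iff ht (gridCell_subset ht.le hi hu).1).1 hu]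
  have hi1 : ∀ K, ∀ i < K + 1, IntervalIntegrable
      (fun u => f (gridPt t K (gridIdx t K u)) * lam u) volume (gridPt t K i)
        (gridPt t K (i + 1)) := fun K i hi =>
    ((hcell K i hi).const_mul (f (gridPt t K i))).congr (fun u hu => heq K i hi u hu)
  have hsum : ∀ K, ∑ i ∈ Finset.range (K + 1),
      f (gridPt t K i) * ∫ u in gridPt t K i..gridPt t K (i + 1), lam u
        = ∫ u in (0 : ℝ)..t, f (gridPt t K (gridIdx t K u)) * lam u := by
    intro K
    have h1 := intervalIntegral.sum_integral_adjacent_intervals (a := gridPt t K) (n := K + 1)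
      (hi1 K)
    rw [gridPt_zero, gridPt_last] at h1
    rw [← h1]
    refine Finset.sum_congr rfl fun i hi => ?_
    rw [← intervalIntegral.integral_const_mul]
    refine intervalIntegral.integral_congr_ae (Eventually.of_forall fun u hu => ?_)
    exact heq K i (Finset.mem_range.1 hi) u hu
  simp only [hsum]
  refine intervalIntegral.tendsto_integral_filter_of_dominated_convergence
    (fun u => C * |lam u|) ?_ ?_ (hl.abs.const_mul C) ?_
  · refine Eventually.of_forall fun K => ?_
    have h1 := IntervalIntegrable.trans_iterate (a := gridPt t K) (n := K + 1) (hi1 K)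
    rw [gridPt_zero, gridPt_last] at h1
    rw [uIoc_of_le ht.le]
    exact h1.1.aestronglyMeasurable
  · refine Eventually.of_forall fun K => Eventually.of_forall fun u hu => ?_
    rw [uIoc_of_le ht.le] at hu
    rw [norm_mul, Real.norm_eq_abs, Real.norm_eq_abs]
    exact mul_le_mul_of_nonneg_right (hfC _ ⟨gridPt_nonneg ht.le _ _,
      gridPt_le ht.le (gridIdx_lt ht hu).le⟩) (abs_nonneg _)
  · refine Eventually.of_forall fun u hu => ?_
    rw [uIoc_of_le ht.le] at hu
    exact ((hf u hu).comp (tendsto_gridPt_gridIdx ht hu)).mul_const _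

/-- The compensation formula for bounded adapted integrands without fixed discontinuities. -/
theorem IsPoissonFamily.integral_cInt (hlam : IsAdmissible T lam)
    (hN : IsPoissonFamily μ ℱ T lam N) (j : Fin M) {F Fl : ℝ → Ω → ℝ} {C : ℝ}
    (hFm : ∀ t ∈ Icc 0 T, Measurable[ℱ t] (F t))
    (hFC : ∀ᵐ ω ∂μ, ∀ t ∈ Icc 0 T, |F t ω| ≤ C)
    (hFl : ∀ᵐ ω ∂μ, ∀ t ∈ Ioc 0 T, Tendsto (fun u => F u ω) (𝓝[<] t) (𝓝 (Fl t ω)))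
    (hFF : ∀ t ∈ Ioc 0 T, ∀ᵐ ω ∂μ, Fl t ω = F t ω) {t : ℝ} (ht : t ∈ Icc 0 T) :
    Integrable (fun ω => cInt (fun u => N j u ω) (fun u => Fl u ω) t) μ ∧
    ∫ ω, cInt (fun u => N j u ω) (fun u => Fl u ω) t ∂μ
      = ∫ u in (0 : ℝ)..t, (∫ ω, F u ω ∂μ) * lam j u := by
  rcases ht.1.eq_or_lt with h0 | h0
  · subst h0; simp [cInt_zero]
  have hT : 0 ≤ T := ht.1.trans ht.2
  set Rm : ℕ → Ω → ℝ := fun K ω => ∑ i ∈ Finset.range (K + 1), F (gridPt t K i) ω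
    * ((N j (gridPt t K (i + 1)) ω : ℝ) - N j (gridPt t K i) ω)
  have hgm : ∀ K, ∀ i ≤ K + 1, gridPt t K i ∈ Icc 0 T := fun K i hi =>
    ⟨gridPt_nonneg h0.le K i, (gridPt_le h0.le hi).trans ht.2⟩
  have hFm' : ∀ t ∈ Icc 0 T, Measurable (F t) := fun t ht => (hFm t ht).mono (ℱ.le t) le_rfl
  have hRmeas : ∀ K, Measurable (Rm K) := fun K => by
    refine Finset.measurable_sum _ fun i hi => ?_
    have hi' := Finset.mem_range.1 hi
    have m1 := hN.measurable j (hgm K (i + 1) hi')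
    have m2 := hN.measurable j (hgm K i hi'.le)
    exact (hFm' _ (hgm K i hi'.le)).mul
      ((measurable_from_top.comp m1).sub (measurable_from_top.comp m2))
  -- The increments are nonnegative and telescope, so every Riemann sum is dominated by `C` times
  -- the total count.
  have hdom : Integrable (fun ω => C * ((N j t ω : ℝ) - N j 0 ω)) μ :=
    (hN.integrable_sub j le_rfl ht.1 ht.2).const_mul C
  have hbound : ∀ K, ∀ᵐ ω ∂μ, ‖Rm K ω‖ ≤ C * ((N j t ω : ℝ) - N j 0 ω) := fun K => by
    filter_upwards [hFC, hN.ae_counting] with ω h1 h2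
    have e : (N j t ω : ℝ) - N j 0 ω = ∑ i ∈ Finset.range (K + 1),
        ((N j (gridPt t K (i + 1)) ω : ℝ) - N j (gridPt t K i) ω) := by
      rw [Finset.sum_range_sub (fun i => (N j (gridPt t K i) ω : ℝ)), gridPt_last, gridPt_zero]
    rw [e, Finset.mul_sum]
    refine (norm_sum_le _ _).trans (Finset.sum_le_sum fun i hi => ?_)
    have hi' := Finset.mem_range.1 hi
    have h3 : N j (gridPt t K i) ω ≤ N j (gridPt t K (i + 1)) ω :=
      (h2 j).1.mono (hgm K i hi'.le) (hgm K (i + 1) hi') (gridPt_mono h0.le K (Nat.le_succ i))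
    have h4 : (0 : ℝ) ≤ (N j (gridPt t K (i + 1)) ω : ℝ) - N j (gridPt t K i) ω := by
      rw [sub_nonneg]; exact_mod_cast h3
    rw [norm_mul, Real.norm_eq_abs, Real.norm_eq_abs, abs_of_nonneg h4]
    exact mul_le_mul_of_nonneg_right (h1 _ (hgm K i hi'.le)) h4
  have hlim : ∀ᵐ ω ∂μ, Tendsto (fun K => Rm K ω) atTop
      (𝓝 (cInt (fun u => N j u ω) (fun u => Fl u ω) t)) := by
    filter_upwards [hFl, hN.ae_counting] with ω h1 h2
    exact (h2 j).1.tendsto_riemannSum h0 ht.2 h1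
  have hI1 := tendsto_integral_of_dominated_convergence _
    (fun K => (hRmeas K).aestronglyMeasurable) hdom hbound hlim
  refine ⟨hdom.mono' (aestronglyMeasurable_of_tendsto_ae atTop
    (fun K => (hRmeas K).aestronglyMeasurable) hlim) ?_, ?_⟩
  · filter_upwards [hlim, ae_all_iff.2 hbound] with ω h1 h2
    exact le_of_tendsto' h1.norm h2
  have hC : ∀ u ∈ Icc 0 T, |∫ ω, F u ω ∂μ| ≤ C := fun u hu => by
    have h1 := norm_integral_le_of_norm_le_const (μ := μ) (f := F u) (C := C)
      (by filter_upwards [hFC] with ω h using h u hu)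
    simpa using h1
  -- `F` itself may jump, but not at a fixed time with positive probability, so its mean is
  -- left-continuous.
  have hfc : ∀ u ∈ Ioc 0 T, Tendsto (fun v => ∫ ω, F v ω ∂μ) (𝓝[<] u) (𝓝 (∫ ω, F u ω ∂μ)) := by
    intro u hu
    have hev : ∀ᶠ v in 𝓝[<] u, v ∈ Icc 0 T := by
      filter_upwards [Ico_mem_nhdsLT hu.1] with v hv using ⟨hv.1, hv.2.le.trans hu.2⟩
    refine tendsto_integral_filter_of_dominated_convergence (fun _ => C)
      (hev.mono fun v hv => (hFm' v hv).aestronglyMeasurable) ?_ (integrable_const C) ?_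
    · filter_upwards [hev] with v hv
      filter_upwards [hFC] with ω h using h v hv
    · filter_upwards [hFl, hFF u hu] with ω h1 h2
      rw [← h2]; exact h1 u hu
  have hl := intervalIntegrable_mono (hlam.intervalIntegrable hT j) le_rfl ht.1 ht.2
  have hI2 := tendsto_riemannSum_rate h0 hl (f := fun u => ∫ ω, F u ω ∂μ)
    (fun u hu => hC u ⟨hu.1, hu.2.trans ht.2⟩) (fun u hu => hfc u ⟨hu.1, hu.2.trans ht.2⟩)
  -- For each grid the two Riemann sums have the same value: sampling at the left end makes `F`
  -- independent of the increment.
  refine tendsto_nhds_unique hI1 (hI2.congr fun K => ?_)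
  rw [integral_finsetSum]
  · refine Finset.sum_congr rfl fun i hi => ?_
    have hi' := Finset.mem_range.1 hi
    rw [hN.integral_mul_sub hlam j (hgm K i hi'.le).1 (gridPt_mono h0.le K (Nat.le_succ i))
      (hgm K (i + 1) hi').2 (hFm _ (hgm K i hi'.le))]
  · intro i hi
    have hi' := Finset.mem_range.1 hi
    refine Integrable.bdd_mul (c := C) (hN.integrable_sub j (hgm K i hi'.le).1
      (gridPt_mono h0.le K (Nat.le_succ i)) (hgm K (i + 1) hi').2)
      (hFm' _ (hgm K i hi'.le)).aestronglyMeasurable ?_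
    filter_upwards [hFC] with ω h using h _ (hgm K i hi'.le)

end Compensator

end CDKF

namespace CDKF

/-! ### Interchange of time integrals and expectations. -/

section Fubini

open scoped Matrix.Norms.L2Operator

variable {E Ω : Type*} [NormedAddCommGroup E] {mΩ : MeasurableSpace Ω} {ν : Measure Ω}
  {T : ℝ}

theorem integrable_prod_of_norm_le {D : ℝ → Ω → E} {a : ℝ → ℝ} {β : Ω → ℝ}
    (hD : AEStronglyMeasurable (fun z : ℝ × Ω => D z.1 z.2) ((volume.restrict (Icc 0 T)).prod ν))
    (ha : IntegrableOn a (Icc 0 T)) (hβ : Integrable β ν)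
    (h : ∀ᵐ ω ∂ν, ∀ t ∈ Icc 0 T, ‖D t ω‖ ≤ a t * β ω) :
    Integrable (fun z : ℝ × Ω => D z.1 z.2) ((volume.restrict (Icc 0 T)).prod ν) := by
  refine (Integrable.mul_prod ha hβ).mono' hD ?_
  have h1 : ∀ᵐ z ∂((volume.restrict (Icc 0 T)).prod ν), z.1 ∈ Icc 0 T :=
    Measure.quasiMeasurePreserving_fst.ae (ae_restrict_mem measurableSet_Icc)
  have h2 := Measure.quasiMeasurePreserving_snd (μ := volume.restrict (Icc 0 T)) (ν := ν) |>.ae h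
  filter_upwards [h1, h2] with z hz1 hz2 using hz2 z.1 hz1

theorem integrable_prod_mono [SFinite ν] {D : ℝ → Ω → E} {s t : ℝ}
    (hD : Integrable (fun z : ℝ × Ω => D z.1 z.2) ((volume.restrict (Icc 0 T)).prod ν))
    (hs : 0 ≤ s) (ht : t ≤ T) :
    Integrable (fun z : ℝ × Ω => D z.1 z.2) ((volume.restrict (Ioc s t)).prod ν) :=
  have h : Ioc s t ⊆ Icc 0 T := fun _ hu => ⟨hs.trans hu.1.le, hu.2.trans ht⟩
  hD.mono_measure (Measure.prod_mono (Measure.restrict_mono h le_rfl) le_rfl)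

variable [NormedSpace ℝ E]

theorem integrable_intervalIntegral [SFinite ν] {D : ℝ → Ω → E} {s t : ℝ}
    (hD : Integrable (fun z : ℝ × Ω => D z.1 z.2) ((volume.restrict (Icc 0 T)).prod ν))
    (hs : 0 ≤ s) (hst : s ≤ t) (ht : t ≤ T) :
    Integrable (fun ω => ∫ u in s..t, D u ω) ν := by
  simp only [intervalIntegral.integral_of_le hst]
  exact (integrable_prod_mono hD hs ht).integral_prod_right

theorem intervalIntegrable_integral [SFinite ν] {D : ℝ → Ω → E} {s t : ℝ}
    (hD : Integrable (fun z : ℝ × Ω => D z.1 z.2) ((volume.restrict (Icc 0 T)).prod ν))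
    (hs : 0 ≤ s) (hst : s ≤ t) (ht : t ≤ T) :
    IntervalIntegrable (fun u => ∫ ω, D u ω ∂ν) volume s t :=
  (intervalIntegrable_iff_integrableOn_Ioc_of_le hst).2
    (integrable_prod_mono hD hs ht).integral_prod_left

theorem integral_intervalIntegral [SFinite ν] {D : ℝ → Ω → E} {s t : ℝ}
    (hD : Integrable (fun z : ℝ × Ω => D z.1 z.2) ((volume.restrict (Icc 0 T)).prod ν))
    (hs : 0 ≤ s) (hst : s ≤ t) (ht : t ≤ T) :
    ∫ ω, (∫ u in s..t, D u ω) ∂ν = ∫ u in s..t, ∫ ω, D u ω ∂ν := by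
  simp only [intervalIntegral.integral_of_le hst]
  exact (integral_integral_swap (integrable_prod_mono hD hs ht)).symm

theorem continuousOn_integral {X : ℝ → Ω → E} {β : Ω → ℝ}
    (hm : ∀ t ∈ Icc 0 T, AEStronglyMeasurable (X t) ν) (hβ : Integrable β ν)
    (hX : ∀ᵐ ω ∂ν, ∀ t ∈ Icc 0 T, ‖X t ω‖ ≤ β ω)
    (hc : ∀ t ∈ Icc 0 T, ∀ᵐ ω ∂ν, ContinuousWithinAt (fun u => X u ω) (Icc 0 T) t) :
    ContinuousOn (fun t => ∫ ω, X t ω ∂ν) (Icc 0 T) := fun t ht =>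
  continuousWithinAt_of_dominated (bound := β)
    (eventually_nhdsWithin_of_forall fun s hs => hm s hs)
    (eventually_nhdsWithin_of_forall fun s hs => by
      filter_upwards [hX] with ω h using h s hs) hβ (hc t ht)

end Fubini

/-! ### The cost functional: monotonicity, linearity, and expectation. -/

section Costs

open scoped Matrix.Norms.L2Operator

variable {n : ℕ} {T : ℝ} {W : ℝ → Matrix (Fin n) (Fin n) ℝ} {WT : Matrix (Fin n) (Fin n) ℝ}

theorem abs_entry_le (X : Matrix (Fin n) (Fin n) ℝ) (i k : Fin n) : |X i k| ≤ ‖X‖ := by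
  have h := abs_bilin_le X (Pi.single k 1) (Pi.single i 1)
  have h1 : ∀ i : Fin n, vnorm (Pi.single i (1 : ℝ)) = 1 := fun i => by
    have h2 := vnorm_sq (Pi.single i (1 : ℝ))
    simp only [single_dotProduct, Pi.single_eq_same, mul_one] at h2
    nlinarith [vnorm_nonneg (Pi.single i (1 : ℝ))]
  simpa [h1] using h

theorem abs_frob_le (W X : Matrix (Fin n) (Fin n) ℝ) : |frob W X| ≤ (∑ i, ∑ k, |W k i|) * ‖X‖ := by
  rw [frob_eq_sum, Finset.sum_mul]
  refine (Finset.abs_sum_le_sum_abs _ _).trans (Finset.sum_le_sum fun i _ => ?_)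
  rw [Finset.sum_mul]
  refine (Finset.abs_sum_le_sum_abs _ _).trans (Finset.sum_le_sum fun k _ => ?_)
  rw [abs_mul]
  exact mul_le_mul_of_nonneg_left (abs_entry_le X k i) (abs_nonneg _)

theorem IsWeight.integrableOn_sum (hW : IsWeight T W WT) :
    IntegrableOn (fun t => ∑ i, ∑ k, |W t k i|) (Icc 0 T) :=
  integrable_finsetSum _ fun i _ => integrable_finsetSum _ fun k _ => (hW.integrable k i).abs

theorem IsWeight.aestronglyMeasurable_frob {Ω : Type*} {mΩ : MeasurableSpace Ω} {ν : Measure Ω}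
    [SFinite ν] (hW : IsWeight T W WT) {X : ℝ → Ω → Matrix (Fin n) (Fin n) ℝ}
    (hX : AEStronglyMeasurable (fun z : ℝ × Ω => X z.1 z.2) ((volume.restrict (Icc 0 T)).prod ν)) :
    AEStronglyMeasurable (fun z : ℝ × Ω => frob (W z.1) (X z.1 z.2))
      ((volume.restrict (Icc 0 T)).prod ν) := by
  simp only [frob_eq_sum]
  refine Finset.aestronglyMeasurable_fun_sum _ fun i _ =>
    Finset.aestronglyMeasurable_fun_sum _ fun k _ => ?_
  exact ((hW.integrable k i).aestronglyMeasurable.comp_fst).mul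
    ((entryL k i).continuous.comp_aestronglyMeasurable hX)

theorem IsWeight.intervalIntegrable_frob (hT : 0 ≤ T) (hW : IsWeight T W WT)
    {X : ℝ → Matrix (Fin n) (Fin n) ℝ}
    (hX : AEStronglyMeasurable X (volume.restrict (Icc 0 T))) {C : ℝ}
    (hC : ∀ t ∈ Icc 0 T, ‖X t‖ ≤ C) :
    IntervalIntegrable (fun t => frob (W t) (X t)) volume 0 T := by
  rw [intervalIntegrable_iff_integrableOn_Icc_of_le hT]
  refine (hW.integrableOn_sum.mul_const C).mono' ?_ ?_
  · simp only [frob_eq_sum]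
    refine Finset.aestronglyMeasurable_fun_sum _ fun i _ =>
      Finset.aestronglyMeasurable_fun_sum _ fun k _ => ?_
    exact (hW.integrable k i).aestronglyMeasurable.mul
      ((entryL k i).continuous.comp_aestronglyMeasurable hX)
  · filter_upwards [ae_restrict_mem measurableSet_Icc] with t ht
    exact (abs_frob_le _ _).trans (mul_le_mul_of_nonneg_left (hC t ht)
      (Finset.sum_nonneg fun i _ => Finset.sum_nonneg fun k _ => abs_nonneg _))

theorem IsWeight.intervalIntegrable_frob_of_continuousOn (hT : 0 ≤ T) (hW : IsWeight T W WT)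
    {X : ℝ → Matrix (Fin n) (Fin n) ℝ} (hX : ContinuousOn X (Icc 0 T)) :
    IntervalIntegrable (fun t => frob (W t) (X t)) volume 0 T := by
  obtain ⟨C, -, hC⟩ := exists_norm_bound hX
  exact hW.intervalIntegrable_frob hT (hX.aestronglyMeasurable measurableSet_Icc) hC

theorem cost_le_cost (hT : 0 ≤ T) (hW : IsWeight T W WT) {X Y : ℝ → Matrix (Fin n) (Fin n) ℝ}
    (hX : IntervalIntegrable (fun t => frob (W t) (X t)) volume 0 T)
    (hY : IntervalIntegrable (fun t => frob (W t) (Y t)) volume 0 T)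
    (hXs : ∀ t ∈ Icc 0 T, (X t).IsSymm) (hYs : ∀ t ∈ Icc 0 T, (Y t).IsSymm)
    (h : ∀ t ∈ Icc 0 T, ∀ v, qf (X t) v ≤ qf (Y t) v) : cost T W WT X ≤ cost T W WT Y := by
  have hTm : T ∈ Icc 0 T := ⟨hT, le_rfl⟩
  refine add_le_add ?_ (frob_le_frob hW.terminal (hXs T hTm) (hYs T hTm) (h T hTm))
  refine intervalIntegral.integral_mono_ae_restrict hT hX hY ?_
  filter_upwards [hW.posSemidef, ae_restrict_mem measurableSet_Icc] with t hWt ht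
  exact frob_le_frob hWt (hXs t ht) (hYs t ht) (h t ht)

theorem cost_smul_add_smul {X Y : ℝ → Matrix (Fin n) (Fin n) ℝ} (a b : ℝ)
    (hX : IntervalIntegrable (fun t => frob (W t) (X t)) volume 0 T)
    (hY : IntervalIntegrable (fun t => frob (W t) (Y t)) volume 0 T) :
    cost T W WT (fun t => a • X t + b • Y t) = a * cost T W WT X + b * cost T W WT Y := by
  simp only [cost, frob_add, frob_smul]
  rw [intervalIntegral.integral_add (hX.const_mul a) (hY.const_mul b),
    intervalIntegral.integral_const_mul, intervalIntegral.integral_const_mul]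
  ring

theorem cost_nonneg (hT : 0 ≤ T) (hW : IsWeight T W WT) {X : ℝ → Matrix (Fin n) (Fin n) ℝ}
    (hX : ∀ t ∈ Icc 0 T, (X t).PosSemidef) : 0 ≤ cost T W WT X := by
  refine add_nonneg ?_ (frob_nonneg hW.terminal (hX T ⟨hT, le_rfl⟩))
  rw [intervalIntegral.integral_of_le hT, ← integral_Icc_eq_integral_Ioc]
  refine integral_nonneg_of_ae ?_
  filter_upwards [hW.posSemidef, ae_restrict_mem measurableSet_Icc] with t hWt ht
  exact frob_nonneg hWt (hX t ht)

theorem frob_integral {Ω : Type*} {mΩ : MeasurableSpace Ω} {ν : Measure Ω}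
    {X : Ω → Matrix (Fin n) (Fin n) ℝ} (hX : Integrable X ν) (U : Matrix (Fin n) (Fin n) ℝ) :
    ∫ ω, frob U (X ω) ∂ν = frob U (∫ ω, X ω ∂ν) := (frobL U).integral_comp_comm hX

theorem qf_integral_measure {Ω : Type*} {mΩ : MeasurableSpace Ω} {ν : Measure Ω}
    {X : Ω → Matrix (Fin n) (Fin n) ℝ} (hX : Integrable X ν) (v : Fin n → ℝ) :
    ∫ ω, qf (X ω) v ∂ν = qf (∫ ω, X ω ∂ν) v := (qfL v).integral_comp_comm hX

theorem isSymm_integral {Ω : Type*} {mΩ : MeasurableSpace Ω} {ν : Measure Ω}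
    {X : Ω → Matrix (Fin n) (Fin n) ℝ} (h : ∀ᵐ ω ∂ν, (X ω).IsSymm) :
    (∫ ω, X ω ∂ν).IsSymm := by
  by_cases hX : Integrable X ν
  · ext i k
    have h1 := (entryL i k).integral_comp_comm hX
    have h2 := (entryL k i).integral_comp_comm hX
    simp only [entryL_apply] at h1 h2
    rw [Matrix.transpose_apply, ← h1, ← h2]
    refine integral_congr_ae ?_
    filter_upwards [h] with ω hω using hω.apply i k
  · rw [integral_undef hX]; exact Matrix.isSymm_zero

/-- The cost of a bounded measurable process is integrable, and its expectation is the cost of the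
mean trajectory. -/
theorem IsWeight.integral_cost {Ω : Type*} {mΩ : MeasurableSpace Ω} {ν : Measure Ω} [SFinite ν]
    (hT : 0 ≤ T) (hW : IsWeight T W WT) {X : ℝ → Ω → Matrix (Fin n) (Fin n) ℝ} {β : Ω → ℝ}
    (hX : AEStronglyMeasurable (fun z : ℝ × Ω => X z.1 z.2) ((volume.restrict (Icc 0 T)).prod ν))
    (hXm : ∀ t ∈ Icc 0 T, AEStronglyMeasurable (X t) ν) (hβ : Integrable β ν)
    (hb : ∀ᵐ ω ∂ν, ∀ t ∈ Icc 0 T, ‖X t ω‖ ≤ β ω) :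
    Integrable (fun ω => cost T W WT (fun t => X t ω)) ν ∧
      ∫ ω, cost T W WT (fun t => X t ω) ∂ν = cost T W WT (fun t => ∫ ω, X t ω ∂ν) := by
  have hI : ∀ t ∈ Icc 0 T, Integrable (X t) ν := fun t ht =>
    hβ.mono' (hXm t ht) (by filter_upwards [hb] with ω h using h t ht)
  have hTm : T ∈ Icc 0 T := ⟨hT, le_rfl⟩
  have hD : Integrable (fun z : ℝ × Ω => frob (W z.1) (X z.1 z.2))
      ((volume.restrict (Icc 0 T)).prod ν) := by
    refine integrable_prod_of_norm_le (D := fun t ω => frob (W t) (X t ω))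
      (hW.aestronglyMeasurable_frob hX) hW.integrableOn_sum hβ ?_
    filter_upwards [hb] with ω h t ht
    exact (abs_frob_le _ _).trans (mul_le_mul_of_nonneg_left (h t ht)
      (Finset.sum_nonneg fun i _ => Finset.sum_nonneg fun k _ => abs_nonneg _))
  have h1 := integrable_intervalIntegral (D := fun t ω => frob (W t) (X t ω)) hD le_rfl hT le_rfl
  have h2 : Integrable (fun ω => frob WT (X T ω)) ν := (frobL WT).integrable_comp (hI T hTm)
  refine ⟨h1.add h2, ?_⟩
  simp only [cost]
  rw [integral_add h1 h2, integral_intervalIntegral (D := fun t ω => frob (W t) (X t ω)) hD le_rfl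
    hT le_rfl, frob_integral (hI T hTm)]
  congr 1
  refine intervalIntegral.integral_congr fun t ht => ?_
  rw [uIcc_of_le hT] at ht
  exact frob_integral (hI t ht) _

theorem IsWeight.aemeasurable_cost {Ω : Type*} {mΩ : MeasurableSpace Ω} {ν : Measure Ω} [SFinite ν]
    (hT : 0 ≤ T) (hW : IsWeight T W WT) {X : ℝ → Ω → Matrix (Fin n) (Fin n) ℝ}
    (hX : AEStronglyMeasurable (fun z : ℝ × Ω => X z.1 z.2) ((volume.restrict (Icc 0 T)).prod ν))
    (hXT : AEStronglyMeasurable (X T) ν) :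
    AEMeasurable (fun ω => cost T W WT (fun t => X t ω)) ν := by
  simp only [cost, intervalIntegral.integral_of_le hT, ← integral_Icc_eq_integral_Ioc]
  exact ((hW.aestronglyMeasurable_frob hX).prod_swap.integral_prod_right'.add
    ((frobL WT).continuous.comp_aestronglyMeasurable hXT)).aemeasurable

end Costs

end CDKF

namespace CDKF

/-! ### The covariance process and the equation for its local means. -/

section Processes

variable {n M : ℕ}

theorem stronglyMeasurable_matrix_inv {Ω : Type*} {m : MeasurableSpace Ω} {k : ℕ}
    {X : Ω → Matrix (Fin k) (Fin k) ℝ} (hX : StronglyMeasurable X) :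
    StronglyMeasurable (fun ω => (X ω)⁻¹) := by
  simp only [Matrix.inv_def, Ring.inverse_eq_inv']
  have h1 : StronglyMeasurable (fun ω => (X ω).det) :=
    continuous_id.matrix_det.comp_stronglyMeasurable hX
  have h2 : StronglyMeasurable (fun ω => (X ω).adjugate) :=
    continuous_id.matrix_adjugate.comp_stronglyMeasurable hX
  exact h1.measurable.inv.stronglyMeasurable.smul h2

theorem stronglyMeasurable_matrix_mul {Ω : Type*} {mΩ : MeasurableSpace Ω} {a b c : ℕ}
    {X : Ω → Matrix (Fin a) (Fin b) ℝ} {Y : Ω → Matrix (Fin b) (Fin c) ℝ}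
    (hX : StronglyMeasurable X) (hY : StronglyMeasurable Y) :
    StronglyMeasurable (fun ω => X ω * Y ω) :=
  (continuous_fst.matrix_mul continuous_snd).comp_stronglyMeasurable (hX.prodMk hY)

theorem Model.stronglyMeasurable_g (S : Model n M) (j : Fin M) {Ω : Type*}
    {mΩ : MeasurableSpace Ω} {X : Ω → Matrix (Fin n) (Fin n) ℝ} (hX : StronglyMeasurable X) :
    StronglyMeasurable (fun ω => S.g j (X ω)) := by
  have hc : ∀ {a b : ℕ} (Z : Matrix (Fin a) (Fin b) ℝ), StronglyMeasurable fun _ : Ω => Z :=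
    fun _ => stronglyMeasurable_const
  have h1 : StronglyMeasurable fun ω => S.H j * X ω * (S.H j)ᵀ + S.R j :=
    (stronglyMeasurable_matrix_mul (stronglyMeasurable_matrix_mul (hc _) hX) (hc _)).add (hc _)
  have h2 := stronglyMeasurable_matrix_inv h1
  simp only [Model.g]
  exact stronglyMeasurable_matrix_mul (stronglyMeasurable_matrix_mul (stronglyMeasurable_matrix_mul
    (stronglyMeasurable_matrix_mul hX (hc _)) h2) (hc _)) hX

open scoped Matrix.Norms.L2Operator

/-- The operator `X ↦ X G + Gᵀ X`. -/
noncomputable def lyapL (G : Matrix (Fin n) (Fin n) ℝ) :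
    Matrix (Fin n) (Fin n) ℝ →L[ℝ] Matrix (Fin n) (Fin n) ℝ :=
  LinearMap.toContinuousLinearMap
    { toFun := fun X => X * G + Gᵀ * X
      map_add' := fun X Y => by rw [add_mul, mul_add]; abel
      map_smul' := fun c X => by simp [smul_add] }

theorem lyapL_apply (G X : Matrix (Fin n) (Fin n) ℝ) : lyapL G X = X * G + Gᵀ * X := rfl

theorem IsCountingPath.cInt_apply {T : ℝ} {N : ℝ → ℕ} (h : IsCountingPath T N)
    (F : ℝ → Matrix (Fin n) (Fin n) ℝ) {t : ℝ} (ht : t ≤ T) (i k : Fin n) :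
    cInt N F t i k = cInt N (fun s => F s i k) t := by
  have := (entryL i k).toLinearMap.toAddMonoidHom.map_finsum_mem'
    (h.finite_support F le_rfl ht)
  exact this

/-- The constant does not depend on the initial value and the bound is affine in it; this is how
integrability of `P 0` passes to the whole trajectory. -/
theorem exists_gronwallBound_le {K ε T : ℝ} (hK : 0 ≤ K) (hε : 0 ≤ ε) (hT : 0 ≤ T) :
    ∃ c : ℝ, 0 ≤ c ∧ ∀ δ, 0 ≤ δ → ∀ t ∈ Icc 0 T, gronwallBound δ K ε t ≤ c * (1 + δ) := by
  rcases hK.eq_or_lt with rfl | hK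
  · refine ⟨1 + ε * T, by positivity, fun δ hδ t ht => ?_⟩
    rw [gronwallBound_K0]
    have h1 := mul_le_mul_of_nonneg_left ht.2 hε
    have h2 : 0 ≤ ε * T * δ := by positivity
    nlinarith
  · refine ⟨(1 + ε / K) * Real.exp (K * T), by positivity, fun δ hδ t ht => ?_⟩
    rw [gronwallBound_of_K_ne_0 hK.ne']
    have h1 : Real.exp (K * t) ≤ Real.exp (K * T) :=
      Real.exp_le_exp.2 (mul_le_mul_of_nonneg_left ht.2 hK.le)
    have h2 : 0 ≤ ε / K := by positivity
    have h3 := mul_le_mul_of_nonneg_left h1 hδ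
    have h4 := mul_le_mul_of_nonneg_left h1 h2
    have h5 : 0 ≤ Real.exp (K * T) := (Real.exp_pos _).le
    have h6 : 0 ≤ ε / K * Real.exp (K * T) * δ := by positivity
    show δ * Real.exp (K * t) + ε / K * (Real.exp (K * t) - 1) ≤ _
    nlinarith

variable {S : Model n M} {T : ℝ} {lam : Fin M → ℝ → ℝ} {Ω : Type*} {mΩ : MeasurableSpace Ω}
  {μ : Measure Ω} {ℱ : Filtration ℝ mΩ} {N : Fin M → ℝ → Ω → ℕ}
  {P : ℝ → Ω → Matrix (Fin n) (Fin n) ℝ}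

theorem IsCovarianceProcess.ae_isCovPath (hP : IsCovarianceProcess μ ℱ T S N P)
    (hN : IsPoissonFamily μ ℱ T lam N) :
    ∀ᵐ ω ∂μ, IsCovPath T S (fun j t => N j t ω) (fun t => P t ω) := by
  filter_upwards [hN.ae_counting, hP.posDef, hP.right_continuous, hP.left_limits, hP.equation]
    with ω h1 h2 h3 h4 h5 using ⟨fun j => (h1 j).1, h2, ⟨h3, h4⟩, h5⟩

theorem IsCovarianceProcess.stronglyMeasurable (hP : IsCovarianceProcess μ ℱ T S N P) {t : ℝ}
    (ht : t ∈ Icc 0 T) : StronglyMeasurable (P t) := (hP.adapted t ht).mono (ℱ.le t)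

theorem IsCovarianceProcess.aestronglyMeasurable_prod {ν : Measure Ω} [SFinite ν] (hT : 0 ≤ T)
    (hP : IsCovarianceProcess μ ℱ T S N P) (hν : ν ≪ μ) :
    AEStronglyMeasurable (fun z : ℝ × Ω => P z.1 z.2) ((volume.restrict (Icc 0 T)).prod ν) :=
  aestronglyMeasurable_prod_of_rc hT (fun _ ht => hP.stronglyMeasurable ht)
    (hν.ae_le hP.right_continuous)

theorem IsCovarianceProcess.aestronglyMeasurable_prod_inv {ν : Measure Ω} [SFinite ν] (hT : 0 ≤ T)
    (hP : IsCovarianceProcess μ ℱ T S N P) (hN : IsPoissonFamily μ ℱ T lam N) (hν : ν ≪ μ) :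
    AEStronglyMeasurable (fun z : ℝ × Ω => (P z.1 z.2)⁻¹)
      ((volume.restrict (Icc 0 T)).prod ν) := by
  refine aestronglyMeasurable_prod_of_rc (X := fun t ω => (P t ω)⁻¹) hT
    (fun _ ht => stronglyMeasurable_matrix_inv (hP.stronglyMeasurable ht)) (hν.ae_le ?_)
  filter_upwards [hP.ae_isCovPath hN] with ω h using (h.cadlag_inv hT).rc

/-- No fixed discontinuities: the null set depends on `t`, which is enough for identities between
means. -/
theorem IsCovarianceProcess.ae_leftLim_eq (hT : 0 ≤ T) (hlam : IsAdmissible T lam)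
    (hN : IsPoissonFamily μ ℱ T lam N) (hP : IsCovarianceProcess μ ℱ T S N P) {t : ℝ}
    (ht : t ∈ Ioc 0 T) : ∀ᵐ ω ∂μ, Function.leftLim (fun u => P u ω) t = P t ω := by
  filter_upwards [hP.ae_isCovPath hN, hN.ae_jump_eq_zero hlam ht] with ω h hj
  have := h.eq_leftLim_sub hT ht
  simpa [hj] using this.symm

theorem IsCovarianceProcess.ae_continuousWithinAt (hT : 0 ≤ T) (hlam : IsAdmissible T lam)
    (hN : IsPoissonFamily μ ℱ T lam N) (hP : IsCovarianceProcess μ ℱ T S N P) {t : ℝ}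
    (ht : t ∈ Icc 0 T) : ∀ᵐ ω ∂μ, ContinuousWithinAt (fun u => P u ω) (Icc 0 T) t := by
  rcases ht.1.eq_or_lt with h0 | h0
  · filter_upwards [hP.ae_isCovPath hN] with ω h
    exact h.continuousWithinAt hT ht fun h1 => absurd h1 (by rw [← h0]; exact lt_irrefl _)
  · filter_upwards [hP.ae_isCovPath hN, hN.ae_jump_eq_zero hlam ⟨h0, ht.2⟩] with ω h hj
    exact h.continuousWithinAt hT ht fun _ => hj

theorem IsCovarianceProcess.exists_norm_le (hT : 0 ≤ T) (hN : IsPoissonFamily μ ℱ T lam N)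
    (hP : IsCovarianceProcess μ ℱ T S N P) :
    ∃ c : ℝ, 0 ≤ c ∧ ∀ᵐ ω ∂μ, ∀ t ∈ Icc 0 T, ‖P t ω‖ ≤ c * (1 + ‖P 0 ω‖) := by
  obtain ⟨c, hc, h⟩ := exists_gronwallBound_le (K := 2 * ‖S.A‖) (ε := ‖S.Q‖) (by positivity)
    (norm_nonneg _) hT
  refine ⟨c, hc, ?_⟩
  filter_upwards [hP.ae_isCovPath hN] with ω hω t ht
  exact (hω.norm_le hT ht).trans (h _ (norm_nonneg _) t ht)

/-- Means of the covariance process over an event of the past on which it starts bounded. -/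
theorem IsCovarianceProcess.setIntegral_eq [IsProbabilityMeasure μ] (hT : 0 ≤ T) (hlam : IsAdmissible T lam)
    (hN : IsPoissonFamily μ ℱ T lam N) (hP : IsCovarianceProcess μ ℱ T S N P) {B : Set Ω}
    (hB : MeasurableSet[ℱ 0] B) {κ : ℝ} (hκ : ∀ ω ∈ B, ‖P 0 ω‖ ≤ κ) :
    (∃ C, ∀ᵐ ω ∂(μ.restrict B), ∀ t ∈ Icc 0 T, ‖P t ω‖ ≤ C) ∧
    ContinuousOn (fun t => ∫ ω in B, P t ω ∂μ) (Icc 0 T) ∧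
    (∀ j, ContinuousOn (fun t => ∫ ω in B, S.g j (P t ω) ∂μ) (Icc 0 T)) ∧
    ∀ t ∈ Icc 0 T, ∫ ω in B, P t ω ∂μ = (∫ ω in B, P 0 ω ∂μ) + ∫ u in (0 : ℝ)..t,
      (S.A * (∫ ω in B, P u ω ∂μ) + (∫ ω in B, P u ω ∂μ) * S.Aᵀ + μ.real B • S.Q
        - ∑ j, lam j u • ∫ ω in B, S.g j (P u ω) ∂μ) := by
  have hB' : MeasurableSet B := ℱ.le 0 _ hB
  set ν := μ.restrict B with hν
  have hac : ν ≪ μ := Measure.absolutelyContinuous_of_le Measure.restrict_le_self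
  obtain ⟨c, hc, hcb⟩ := hP.exists_norm_le hT hN
  obtain ⟨C, hC0, hC⟩ : ∃ C, 0 ≤ C ∧ ∀ᵐ ω ∂μ, ω ∈ B → ∀ t ∈ Icc 0 T, ‖P t ω‖ ≤ C := by
    refine ⟨c * (1 + |κ|), by positivity, ?_⟩
    filter_upwards [hcb] with ω h hω t ht
    exact (h t ht).trans (mul_le_mul_of_nonneg_left
      (add_le_add le_rfl ((hκ ω hω).trans (le_abs_self κ))) hc)
  have hCν : ∀ᵐ ω ∂ν, ∀ t ∈ Icc 0 T, ‖P t ω‖ ≤ C := (ae_restrict_iff' hB').2 hC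
  have hpath : ∀ᵐ ω ∂μ, IsCovPath T S (fun j t => N j t ω) (fun t => P t ω) :=
    hP.ae_isCovPath hN
  have hgC : ∀ᵐ ω ∂μ, ω ∈ B → ∀ j, ∀ t ∈ Icc 0 T, ‖S.g j (P t ω)‖ ≤ C := by
    filter_upwards [hC, hpath] with ω h1 h2 hω j t ht
    exact (S.norm_g_le j (h2.posDef t ht).posSemidef).trans (h1 hω t ht)
  have hm : ∀ t ∈ Icc 0 T, AEStronglyMeasurable (P t) ν := fun t ht =>
    (hP.stronglyMeasurable ht).aestronglyMeasurable
  have hgm : ∀ j, ∀ t ∈ Icc 0 T, StronglyMeasurable (fun ω => S.g j (P t ω)) := fun j t ht =>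
    S.stronglyMeasurable_g j (hP.stronglyMeasurable ht)
  have hI : ∀ t ∈ Icc 0 T, Integrable (P t) ν := fun t ht =>
    (integrable_const C).mono' (hm t ht) (by filter_upwards [hCν] with ω h using h t ht)
  have hgI : ∀ j, ∀ t ∈ Icc 0 T, Integrable (fun ω => S.g j (P t ω)) ν := fun j t ht =>
    (integrable_const C).mono' (hgm j t ht).aestronglyMeasurable
      (by filter_upwards [(ae_restrict_iff' hB').2 hgC] with ω h using h j t ht)
  have hX : ContinuousOn (fun t => ∫ ω, P t ω ∂ν) (Icc 0 T) :=
    continuousOn_integral hm (integrable_const C) hCν fun t ht =>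
      hac.ae_le (hP.ae_continuousWithinAt hT hlam hN ht)
  have hγ : ∀ j, ContinuousOn (fun t => ∫ ω, S.g j (P t ω) ∂ν) (Icc 0 T) := fun j => by
    refine continuousOn_integral (fun t ht => (hgm j t ht).aestronglyMeasurable)
      (integrable_const C) ?_ fun t ht => hac.ae_le ?_
    · filter_upwards [(ae_restrict_iff' hB').2 hgC] with ω h using h j
    · filter_upwards [hP.ae_continuousWithinAt hT hlam hN ht, hpath] with ω h1 h2
      exact (S.continuousAt_g j (h2.posDef t ht).posSemidef).comp_continuousWithinAt
        (f := fun u => P u ω) h1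
  refine ⟨⟨C, hCν⟩, hX, hγ, fun t ht => ?_⟩
  have hdrift : Integrable (fun z : ℝ × Ω => S.A * P z.1 z.2 + P z.1 z.2 * S.Aᵀ + S.Q)
      ((volume.restrict (Icc 0 T)).prod ν) := by
    refine integrable_prod_of_norm_le (D := fun t ω => S.A * P t ω + P t ω * S.Aᵀ + S.Q)
      (a := fun _ => 1) (β := fun _ => 2 * ‖S.A‖ * C + ‖S.Q‖) ?_ (integrable_const _)
      (integrable_const _) ?_
    · exact (by fun_prop : Continuous fun Z : Matrix (Fin n) (Fin n) ℝ => S.A * Z + Z * S.Aᵀ + S.Q)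
        |>.comp_aestronglyMeasurable (hP.aestronglyMeasurable_prod hT hac)
    · filter_upwards [hCν] with ω h t ht
      rw [one_mul]
      exact (norm_drift_le _ _ _).trans (by gcongr; exact h t ht)
  have h0 : (0 : ℝ) ∈ Icc 0 T := ⟨le_rfl, hT⟩
  have hDI := integrable_intervalIntegral (D := fun t ω => S.A * P t ω + P t ω * S.Aᵀ + S.Q)
    hdrift le_rfl ht.1 ht.2
  -- The total reduction up to time `t`, expressed through the other terms of the equation so that
  -- its integrability is immediate; its mean is then computed entrywise.
  set Sg : Ω → Matrix (Fin n) (Fin n) ℝ := fun ω =>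
    P 0 ω + (∫ u in (0 : ℝ)..t, (S.A * P u ω + P u ω * S.Aᵀ + S.Q)) - P t ω with hSg
  have hSgI : Integrable Sg ν := ((hI 0 h0).add hDI).sub (hI t ht)
  have hγi : ∀ j, IntervalIntegrable (fun u => lam j u • ∫ ω, S.g j (P u ω) ∂ν) volume 0 t :=
    fun j => intervalIntegrable_mono (hlam.intervalIntegrable_smul hT j (hγ j)) le_rfl ht.1 ht.2
  have hkey : ∫ ω, Sg ω ∂ν = ∫ u in (0 : ℝ)..t, ∑ j, lam j u • ∫ ω, S.g j (P u ω) ∂ν := by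
    ext i k
    have e1 := (entryL i k).integral_comp_comm hSgI
    have e2 := (entryL i k).intervalIntegral_comp_comm
      (intervalIntegrable_finset_sum (s := Finset.univ) fun j _ => hγi j)
    simp only [entryL_apply] at e1 e2
    rw [← e1, ← e2]
    have hcomp : ∀ j, Integrable (fun ω => cInt (fun u => N j u ω) (fun u => B.indicator
          (fun ω => S.g j (Function.leftLim (fun r => P r ω) u) i k) ω) t) μ ∧
        ∫ ω, cInt (fun u => N j u ω) (fun u => B.indicator
          (fun ω => S.g j (Function.leftLim (fun r => P r ω) u) i k) ω) t ∂μ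
        = ∫ u in (0 : ℝ)..t, (∫ ω, B.indicator (fun ω => S.g j (P u ω) i k) ω ∂μ) * lam j u := by
      intro j
      -- The indicator of `B` makes the integrand bounded, and it stays adapted because `B` belongs
      -- to the initial σ-algebra.
      refine hN.integral_cInt hlam j (C := C) ?_ ?_ ?_ ?_ ht
      · intro u hu
        exact (((entryL i k).continuous.comp_stronglyMeasurable
          (S.stronglyMeasurable_g j (hP.adapted u hu))).measurable).indicator (ℱ.mono hu.1 _ hB)
      · filter_upwards [hgC] with ω h u hu
        by_cases hω : ω ∈ B
        · rw [indicator_of_mem hω]; exact (abs_entry_le _ _ _).trans (h hω j u hu)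
        · rw [indicator_of_notMem hω, abs_zero]; exact hC0
      · filter_upwards [hpath] with ω h u hu
        by_cases hω : ω ∈ B
        · simp only [indicator_of_mem hω]
          exact ((entryL i k).continuous.tendsto _).comp
            ((S.continuousAt_g j (h.leftLim_posSemidef hu)).tendsto.comp (h.tendsto_leftLim hu))
        · simp only [indicator_of_notMem hω]; exact tendsto_const_nhds
      · intro u hu
        filter_upwards [hP.ae_leftLim_eq hT hlam hN hu] with ω h
        simp only [indicator, h]
    have hSgi : ∀ᵐ ω ∂μ, B.indicator (fun ω => Sg ω i k) ω = ∑ j, cInt (fun u => N j u ω)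
        (fun u => B.indicator
          (fun ω => S.g j (Function.leftLim (fun r => P r ω) u) i k) ω) t := by
      filter_upwards [hpath] with ω h
      by_cases hω : ω ∈ B
      · simp only [indicator_of_mem hω]
        have h1 : Sg ω = ∑ j, cInt (fun u => N j u ω)
            (fun s => S.g j (Function.leftLim (fun r => P r ω) s)) t := by
          rw [hSg]
          have := h.eq_integral hT ht
          simp only [this]
          abel
        rw [h1, Matrix.sum_apply]
        exact Finset.sum_congr rfl fun j _ => (h.counting j).cInt_apply _ ht.2 i k
      · simp [indicator_of_notMem hω, cInt]
    rw [← integral_indicator hB', integral_congr_ae hSgi,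
      integral_finsetSum _ fun j _ => (hcomp j).1]
    have e3 : ∀ u, (∑ j, lam j u • ∫ ω, S.g j (P u ω) ∂ν) i k
        = ∑ j, lam j u * (∫ ω, S.g j (P u ω) ∂ν) i k := fun u => by
      rw [Matrix.sum_apply]; rfl
    simp only [e3]
    have e4 : ∀ j, IntervalIntegrable (fun u => lam j u * (∫ ω, S.g j (P u ω) ∂ν) i k) volume 0 t :=
      fun j => ⟨(entryL i k).integrable_comp (hγi j).1, (entryL i k).integrable_comp (hγi j).2⟩
    rw [intervalIntegral.integral_finsetSum fun j _ => e4 j]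
    refine Finset.sum_congr rfl fun j _ => ?_
    rw [(hcomp j).2]
    refine intervalIntegral.integral_congr fun u hu => ?_
    rw [uIcc_of_le ht.1] at hu
    have e5 := (entryL i k).integral_comp_comm (hgI j u ⟨hu.1, hu.2.trans ht.2⟩)
    simp only [entryL_apply] at e5
    rw [← e5, integral_indicator hB', mul_comm]
  have hXi : IntervalIntegrable (fun u => S.A * (∫ ω, P u ω ∂ν) + (∫ ω, P u ω ∂ν) * S.Aᵀ
      + μ.real B • S.Q) volume 0 t :=
    intervalIntegrable_mono (ContinuousOn.intervalIntegrable_Icc hT (by fun_prop)) le_rfl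
      ht.1 ht.2
  rw [intervalIntegral.integral_sub hXi (intervalIntegrable_finset_sum fun j _ => hγi j), ← hkey]
  have e5 : ∫ ω, Sg ω ∂ν = (∫ ω, P 0 ω ∂ν) + (∫ u in (0 : ℝ)..t, (S.A * (∫ ω, P u ω ∂ν)
      + (∫ ω, P u ω ∂ν) * S.Aᵀ + μ.real B • S.Q)) - ∫ ω, P t ω ∂ν := by
    have h1 : Integrable (fun ω => P 0 ω
        + ∫ u in (0 : ℝ)..t, (S.A * P u ω + P u ω * S.Aᵀ + S.Q)) ν := (hI 0 h0).add hDI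
    rw [integral_sub h1 (hI t ht), integral_add (hI 0 h0) hDI,
      integral_intervalIntegral (D := fun t ω => S.A * P t ω + P t ω * S.Aᵀ + S.Q)
        hdrift le_rfl ht.1 ht.2]
    congr 2
    refine intervalIntegral.integral_congr fun u hu => ?_
    rw [uIcc_of_le ht.1] at hu
    have hu' : u ∈ Icc 0 T := ⟨hu.1, hu.2.trans ht.2⟩
    have e6 := (lyapL S.Aᵀ).integral_comp_comm (hI u hu')
    simp only [lyapL_apply, Matrix.transpose_transpose] at e6
    have e7 : ∀ X : Matrix (Fin n) (Fin n) ℝ, S.A * X + X * S.Aᵀ = X * S.Aᵀ + S.A * X :=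
      fun X => add_comm _ _
    simp only [e7]
    have e8 : Integrable (fun ω => P u ω * S.Aᵀ + S.A * P u ω) ν := by
      simpa only [lyapL_apply, Matrix.transpose_transpose] using
        (lyapL S.Aᵀ).integrable_comp (hI u hu')
    rw [integral_add e8 (integrable_const _), e6,
      integral_const, hν, measureReal_restrict_apply_univ]
  rw [e5]
  abel

end Processes

end CDKF

namespace CDKF

/-! ### Local Jensen bounds for the means of the covariance and the information. -/

section MeanBounds

open scoped Matrix.Norms.L2Operator

variable {n M : ℕ} {S : Model n M} {T : ℝ} {lam : Fin M → ℝ → ℝ} {Ω : Type*}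
  {mΩ : MeasurableSpace Ω} {μ : Measure Ω} {ℱ : Filtration ℝ mΩ} {N : Fin M → ℝ → Ω → ℕ}
  {P : ℝ → Ω → Matrix (Fin n) (Fin n) ℝ}

theorem norm_le_add_of_norm_sub_le {E : Type*} [NormedAddCommGroup E] {x p : E} {r : ℝ}
    (h : ‖x - p‖ ≤ r) : ‖x‖ ≤ ‖p‖ + r := by
  have := norm_add_le p (x - p)
  rw [add_sub_cancel] at this
  linarith

/-- Controls the initial mismatch in the comparison: freezing `P 0` at `p` costs only `r` times the
mass of the event. -/
theorem lamPos_setIntegral_sub_le [IsFiniteMeasure μ] {X : Ω → Matrix (Fin n) (Fin n) ℝ}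
    {B : Set Ω} (hX : IntegrableOn X B μ) {p : Matrix (Fin n) (Fin n) ℝ}
    {r : ℝ} (hr : ∀ ω ∈ B, ‖X ω - p‖ ≤ r) :
    lamPos ((∫ ω in B, X ω ∂μ) - μ.real B • p) ≤ r * μ.real B := by
  have e : (∫ ω in B, X ω ∂μ) - μ.real B • p = ∫ ω in B, (X ω - p) ∂μ := by
    rw [integral_sub hX (integrable_const _), setIntegral_const]
  rw [e]
  exact (lamPos_le_norm _).trans
    (norm_setIntegral_le_of_norm_le_const (measure_lt_top _ _) hr)

/-- Local upper bound of the mean covariance by the covariance-form surrogate. -/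
theorem IsCovSurrogate.exists_setIntegral_le [IsProbabilityMeasure μ] (hT : 0 ≤ T)
    (hlam : IsAdmissible T lam) (hN : IsPoissonFamily μ ℱ T lam N)
    (hP : IsCovarianceProcess μ ℱ T S N P) {p : Matrix (Fin n) (Fin n) ℝ}
    {Z : ℝ → Matrix (Fin n) (Fin n) ℝ} (hZ : IsCovSurrogate T S lam p Z) :
    ∃ C : ℝ, 0 ≤ C ∧ ∀ (B : Set Ω) (r : ℝ), 0 ≤ r → MeasurableSet[ℱ 0] B →
      (∀ ω ∈ B, ‖P 0 ω - p‖ ≤ r) → ∀ t ∈ Icc 0 T, ∀ v,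
      qf (∫ ω in B, P t ω ∂μ) v ≤ μ.real B * qf (Z t) v + C * (r * μ.real B) * vnorm v ^ 2 := by
  obtain ⟨C, hC0, hC⟩ := hZ.exists_upper_bound hT hlam
  refine ⟨C, hC0, fun B r hr hB hBr t ht v => ?_⟩
  have hB' : MeasurableSet B := ℱ.le 0 _ hB
  have hac : μ.restrict B ≪ μ := Measure.absolutelyContinuous_of_le Measure.restrict_le_self
  obtain ⟨⟨c, hc⟩, hX, hγ, heq⟩ := hP.setIntegral_eq hT hlam hN hB
    fun ω hω => norm_le_add_of_norm_sub_le (hBr ω hω)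
  have hI : ∀ t ∈ Icc 0 T, IntegrableOn (P t) B μ := fun t ht =>
    (integrable_const c).mono' (hP.stronglyMeasurable ht).aestronglyMeasurable
      (by filter_upwards [hc] with ω h using h t ht)
  have hpd := hac.ae_le hP.posDef
  have hgI : ∀ j, ∀ t ∈ Icc 0 T, IntegrableOn (fun ω => S.g j (P t ω)) B μ := fun j t ht =>
    (integrable_const c).mono'
      (S.stronglyMeasurable_g j (hP.stronglyMeasurable ht)).aestronglyMeasurable
      (by filter_upwards [hc, hpd] with ω h h'
            using (S.norm_g_le j (h' t ht).posSemidef).trans (h t ht))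
  have h0 : (0 : ℝ) ∈ Icc 0 T := ⟨le_rfl, hT⟩
  refine (hC (μ.real B) measureReal_nonneg (fun t => ∫ ω in B, P t ω ∂μ)
    (fun j t => ∫ ω in B, S.g j (P t ω) ∂μ) hX (fun t ht => isSymm_integral ?_) hγ heq ?_ t ht
    v).trans ?_
  · filter_upwards [hpd] with ω h using (h t ht).posSemidef.isSymm
  · intro j u hu K v
    have hq : ∀ w, Integrable (fun ω => qf (P u ω) w) (μ.restrict B) := fun w =>
      (qfL w).integrable_comp (hI u hu)
    have hq2 : Integrable (fun ω => qf (P u ω) v - qf (P u ω) ((1 - K * S.H j)ᵀ *ᵥ v))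
        (μ.restrict B) := (hq _).sub (hq _)
    -- Jensen's inequality for `g_j`: integrate its affine minorant for the fixed gain `K`. The
    -- constant part acquires the mass of `B`, which is the parameter `b` of the comparison.
    have h1 : qf (∫ ω in B, P u ω ∂μ) v - qf (∫ ω in B, P u ω ∂μ) ((1 - K * S.H j)ᵀ *ᵥ v)
        - μ.real B * qf (K * S.R j * Kᵀ) v ≤ qf (∫ ω in B, S.g j (P u ω) ∂μ) v := by
      rw [← qf_integral_measure (hI u hu), ← qf_integral_measure (hI u hu),
        ← qf_integral_measure (hgI j u hu), ← smul_eq_mul, ← setIntegral_const,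
        ← integral_sub (hq _) (hq _), ← integral_sub hq2 (integrable_const _)]
      refine integral_mono_ae (hq2.sub (integrable_const _))
        ((qfL v).integrable_comp (hgI j u hu)) ?_
      filter_upwards [hpd] with ω h
      have := S.le_qf_g j (h u hu).posSemidef K v
      rwa [qf_sub, qf_sub, qf_conj] at this
    rwa [qf_sub, qf_sub, qf_smul, qf_conj]
  · gcongr
    exact lamPos_setIntegral_sub_le (hI 0 h0) hBr

/-- The information drift, bounded along a reference trajectory. -/
theorem qf_info_drift_le (S : Model n M) {Y Z : Matrix (Fin n) (Fin n) ℝ} (hY : Y.IsSymm)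
    (hZ : Z.IsSymm) (v : Fin n → ℝ) :
    qf (-(Y * S.A) - S.Aᵀ * Y - Y * S.Q * Y) v
      ≤ qf (Z * S.Q * Z - lyapL (S.A + S.Q * Z) Y) v := by
  have h := qf_tangent_le_quadratic S.Q_posSemidef hY hZ v
  have e : Z * S.Q * Z - lyapL (S.A + S.Q * Z) Y
      = -(Y * S.A) - S.Aᵀ * Y - (Y * S.Q * Z + Z * S.Q * Y - Z * S.Q * Z) := by
    rw [lyapL_apply, Matrix.transpose_add, Matrix.transpose_mul, hZ.eq,
      S.Q_posSemidef.isSymm.eq]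
    noncomm_ring
  rw [e, qf_sub, qf_sub _ (Y * S.Q * Z + Z * S.Q * Y - Z * S.Q * Z)]
  linarith

theorem norm_info_drift_le (A Q Z Y : Matrix (Fin n) (Fin n) ℝ) {κ β : ℝ} (hZ : ‖Z‖ ≤ κ)
    (hY : ‖Y‖ ≤ β) :
    ‖Z * Q * Z - lyapL (A + Q * Z) Y‖ ≤ (κ * ‖Q‖ * κ + 2 * (‖A‖ + ‖Q‖ * κ)) * (1 + β) := by
  have hκ : 0 ≤ κ := (norm_nonneg _).trans hZ
  have hβ : 0 ≤ β := (norm_nonneg _).trans hY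
  have hG : ‖A + Q * Z‖ ≤ ‖A‖ + ‖Q‖ * κ :=
    (norm_add_le _ _).trans (by gcongr; exact (norm_mul_le _ _).trans (by gcongr))
  have h1 : ‖Z * Q * Z‖ ≤ κ * ‖Q‖ * κ :=
    (norm_mul_le _ _).trans (by gcongr; exact (norm_mul_le _ _).trans (by gcongr))
  have h2 : ‖lyapL (A + Q * Z) Y‖ ≤ 2 * (‖A‖ + ‖Q‖ * κ) * β := by
    rw [lyapL_apply]
    have a1 := (norm_mul_le Y (A + Q * Z)).trans
      (mul_le_mul hY hG (norm_nonneg _) hβ)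
    have a2 := norm_mul_le (A + Q * Z)ᵀ Y
    rw [norm_transpose_eq] at a2
    have a3 := a2.trans (mul_le_mul hG hY (norm_nonneg _) (by positivity))
    have a4 := norm_add_le (Y * (A + Q * Z)) ((A + Q * Z)ᵀ * Y)
    linarith
  have h3 : 0 ≤ κ * ‖Q‖ * κ * β := by positivity
  have h4 : 0 ≤ 2 * (‖A‖ + ‖Q‖ * κ) := by positivity
  have h5 := norm_sub_le (Z * Q * Z) (lyapL (A + Q * Z) Y)
  nlinarith

/-- Only the drift linearised along `Z` is averaged: it grows linearly in `Y`, so first moments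
suffice, whereas `Y Q Y` would require second moments. -/
theorem integrable_info_drift {ν : Measure Ω} [IsFiniteMeasure ν] (A Q : Matrix (Fin n) (Fin n) ℝ)
    {Z : ℝ → Matrix (Fin n) (Fin n) ℝ} (hZ : ContinuousOn Z (Icc 0 T))
    {Y : ℝ → Ω → Matrix (Fin n) (Fin n) ℝ}
    (hY : AEStronglyMeasurable (fun z : ℝ × Ω => Y z.1 z.2) ((volume.restrict (Icc 0 T)).prod ν))
    {β : Ω → ℝ} (hβ : Integrable β ν) (hb : ∀ᵐ ω ∂ν, ∀ t ∈ Icc 0 T, ‖Y t ω‖ ≤ β ω) :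
    Integrable (fun z : ℝ × Ω => Z z.1 * Q * Z z.1 - lyapL (A + Q * Z z.1) (Y z.1 z.2))
      ((volume.restrict (Icc 0 T)).prod ν) := by
  obtain ⟨κ, -, hκ⟩ := exists_norm_bound hZ
  have hZm : AEStronglyMeasurable (fun z : ℝ × Ω => Z z.1) ((volume.restrict (Icc 0 T)).prod ν) :=
    (hZ.aestronglyMeasurable measurableSet_Icc).comp_fst
  refine integrable_prod_of_norm_le (D := fun u ω => Z u * Q * Z u - lyapL (A + Q * Z u) (Y u ω))
    (a := fun _ => κ * ‖Q‖ * κ + 2 * (‖A‖ + ‖Q‖ * κ)) (β := fun ω => 1 + β ω)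
    ?_ (integrable_const _) ((integrable_const _).add hβ) ?_
  · have hG : AEStronglyMeasurable (fun z : ℝ × Ω => A + Q * Z z.1)
        ((volume.restrict (Icc 0 T)).prod ν) :=
      aestronglyMeasurable_const.add (aestronglyMeasurable_const.mul hZm)
    have hGt : AEStronglyMeasurable (fun z : ℝ × Ω => (A + Q * Z z.1)ᵀ)
        ((volume.restrict (Icc 0 T)).prod ν) :=
      continuous_id.matrix_transpose.comp_aestronglyMeasurable hG
    simp only [lyapL_apply]
    exact ((hZm.mul aestronglyMeasurable_const).mul hZm).sub ((hY.mul hG).add (hGt.mul hY))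
  · filter_upwards [hb] with ω h u hu using norm_info_drift_le _ _ _ _ (hκ u hu) (h u hu)

/-- Pathwise information inequality along a reference trajectory. -/
theorem IsCovPath.qf_inv_le {N : Fin M → ℝ → ℕ} {P Z : ℝ → Matrix (Fin n) (Fin n) ℝ}
    (hT : 0 ≤ T) (h : IsCovPath T S N P) (hN : NoDoubleJump T N)
    (hZc : ContinuousOn Z (Icc 0 T)) (hZ : ∀ t ∈ Icc 0 T, (Z t).IsSymm) {s t : ℝ} (hs : 0 ≤ s)
    (hst : s ≤ t) (ht : t ≤ T) (v : Fin n → ℝ) :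
    qf (P t)⁻¹ v ≤ qf (P s)⁻¹ v
      + (∫ u in s..t, qf (Z u * S.Q * Z u - lyapL (S.A + S.Q * Z u) (P u)⁻¹) v)
      + ∑ j, ((N j t : ℝ) - N j s) * qf (S.infoGain j) v := by
  have htm : t ∈ Icc 0 T := ⟨hs.trans hst, ht⟩
  have hsm : s ∈ Icc 0 T := ⟨hs, hst.trans ht⟩
  have hI := (h.cadlag_inv_drift hT).intervalIntegrable hT
  have hIs := intervalIntegrable_mono hI le_rfl hs (hst.trans ht)
  have hIst := intervalIntegrable_mono hI hs hst ht
  have e : (P t)⁻¹ = (P s)⁻¹ + (∫ u in s..t,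
      (-((P u)⁻¹ * S.A) - S.Aᵀ * (P u)⁻¹ - (P u)⁻¹ * S.Q * (P u)⁻¹))
      + ∑ j, ((N j t : ℝ) - N j s) • S.infoGain j := by
    have e1 := h.inv_eq hT hN htm
    have e2 := h.inv_eq hT hN hsm
    rw [← intervalIntegral.integral_add_adjacent_intervals hIs hIst] at e1
    have e3 : ∑ j, ((N j t : ℝ) - N j 0) • S.infoGain j
        = ∑ j, ((N j s : ℝ) - N j 0) • S.infoGain j + ∑ j, ((N j t : ℝ) - N j s) • S.infoGain j := by
      rw [← Finset.sum_add_distrib]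
      refine Finset.sum_congr rfl fun j _ => ?_
      rw [← add_smul]; congr 1; ring
    rw [e1, e2, e3]
    abel
  rw [e, qf_add, qf_add, qf_integral hIst, qf_sum]
  simp only [qf_smul]
  refine add_le_add (add_le_add le_rfl ?_) le_rfl
  have hL : IntervalIntegrable (fun u => Z u * S.Q * Z u - lyapL (S.A + S.Q * Z u) (P u)⁻¹)
      volume 0 T := by
    have hY := (h.cadlag_inv hT).intervalIntegrable hT
    have h1 : IntervalIntegrable (fun u => (P u)⁻¹ * (S.A + S.Q * Z u)) volume 0 T :=
      hY.mul_continuousOn (by rw [uIcc_of_le hT]; fun_prop)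
    have h2 : IntervalIntegrable (fun u => (S.A + S.Q * Z u)ᵀ * (P u)⁻¹) volume 0 T :=
      hY.continuousOn_mul (by rw [uIcc_of_le hT]; fun_prop)
    have h3 : IntervalIntegrable (fun u => Z u * S.Q * Z u) volume 0 T :=
      ContinuousOn.intervalIntegrable_Icc hT (by fun_prop)
    exact h3.sub (h1.add h2)
  refine intervalIntegral.integral_mono_on hst (hIst.qf v)
    ((intervalIntegrable_mono hL hs hst ht).qf v) fun u hu => ?_
  have hu' : u ∈ Icc 0 T := ⟨hs.trans hu.1, hu.2.trans ht⟩
  exact qf_info_drift_le S (h.posDef u hu').inv.posSemidef.isSymm (hZ u hu') v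

/-- Local upper bound of the mean information by the information-form surrogate. -/
theorem IsInfoSurrogate.exists_setIntegral_inv_le [IsProbabilityMeasure μ] (hT : 0 ≤ T)
    (hlam : IsAdmissible T lam) (hN : IsPoissonFamily μ ℱ T lam N)
    (hP : IsCovarianceProcess μ ℱ T S N P) {y : Matrix (Fin n) (Fin n) ℝ}
    {Z : ℝ → Matrix (Fin n) (Fin n) ℝ} (hZ : IsInfoSurrogate T S lam y Z) :
    ∃ C : ℝ, 0 ≤ C ∧ ∀ (B : Set Ω) (r : ℝ), 0 ≤ r → MeasurableSet[ℱ 0] B →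
      (∀ ω ∈ B, ‖(P 0 ω)⁻¹ - y‖ ≤ r) →
      (∀ t ∈ Icc 0 T, IntegrableOn (fun ω => (P t ω)⁻¹) B μ) ∧ ∀ t ∈ Icc 0 T, ∀ v,
      qf (∫ ω in B, (P t ω)⁻¹ ∂μ) v ≤ μ.real B * qf (Z t) v + C * (r * μ.real B) * vnorm v ^ 2 := by
  obtain ⟨C, hC0, hC⟩ := hZ.exists_upper_bound hT hlam
  refine ⟨C, hC0, fun B r hr hB hBr => ?_⟩
  have hB' : MeasurableSet B := ℱ.le 0 _ hB
  set ν := μ.restrict B with hν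
  have hac : ν ≪ μ := Measure.absolutelyContinuous_of_le Measure.restrict_le_self
  have h0 : (0 : ℝ) ∈ Icc 0 T := ⟨le_rfl, hT⟩
  have hpath := hP.ae_isCovPath hN
  have hnd := hN.ae_noDoubleJump hlam
  -- The information is unbounded even on `B`, because counts are; the final counts give an
  -- integrable dominating function.
  set β : Ω → ℝ := fun ω => (‖y‖ + r + ∑ j, ((N j T ω : ℝ) - N j 0 ω) * ‖S.infoGain j‖)
    * Real.exp (2 * ‖S.A‖ * T) with hβ
  have hβI : Integrable β ν := by
    refine ((integrable_const _).add (integrable_finsetSum _ fun j _ => ?_)).mul_const _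
    exact ((hN.integrable_sub j le_rfl hT le_rfl).mul_const _).restrict
  have hb : ∀ᵐ ω ∂ν, ∀ t ∈ Icc 0 T, ‖(P t ω)⁻¹‖ ≤ β ω := by
    rw [hν, ae_restrict_iff' hB']
    filter_upwards [hpath, hnd, hN.ae_counting] with ω h1 h2 h3 hω t ht
    refine (h1.norm_inv_le hT h2 ht).trans ?_
    have h4 : 0 ≤ ∑ j, ((N j T ω : ℝ) - N j 0 ω) * ‖S.infoGain j‖ :=
      Finset.sum_nonneg fun j _ => mul_nonneg (sub_nonneg.2 (Nat.cast_le.2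
        ((h3 j).1.mono h0 ⟨hT, le_rfl⟩ hT))) (norm_nonneg _)
    have h5 := norm_le_add_of_norm_sub_le (hBr ω hω)
    have h6 := ht.2
    have h7 : 0 ≤ ‖y‖ + r + ∑ j, ((N j T ω : ℝ) - N j 0 ω) * ‖S.infoGain j‖ := by positivity
    simp only [hβ]
    gcongr
  have hm : ∀ t ∈ Icc 0 T, StronglyMeasurable (fun ω => (P t ω)⁻¹) := fun t ht =>
    stronglyMeasurable_matrix_inv (hP.stronglyMeasurable ht)
  have hI : ∀ t ∈ Icc 0 T, Integrable (fun ω => (P t ω)⁻¹) ν := fun t ht =>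
    hβI.mono' (hm t ht).aestronglyMeasurable (by filter_upwards [hb] with ω h using h t ht)
  refine ⟨hI, fun t ht v => ?_⟩
  have hX : ContinuousOn (fun t => ∫ ω, (P t ω)⁻¹ ∂ν) (Icc 0 T) :=
    continuousOn_integral (fun t ht => (hm t ht).aestronglyMeasurable) hβI hb fun t ht => by
      refine hac.ae_le ?_
      filter_upwards [hP.ae_continuousWithinAt hT hlam hN ht, hpath] with ω h1 h2
      exact (continuousAt_matrix_inv (h2.posDef t ht).isUnit).comp_continuousWithinAt
        (f := fun u => P u ω) h1
  have hpd := hac.ae_le hP.posDef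
  refine (hC (μ.real B) measureReal_nonneg (fun t => ∫ ω, (P t ω)⁻¹ ∂ν) hX
    (fun t ht => isSymm_integral ?_) ?_ t ht v).trans ?_
  · filter_upwards [hpd] with ω h using (h t ht).inv.posSemidef.isSymm
  · intro s t hs hst ht v
    have hD := integrable_info_drift S.A S.Q hZ.continuousOn
      (hP.aestronglyMeasurable_prod_inv (ν := ν) hT hN hac) hβI hb
    have hDq : Integrable (fun z : ℝ × Ω =>
        qf (Z z.1 * S.Q * Z z.1 - lyapL (S.A + S.Q * Z z.1) (P z.1 z.2)⁻¹) v)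
        ((volume.restrict (Icc 0 T)).prod ν) := (qfL v).integrable_comp hD
    have htm : t ∈ Icc 0 T := ⟨hs.trans hst, ht⟩
    have hsm : s ∈ Icc 0 T := ⟨hs, hst.trans ht⟩
    have hDI := integrable_intervalIntegral
      (D := fun u ω => qf (Z u * S.Q * Z u - lyapL (S.A + S.Q * Z u) (P u ω)⁻¹) v) hDq hs hst ht
    have hNI : ∀ j, Integrable (fun ω => ((N j t ω : ℝ) - N j s ω) * qf (S.infoGain j) v) ν :=
      fun j => ((hN.integrable_sub j hs hst ht).mul_const _).restrict
    have hqt : Integrable (fun ω => qf (P t ω)⁻¹ v) ν := (qfL v).integrable_comp (hI t htm)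
    have hqs : Integrable (fun ω => qf (P s ω)⁻¹ v) ν := (qfL v).integrable_comp (hI s hsm)
    have h1 : ∫ ω, qf (P t ω)⁻¹ v ∂ν ≤ ∫ ω, (qf (P s ω)⁻¹ v
        + (∫ u in s..t, qf (Z u * S.Q * Z u - lyapL (S.A + S.Q * Z u) (P u ω)⁻¹) v)
        + ∑ j, ((N j t ω : ℝ) - N j s ω) * qf (S.infoGain j) v) ∂ν := by
      refine integral_mono_ae hqt ((hqs.add hDI).add (integrable_finsetSum _ fun j _ => hNI j)) ?_
      refine hac.ae_le ?_
      filter_upwards [hpath, hnd] with ω h1 h2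
      exact h1.qf_inv_le hT h2 hZ.continuousOn hZ.symm hs hst ht v
    have h2 : ∀ j, ∫ ω, ((N j t ω : ℝ) - N j s ω) * qf (S.infoGain j) v ∂ν
        = ∫ u in s..t, μ.real B * (lam j u * qf (S.infoGain j) v) := fun j => by
      -- Increments after `s` are independent of the initial event, so the jumps average to the rate
      -- times the mass of `B`.
      have e1 := hN.integral_mul_sub hlam j hs hst ht (Z := B.indicator fun _ => 1)
        (measurable_const.indicator (ℱ.mono hs _ hB))
      have e2 : ∀ ω, B.indicator (fun _ => (1 : ℝ)) ω * ((N j t ω : ℝ) - N j s ω)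
          = B.indicator (fun ω => (N j t ω : ℝ) - N j s ω) ω := fun ω => by
        by_cases hω : ω ∈ B <;> simp [hω]
      simp only [e2] at e1
      rw [integral_indicator hB', integral_indicator hB', setIntegral_const, smul_eq_mul,
        mul_one] at e1
      rw [integral_mul_const, e1, intervalIntegral.integral_const_mul,
        intervalIntegral.integral_mul_const, mul_assoc]
    have hli : ∀ j, IntervalIntegrable (fun u => μ.real B * (lam j u * qf (S.infoGain j) v))
        volume s t := fun j =>
      ((intervalIntegrable_mono (hlam.intervalIntegrable hT j) hs hst ht).mul_const _).const_mul _
    have hqD : Integrable (fun ω => qf (P s ω)⁻¹ v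
        + ∫ u in s..t, qf (Z u * S.Q * Z u - lyapL (S.A + S.Q * Z u) (P u ω)⁻¹) v) ν := hqs.add hDI
    rw [integral_add hqD (integrable_finsetSum _ fun j _ => hNI j),
      integral_add hqs hDI, integral_finsetSum _ fun j _ => hNI j,
      Finset.sum_congr rfl fun j _ => h2 j,
      ← intervalIntegral.integral_finsetSum fun j _ => hli j,
      integral_intervalIntegral
        (D := fun u ω => qf (Z u * S.Q * Z u - lyapL (S.A + S.Q * Z u) (P u ω)⁻¹) v) hDq hs hst ht,
      qf_integral_measure (hI t htm), qf_integral_measure (hI s hsm), add_assoc,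
      ← intervalIntegral.integral_add (intervalIntegrable_integral
        (D := fun u ω => qf (Z u * S.Q * Z u - lyapL (S.A + S.Q * Z u) (P u ω)⁻¹) v) hDq hs hst ht)
        (intervalIntegrable_finset_sum fun j _ => hli j)] at h1
    refine h1.trans (le_of_eq ?_)
    congr 1
    refine intervalIntegral.integral_congr fun u hu => ?_
    rw [uIcc_of_le hst] at hu
    have hu' : u ∈ Icc 0 T := ⟨hs.trans hu.1, hu.2.trans ht⟩
    have e3 := (lyapL (S.A + S.Q * Z u)).integral_comp_comm (hI u hu')
    have e4 := (lyapL (S.A + S.Q * Z u)).integrable_comp (hI u hu')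
    have e5 : ∫ ω, qf (Z u * S.Q * Z u - lyapL (S.A + S.Q * Z u) (P u ω)⁻¹) v ∂ν
        = qf (μ.real B • (Z u * S.Q * Z u)
          - lyapL (S.A + S.Q * Z u) (∫ ω, (P u ω)⁻¹ ∂ν)) v := by
      have e6 : Integrable (fun ω => Z u * S.Q * Z u - lyapL (S.A + S.Q * Z u) (P u ω)⁻¹) ν :=
        (integrable_const _).sub e4
      rw [qf_integral_measure e6, integral_sub (integrable_const _) e4,
        e3, integral_const, hν, measureReal_restrict_apply_univ]
    rw [e5]
    simp only [lyapL_apply, qf_sub, qf_add, qf_neg, qf_smul, qf_sum, Finset.mul_sum]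
    ring
  · gcongr
    exact lamPos_setIntegral_sub_le (hI 0 h0) hBr

end MeanBounds

end CDKF

namespace CDKF

/-! ### Local two-sided bounds for the mean cost. -/

section CostBounds

open scoped Matrix.Norms.L2Operator

variable {n M : ℕ} {S : Model n M} {T : ℝ} {lam : Fin M → ℝ → ℝ} {Ω : Type*}
  {mΩ : MeasurableSpace Ω} {μ : Measure Ω} [IsProbabilityMeasure μ] {ℱ : Filtration ℝ mΩ}
  {N : Fin M → ℝ → Ω → ℕ} {P : ℝ → Ω → Matrix (Fin n) (Fin n) ℝ}
  {W : ℝ → Matrix (Fin n) (Fin n) ℝ} {WT : Matrix (Fin n) (Fin n) ℝ}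

theorem continuousOn_inv {Z : ℝ → Matrix (Fin n) (Fin n) ℝ} (hZ : ContinuousOn Z (Icc 0 T))
    (hpd : ∀ t ∈ Icc 0 T, (Z t).PosDef) : ContinuousOn (fun t => (Z t)⁻¹) (Icc 0 T) := fun t ht =>
  (continuousAt_matrix_inv (hpd t ht).isUnit).comp_continuousWithinAt (hZ t ht)

/-- Local lower bound of the mean covariance by the information-form surrogate. -/
theorem IsInfoSurrogate.exists_le_setIntegral (hT : 0 ≤ T)
    (hlam : IsAdmissible T lam) (hN : IsPoissonFamily μ ℱ T lam N)
    (hP : IsCovarianceProcess μ ℱ T S N P) {p : Matrix (Fin n) (Fin n) ℝ} (hp : p.PosDef)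
    {Z : ℝ → Matrix (Fin n) (Fin n) ℝ} (hZ : IsInfoSurrogate T S lam p⁻¹ Z) :
    ∃ C : ℝ, 0 ≤ C ∧ ∀ (B : Set Ω) (r : ℝ), 0 ≤ r → MeasurableSet[ℱ 0] B →
      (∀ ω ∈ B, ‖P 0 ω - p‖ ≤ r) → (∀ ω ∈ B, ‖(P 0 ω)⁻¹ - p⁻¹‖ ≤ r) → ∀ t ∈ Icc 0 T, ∀ v,
      μ.real B * qf (Z t)⁻¹ v ≤ qf (∫ ω in B, P t ω ∂μ) v + C * (r * μ.real B) * vnorm v ^ 2 := by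
  have hpd := hZ.posDef hT hlam hp.inv
  obtain ⟨C, hC0, hC⟩ := hZ.exists_setIntegral_inv_le hT hlam hN hP
  obtain ⟨κ, hκ0, hκ⟩ := exists_norm_bound (continuousOn_inv hZ.continuousOn hpd)
  refine ⟨C * κ ^ 2, by positivity, fun B r hr hB hBr hBi t ht v => ?_⟩
  have hac : μ.restrict B ≪ μ := Measure.absolutelyContinuous_of_le Measure.restrict_le_self
  obtain ⟨hYI, hY⟩ := hC B r hr hB hBi
  obtain ⟨⟨c, hc⟩, -⟩ := hP.setIntegral_eq hT hlam hN hB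
    fun ω hω => norm_le_add_of_norm_sub_le (hBr ω hω)
  have hI : IntegrableOn (P t) B μ :=
    (integrable_const c).mono' (hP.stronglyMeasurable ht).aestronglyMeasurable
      (by filter_upwards [hc] with ω h using h t ht)
  set V := (Z t)⁻¹
  have hVs : V.IsSymm := (hpd t ht).inv.posSemidef.isSymm
  have hZu : IsUnit (Z t).det := (Matrix.isUnit_iff_isUnit_det _).1 (hpd t ht).isUnit
  have hconj : ∀ X : Matrix (Fin n) (Fin n) ℝ, qf (V * X * V) v = qf X (V *ᵥ v) := fun X => by
    have := qf_conj V X v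
    rwa [hVs.eq] at this
  have hVZV : qf (Z t) (V *ᵥ v) = qf V v := by
    rw [← hconj, Matrix.nonsing_inv_mul _ hZu, Matrix.one_mul]
  -- Tangent inequality for inversion at `V = (Z t)⁻¹`, with `V` fixed under the integral. Since `V
  -- Z V = V`, the upper bound on the mean information turns `2 V - V (mean) V` into `μ(B) V` minus
  -- an error.
  have h1 : ∫ ω in B, (2 * qf V v - qf (P t ω)⁻¹ (V *ᵥ v)) ∂μ ≤ ∫ ω in B, qf (P t ω) v ∂μ := by
    refine integral_mono_ae ((integrable_const _).sub ((qfL _).integrable_comp (hYI t ht)))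
      ((qfL v).integrable_comp hI) ?_
    filter_upwards [hac.ae_le hP.posDef] with ω h
    have h2 := qf_tangent_le_inv (h t ht).inv hVs v
    rwa [qf_sub, qf_smul, hconj, Matrix.nonsing_inv_nonsing_inv _
      ((Matrix.isUnit_iff_isUnit_det _).1 (h t ht).isUnit)] at h2
  have hq : Integrable (fun ω => qf (P t ω)⁻¹ (V *ᵥ v)) (μ.restrict B) :=
    (qfL _).integrable_comp (hYI t ht)
  rw [integral_sub (integrable_const _) hq, setIntegral_const, smul_eq_mul,
    qf_integral_measure (hYI t ht), qf_integral_measure hI] at h1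
  have h2 := hY t ht (V *ᵥ v)
  rw [hVZV] at h2
  have h3 : vnorm (V *ᵥ v) ^ 2 ≤ κ ^ 2 * vnorm v ^ 2 := by
    rw [← mul_pow]
    exact pow_le_pow_left₀ (vnorm_nonneg _) ((vnorm_mulVec_le V v).trans
      (mul_le_mul_of_nonneg_right (hκ t ht) (vnorm_nonneg v))) 2
  have h4 : 0 ≤ C * (r * μ.real B) := by positivity
  have h5 := mul_le_mul_of_nonneg_left h3 h4
  nlinarith

theorem setLIntegral_ofReal_cost (hT : 0 ≤ T) (hW : IsWeight T W WT)
    (hP : IsCovarianceProcess μ ℱ T S N P) {B : Set Ω}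
    {C : ℝ} (hC : ∀ᵐ ω ∂(μ.restrict B), ∀ t ∈ Icc 0 T, ‖P t ω‖ ≤ C) :
    ∫⁻ ω in B, ENNReal.ofReal (cost T W WT fun t => P t ω) ∂μ
      = ENNReal.ofReal (cost T W WT fun t => ∫ ω in B, P t ω ∂μ) := by
  have hac : μ.restrict B ≪ μ := Measure.absolutelyContinuous_of_le Measure.restrict_le_self
  obtain ⟨h1, h2⟩ := hW.integral_cost hT (ν := μ.restrict B) (X := P) (β := fun _ => C)
    (hP.aestronglyMeasurable_prod hT hac)
    (fun t ht => (hP.stronglyMeasurable ht).aestronglyMeasurable) (integrable_const _) hC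
  rw [← h2, ofReal_integral_eq_lintegral_ofReal h1]
  filter_upwards [hac.ae_le hP.posDef] with ω h
  exact cost_nonneg hT hW fun t ht => (h t ht).posSemidef

/-- Local upper bound of the mean cost. -/
theorem IsCovSurrogate.exists_setLIntegral_cost_le (hT : 0 ≤ T) (hW : IsWeight T W WT)
    (hlam : IsAdmissible T lam) (hN : IsPoissonFamily μ ℱ T lam N)
    (hP : IsCovarianceProcess μ ℱ T S N P) {p : Matrix (Fin n) (Fin n) ℝ}
    {Z : ℝ → Matrix (Fin n) (Fin n) ℝ} (hZ : IsCovSurrogate T S lam p Z) :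
    ∃ C : ℝ, ∀ (B : Set Ω) (r : ℝ), 0 ≤ r → MeasurableSet[ℱ 0] B →
      (∀ ω ∈ B, ‖P 0 ω - p‖ ≤ r) →
      ∫⁻ ω in B, ENNReal.ofReal (cost T W WT fun t => P t ω) ∂μ
        ≤ ENNReal.ofReal (cost T W WT Z + C * r) * μ B := by
  obtain ⟨C, hC0, hC⟩ := hZ.exists_setIntegral_le hT hlam hN hP
  -- The matrix error is a multiple of the identity, so its cost is that multiple of the cost of the
  -- constant path `1`.
  refine ⟨C * cost T W WT fun _ => 1, fun B r hr hB hBr => ?_⟩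
  have hac : μ.restrict B ≪ μ := Measure.absolutelyContinuous_of_le Measure.restrict_le_self
  obtain ⟨⟨c, hc⟩, hX, -⟩ := hP.setIntegral_eq hT hlam hN hB
    fun ω hω => norm_le_add_of_norm_sub_le (hBr ω hω)
  have h1 : IntervalIntegrable (fun t => frob (W t) 1) volume 0 T :=
    hW.intervalIntegrable_frob_of_continuousOn hT (X := fun _ => 1) continuousOn_const
  have hZi := hW.intervalIntegrable_frob_of_continuousOn hT hZ.continuousOn
  rw [setLIntegral_ofReal_cost hT hW hP hc, ← ofReal_measureReal (measure_ne_top μ B),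
    ← ENNReal.ofReal_mul' measureReal_nonneg]
  refine ENNReal.ofReal_le_ofReal ?_
  have h2 : cost T W WT (fun t => ∫ ω in B, P t ω ∂μ)
      ≤ cost T W WT (fun t => μ.real B • Z t + (C * (r * μ.real B)) • 1) := by
    refine cost_le_cost hT hW (hW.intervalIntegrable_frob_of_continuousOn hT hX)
      (hW.intervalIntegrable_frob_of_continuousOn hT
        (by have := hZ.continuousOn; fun_prop)) (fun t ht => isSymm_integral ?_)
      (fun t ht => ((hZ.posSemidef t ht).isSymm.smul _).add (Matrix.isSymm_one.smul _))
      fun t ht v => ?_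
    · filter_upwards [hac.ae_le hP.posDef] with ω h using (h t ht).posSemidef.isSymm
    · rw [qf_add, qf_smul, qf_smul, qf_one]
      exact hC B r hr hB hBr t ht v
  refine h2.trans (le_of_eq ?_)
  rw [cost_smul_add_smul _ _ hZi h1]
  ring

/-- Local lower bound of the mean cost. -/
theorem IsInfoSurrogate.exists_le_setLIntegral_cost (hT : 0 ≤ T) (hW : IsWeight T W WT)
    (hlam : IsAdmissible T lam) (hN : IsPoissonFamily μ ℱ T lam N)
    (hP : IsCovarianceProcess μ ℱ T S N P) {p : Matrix (Fin n) (Fin n) ℝ} (hp : p.PosDef)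
    {Z : ℝ → Matrix (Fin n) (Fin n) ℝ} (hZ : IsInfoSurrogate T S lam p⁻¹ Z) :
    ∃ C : ℝ, ∀ (B : Set Ω) (r : ℝ), 0 ≤ r → MeasurableSet[ℱ 0] B →
      (∀ ω ∈ B, ‖P 0 ω - p‖ ≤ r) → (∀ ω ∈ B, ‖(P 0 ω)⁻¹ - p⁻¹‖ ≤ r) →
      ENNReal.ofReal (cost T W WT (fun t => (Z t)⁻¹) + C * r) * μ B
        ≤ ∫⁻ ω in B, ENNReal.ofReal (cost T W WT fun t => P t ω) ∂μ := by
  obtain ⟨C, hC0, hC⟩ := hZ.exists_le_setIntegral hT hlam hN hP hp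
  have hpd := hZ.posDef hT hlam hp.inv
  have hZc := continuousOn_inv hZ.continuousOn hpd
  refine ⟨-(C * cost T W WT fun _ => 1), fun B r hr hB hBr hBi => ?_⟩
  have hac : μ.restrict B ≪ μ := Measure.absolutelyContinuous_of_le Measure.restrict_le_self
  obtain ⟨⟨c, hc⟩, hX, -⟩ := hP.setIntegral_eq hT hlam hN hB
    fun ω hω => norm_le_add_of_norm_sub_le (hBr ω hω)
  have h1 : IntervalIntegrable (fun t => frob (W t) 1) volume 0 T :=
    hW.intervalIntegrable_frob_of_continuousOn hT (X := fun _ => 1) continuousOn_const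
  have hZi := hW.intervalIntegrable_frob_of_continuousOn hT hZc
  rw [setLIntegral_ofReal_cost hT hW hP hc, ← ofReal_measureReal (measure_ne_top μ B),
    ← ENNReal.ofReal_mul' measureReal_nonneg]
  refine ENNReal.ofReal_le_ofReal ?_
  have h2 : cost T W WT (fun t => μ.real B • (Z t)⁻¹ + (-(C * (r * μ.real B))) • 1)
      ≤ cost T W WT (fun t => ∫ ω in B, P t ω ∂μ) := by
    refine cost_le_cost hT hW (hW.intervalIntegrable_frob_of_continuousOn hT
        (by fun_prop))
      (hW.intervalIntegrable_frob_of_continuousOn hT hX)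
      (fun t ht => ((hpd t ht).inv.posSemidef.isSymm.smul _).add (Matrix.isSymm_one.smul _))
      (fun t ht => isSymm_integral ?_) fun t ht v => ?_
    · filter_upwards [hac.ae_le hP.posDef] with ω h using (h t ht).posSemidef.isSymm
    · rw [qf_add, qf_smul, qf_smul, qf_one]
      have := hC B r hr hB hBr hBi t ht v
      linarith
  refine le_trans (le_of_eq ?_) h2
  rw [cost_smul_add_smul _ _ hZi h1]
  ring

end CostBounds

end CDKF

namespace CDKF

/-! ### From local estimates to conditional expectations. -/

section ConditionalExpectation

variable {Ω E : Type*} {m mΩ : MeasurableSpace Ω} {μ : Measure Ω}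
  [PseudoMetricSpace E] [TopologicalSpace.SeparableSpace E] [MeasurableSpace E]
  [OpensMeasurableSpace E]

/-- A property which holds almost everywhere on small cells around almost every point, up to an
error proportional to the size of the cell, holds almost everywhere. -/
theorem ae_of_local {X : Ω → E} (hX : Measurable[m] X) {u : Ω → ℝ} {p : ℚ → Ω → Prop}
    (h : ∀ᵐ ω ∂μ, ∃ C : ℝ, ∀ (B : Set Ω) (r : ℝ), 0 ≤ r → MeasurableSet[m] B →
      (∀ ω' ∈ B, dist (X ω') (X ω) ≤ r) → ∀ q : ℚ, u ω + C * r < q → ∀ᵐ x ∂μ, x ∈ B → p q x) :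
    ∀ᵐ x ∂μ, ∀ q : ℚ, u x < q → p q x := by
  obtain ⟨s, hs, hd⟩ := TopologicalSpace.exists_countable_dense E
  set G : Ω → ℝ → Prop := fun ω C => ∀ (B : Set Ω) (r : ℝ), 0 ≤ r → MeasurableSet[m] B →
      (∀ ω' ∈ B, dist (X ω') (X ω) ≤ r) → ∀ q : ℚ, u ω + C * r < q → ∀ᵐ x ∂μ, x ∈ B → p q x
  -- Countably many balls and rational levels give one common null set. In each ball a single good
  -- centre `ω` suffices, so `u` and `C` need not be measurable. The radius `2 / (k + 1)` is the
  -- diameter bound of the ball.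
  have h1 : ∀ᵐ x ∂μ, ∀ k : ℕ, ∀ d ∈ s, ∀ q : ℚ,
      (∃ ω ∈ X ⁻¹' Metric.ball d (1 / ((k : ℝ) + 1)), ∃ C, G ω C ∧
        u ω + C * (2 * (1 / ((k : ℝ) + 1))) < q) →
      x ∈ X ⁻¹' Metric.ball d (1 / ((k : ℝ) + 1)) → p q x := by
    refine ae_all_iff.2 fun k => (ae_ball_iff hs).2 fun d _ => ae_all_iff.2 fun q => ?_
    by_cases hex : ∃ ω ∈ X ⁻¹' Metric.ball d (1 / ((k : ℝ) + 1)), ∃ C, G ω C ∧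
        u ω + C * (2 * (1 / ((k : ℝ) + 1))) < q
    · obtain ⟨ω, hω, C, hG, hq⟩ := hex
      have := hG (X ⁻¹' Metric.ball d (1 / ((k : ℝ) + 1))) (2 * (1 / ((k : ℝ) + 1)))
        (by positivity) (hX Metric.isOpen_ball.measurableSet) (fun ω' hω' => ?_) q hq
      · filter_upwards [this] with x hx _ using hx
      · have a1 := Metric.mem_ball.1 hω'
        have a2 := Metric.mem_ball'.1 hω
        linarith [dist_triangle (X ω') d (X ω)]
    · exact Eventually.of_forall fun x hx => absurd hx hex
  -- Almost every `x` is itself a good centre: for large `k` its error term fits below `q`, and `x`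
  -- serves as witness in a ball around a nearby dense point.
  filter_upwards [h1, h] with x hx ⟨C, hG⟩ q hq
  have h2 : Tendsto (fun k : ℕ => u x + C * (2 * (1 / ((k : ℝ) + 1)))) atTop
      (𝓝 (u x + C * (2 * 0))) :=
    tendsto_const_nhds.add ((tendsto_one_div_add_atTop_nhds_zero_nat.const_mul 2).const_mul _)
  rw [mul_zero, mul_zero, add_zero] at h2
  obtain ⟨k, hk⟩ := (h2.eventually (gt_mem_nhds hq)).exists
  obtain ⟨d, hds, hdx⟩ := hd.exists_dist_lt (X x) (show 0 < 1 / ((k : ℝ) + 1) by positivity)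
  exact hx k d hds q ⟨x, Metric.mem_ball.2 hdx, C, hG, hk⟩ (Metric.mem_ball.2 hdx)

theorem setLIntegral_const_restrict_trim (hm : m ≤ mΩ) (c : ℝ≥0∞) {B s : Set Ω}
    (hs : MeasurableSet[m] s) :
    ∫⁻ _ in s, c ∂((μ.restrict B).trim hm) = c * μ (s ∩ B) := by
  rw [setLIntegral_trim hm measurable_const hs, setLIntegral_const,
    Measure.restrict_apply (hm _ hs)]

variable [IsFiniteMeasure μ]

theorem setLIntegral_condLExp_restrict_trim (hm : m ≤ mΩ) (f : Ω → ℝ≥0∞) {B s : Set Ω}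
    (hB : MeasurableSet[m] B) (hs : MeasurableSet[m] s) :
    ∫⁻ x in s, condLExp m μ f x ∂((μ.restrict B).trim hm) = ∫⁻ x in s ∩ B, f x ∂μ := by
  rw [setLIntegral_trim hm (measurable_condLExp _ _ _) hs, Measure.restrict_restrict (hm _ hs),
    setLIntegral_condLExp hm _ _ (hs.inter hB)]

/-- Local upper bounds of the masses of a function over small cells bound its conditional
expectation. -/
theorem condLExp_le_of_local (hm : m ≤ mΩ) {f : Ω → ℝ≥0∞} {X : Ω → E}
    (hX : Measurable[m] X) {u : Ω → ℝ}
    (h : ∀ᵐ ω ∂μ, ∃ C : ℝ, ∀ (B : Set Ω) (r : ℝ), 0 ≤ r → MeasurableSet[m] B →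
      (∀ ω' ∈ B, dist (X ω') (X ω) ≤ r) →
      ∫⁻ ω' in B, f ω' ∂μ ≤ ENNReal.ofReal (u ω + C * r) * μ B) :
    ∀ᵐ ω ∂μ, condLExp m μ f ω ≤ ENNReal.ofReal (u ω) := by
  have h1 : ∀ᵐ x ∂μ, ∀ q : ℚ, u x < q → condLExp m μ f x ≤ ENNReal.ofReal q := by
    refine ae_of_local hX ?_
    filter_upwards [h] with ω ⟨C, hω⟩
    refine ⟨C, fun B r hr hB hBr q hq => ?_⟩
    rw [← ae_restrict_iff' (hm _ hB)]
    -- Compare integrals over all `m`-measurable subsets of `B`. The local hypothesis passes to `s ∩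
    -- B` with the same centre and radius.
    refine ae_of_ae_trim hm (ae_le_of_forall_setLIntegral_le_of_sigmaFinite
      (g := fun _ => ENNReal.ofReal q) (measurable_condLExp _ _ _) fun s hs _ => ?_)
    rw [setLIntegral_condLExp_restrict_trim hm f hB hs, setLIntegral_const_restrict_trim hm _ hs]
    exact (hω (s ∩ B) r hr (hs.inter hB) fun ω' h' => hBr ω' h'.2).trans
      (mul_le_mul_left (ENNReal.ofReal_le_ofReal hq.le) _)
  filter_upwards [h1] with x hx
  have h2 : Tendsto ENNReal.ofReal (𝓝[>] (u x)) (𝓝 (ENNReal.ofReal (u x))) :=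
    (ENNReal.continuous_ofReal.tendsto _).mono_left nhdsWithin_le_nhds
  refine ge_of_tendsto h2 (eventually_nhdsWithin_of_forall fun y hy => ?_)
  obtain ⟨q, hq1, hq2⟩ := exists_rat_btwn (mem_Ioi.1 hy)
  exact (hx q hq1).trans (ENNReal.ofReal_le_ofReal hq2.le)

/-- Local lower bounds of the masses of a function over small cells bound its conditional
expectation. -/
theorem le_condLExp_of_local (hm : m ≤ mΩ) {f : Ω → ℝ≥0∞} {X : Ω → E}
    (hX : Measurable[m] X) {u : Ω → ℝ}
    (h : ∀ᵐ ω ∂μ, ∃ C : ℝ, ∀ (B : Set Ω) (r : ℝ), 0 ≤ r → MeasurableSet[m] B →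
      (∀ ω' ∈ B, dist (X ω') (X ω) ≤ r) →
      ENNReal.ofReal (u ω + C * r) * μ B ≤ ∫⁻ ω' in B, f ω' ∂μ) :
    ∀ᵐ ω ∂μ, ENNReal.ofReal (u ω) ≤ condLExp m μ f ω := by
  -- Changing signs reduces lower bounds to the same localisation lemma, which is formulated for
  -- levels above a function.
  have h1 : ∀ᵐ x ∂μ, ∀ q : ℚ, -u x < q → ENNReal.ofReal (-q) ≤ condLExp m μ f x := by
    refine ae_of_local hX ?_
    filter_upwards [h] with ω ⟨C, hω⟩
    refine ⟨-C, fun B r hr hB hBr q hq => ?_⟩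
    rw [← ae_restrict_iff' (hm _ hB)]
    refine ae_of_ae_trim hm (ae_le_of_forall_setLIntegral_le_of_sigmaFinite
      (f := fun _ => ENNReal.ofReal (-q)) measurable_const fun s hs _ => ?_)
    rw [setLIntegral_condLExp_restrict_trim hm f hB hs, setLIntegral_const_restrict_trim hm _ hs]
    exact (mul_le_mul_left (ENNReal.ofReal_le_ofReal (by linarith)) _).trans
      (hω (s ∩ B) r hr (hs.inter hB) fun ω' h' => hBr ω' h'.2)
  filter_upwards [h1] with x hx
  have h2 : Tendsto ENNReal.ofReal (𝓝[<] (u x)) (𝓝 (ENNReal.ofReal (u x))) :=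
    (ENNReal.continuous_ofReal.tendsto _).mono_left nhdsWithin_le_nhds
  refine le_of_tendsto h2 (eventually_nhdsWithin_of_forall fun y hy => ?_)
  obtain ⟨q, hq1, hq2⟩ := exists_rat_btwn (neg_lt_neg (mem_Iio.1 hy))
  exact (ENNReal.ofReal_le_ofReal (by linarith)).trans (hx q hq1)

end ConditionalExpectation

end CDKF

namespace CDKF

/-! ### The two bounds conditional on the initial covariance. -/

section ConditionalCost

open scoped Matrix.Norms.L2Operator

variable {n M : ℕ} {S : Model n M} {T : ℝ} {lam : Fin M → ℝ → ℝ} {Ω : Type*}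
  {mΩ : MeasurableSpace Ω} {μ : Measure Ω} {ℱ : Filtration ℝ mΩ}
  {N : Fin M → ℝ → Ω → ℕ} {P : ℝ → Ω → Matrix (Fin n) (Fin n) ℝ}
  {W : ℝ → Matrix (Fin n) (Fin n) ℝ} {WT : Matrix (Fin n) (Fin n) ℝ}

theorem sigmaGen_le {m : MeasurableSpace Ω} {X : Ω → Matrix (Fin n) (Fin n) ℝ}
    (hX : StronglyMeasurable[m] X) : sigmaGen X ≤ m :=
  measurable_iff_comap_le.1 (measurable_pi_lambda _ fun i => measurable_pi_lambda _ fun k =>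
    ((entryL i k).continuous.comp_stronglyMeasurable hX).measurable)

theorem stronglyMeasurable_sigmaGen (X : Ω → Matrix (Fin n) (Fin n) ℝ) :
    StronglyMeasurable[sigmaGen X] X := by
  have h : @Measurable _ _ (sigmaGen X) MeasurableSpace.pi (fun ω (i k : Fin n) => X ω i k) :=
    comap_measurable _
  exact h.stronglyMeasurable

theorem integrable_norm_of_entries {X : Ω → Matrix (Fin n) (Fin n) ℝ}
    (h : ∀ i k, Integrable (fun ω => X ω i k) μ) : Integrable (fun ω => ‖X ω‖) μ := by
  have e : X = fun ω => ∑ i, ∑ k, X ω i k • Matrix.single i k (1 : ℝ) := by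
    funext ω
    conv_lhs => rw [Matrix.matrix_eq_sum_single (X ω)]
    simp [Matrix.smul_single]
  have hX : Integrable X μ := by
    rw [e]
    exact integrable_finsetSum _ fun i _ => integrable_finsetSum _ fun k _ => (h i k).smul_const _
  exact hX.norm

variable [IsProbabilityMeasure μ]

theorem IsCovarianceProcess.condLExp_cost_le (hT : 0 ≤ T) (hW : IsWeight T W WT)
    (hlam : IsAdmissible T lam) (hN : IsPoissonFamily μ ℱ T lam N)
    (hP : IsCovarianceProcess μ ℱ T S N P) {Z : ℝ → Ω → Matrix (Fin n) (Fin n) ℝ}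
    (hZ : ∀ᵐ ω ∂μ, IsCovSurrogate T S lam (P 0 ω) (fun t => Z t ω)) :
    ∀ᵐ ω ∂μ, condLExp (sigmaGen (P 0)) μ
      (fun ω' => ENNReal.ofReal (cost T W WT fun t => P t ω')) ω
        ≤ ENNReal.ofReal (cost T W WT fun t => Z t ω) := by
  borelize (Matrix (Fin n) (Fin n) ℝ)
  have hm0 : sigmaGen (P 0) ≤ ℱ 0 := sigmaGen_le (hP.adapted 0 ⟨le_rfl, hT⟩)
  refine condLExp_le_of_local (hm0.trans (ℱ.le 0)) (stronglyMeasurable_sigmaGen (P 0)).measurable ?_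
  filter_upwards [hZ] with ω h
  obtain ⟨C, hC⟩ := h.exists_setLIntegral_cost_le hT hW hlam hN hP
  exact ⟨C, fun B r hr hB hBr => hC B r hr (hm0 _ hB) fun ω' hω' => by
    rw [← dist_eq_norm]; exact hBr ω' hω'⟩

theorem IsCovarianceProcess.le_condLExp_cost (hT : 0 ≤ T) (hW : IsWeight T W WT)
    (hlam : IsAdmissible T lam) (hN : IsPoissonFamily μ ℱ T lam N)
    (hP : IsCovarianceProcess μ ℱ T S N P) {Z : ℝ → Ω → Matrix (Fin n) (Fin n) ℝ}
    (hZ : ∀ᵐ ω ∂μ, IsInfoSurrogate T S lam (P 0 ω)⁻¹ (fun t => Z t ω)) :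
    ∀ᵐ ω ∂μ, ENNReal.ofReal (cost T W WT fun t => (Z t ω)⁻¹)
      ≤ condLExp (sigmaGen (P 0)) μ
        (fun ω' => ENNReal.ofReal (cost T W WT fun t => P t ω')) ω := by
  borelize (Matrix (Fin n) (Fin n) ℝ × Matrix (Fin n) (Fin n) ℝ)
  have hm0 : sigmaGen (P 0) ≤ ℱ 0 := sigmaGen_le (hP.adapted 0 ⟨le_rfl, hT⟩)
  have h0 := stronglyMeasurable_sigmaGen (P 0)
  refine le_condLExp_of_local (hm0.trans (ℱ.le 0))
    -- Cells are taken for the pair `(P 0, (P 0)⁻¹)` with the maximum distance, so that a small cell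
    -- controls both initial values.
    (h0.prodMk (stronglyMeasurable_matrix_inv h0)).measurable ?_
  filter_upwards [hZ, hP.posDef] with ω h hpd
  obtain ⟨C, hC⟩ := h.exists_le_setLIntegral_cost hT hW hlam hN hP (hpd 0 ⟨le_rfl, hT⟩)
  refine ⟨C, fun B r hr hB hBr => hC B r hr (hm0 _ hB) (fun ω' hω' => ?_) fun ω' hω' => ?_⟩
  · rw [← dist_eq_norm]; exact (le_max_left _ _).trans (hBr ω' hω')
  · rw [← dist_eq_norm]; exact (le_max_right _ _).trans (hBr ω' hω')

end ConditionalCost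

end CDKF

/-! ### Assembly of the theorem. -/

open scoped Matrix.Norms.L2Operator in
theorem mainTheorem3 {n M : ℕ} (S : CDKF.Model n M) (T : ℝ) (hT : 0 ≤ T)
    (W : ℝ → Matrix (Fin n) (Fin n) ℝ) (WT : Matrix (Fin n) (Fin n) ℝ)
    (hW : CDKF.IsWeight T W WT)
    (lam : Fin M → ℝ → ℝ) (hlam : CDKF.IsAdmissible T lam)
    {Ω : Type*} {mΩ : MeasurableSpace Ω} (μ : Measure Ω) [IsProbabilityMeasure μ]
    (ℱ : Filtration ℝ mΩ)
    (N : Fin M → ℝ → Ω → ℕ) (hN : CDKF.IsPoissonFamily μ ℱ T lam N)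
    (P : ℝ → Ω → Matrix (Fin n) (Fin n) ℝ) (hP : CDKF.IsCovarianceProcess μ ℱ T S N P)
    (Yhat Phat : ℝ → Ω → Matrix (Fin n) (Fin n) ℝ)
    (hY : ∀ᵐ ω ∂μ, CDKF.IsInfoSurrogate T S lam (P 0 ω)⁻¹ (fun t => Yhat t ω))
    (hPhat : ∀ᵐ ω ∂μ, CDKF.IsCovSurrogate T S lam (P 0 ω) (fun t => Phat t ω)) :
    -- the inverse of `Yhat`, the three costs and the conditional expectation make sense
    (∀ᵐ ω ∂μ, (∀ t ∈ Set.Icc 0 T, (Yhat t ω).PosDef) ∧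
      IntervalIntegrable (fun t => CDKF.frob (W t) (Yhat t ω)⁻¹) volume 0 T ∧
      IntervalIntegrable (fun t => CDKF.frob (W t) (P t ω)) volume 0 T ∧
      IntervalIntegrable (fun t => CDKF.frob (W t) (Phat t ω)) volume 0 T ∧
      0 ≤ CDKF.cost T W WT (fun t => P t ω)) ∧
    AEMeasurable (fun ω => CDKF.cost T W WT (fun t => P t ω)) μ ∧
    -- the bounds, with the conditional expectation of a nonnegative random variable
    (∀ᵐ ω ∂μ,
      condLExp (CDKF.sigmaGen (P 0)) μ
        (fun ω' => ENNReal.ofReal (CDKF.cost T W WT (fun t => P t ω'))) ω < ∞ ∧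
      CDKF.cost T W WT (fun t => (Yhat t ω)⁻¹) ≤
        (condLExp (CDKF.sigmaGen (P 0)) μ
          (fun ω' => ENNReal.ofReal (CDKF.cost T W WT (fun t => P t ω'))) ω).toReal ∧
      (condLExp (CDKF.sigmaGen (P 0)) μ
          (fun ω' => ENNReal.ofReal (CDKF.cost T W WT (fun t => P t ω'))) ω).toReal ≤
        CDKF.cost T W WT (fun t => Phat t ω)) ∧
    -- the same bounds with the usual conditional expectation, when `P 0` is integrable
    ((∀ i k, Integrable (fun ω => P 0 ω i k) μ) →
      Integrable (fun ω => CDKF.cost T W WT (fun t => P t ω)) μ ∧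
      ∀ᵐ ω ∂μ,
        CDKF.cost T W WT (fun t => (Yhat t ω)⁻¹) ≤
          (μ[fun ω' => CDKF.cost T W WT (fun t => P t ω') | CDKF.sigmaGen (P 0)]) ω ∧
        (μ[fun ω' => CDKF.cost T W WT (fun t => P t ω') | CDKF.sigmaGen (P 0)]) ω ≤
          CDKF.cost T W WT (fun t => Phat t ω)) := by
  obtain ⟨c, hc, hPc⟩ := hP.exists_norm_le hT hN
  have hm0 : CDKF.sigmaGen (P 0) ≤ ℱ 0 := CDKF.sigmaGen_le (hP.adapted 0 ⟨le_rfl, hT⟩)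
  have hm : CDKF.sigmaGen (P 0) ≤ mΩ := hm0.trans (ℱ.le 0)
  have hYpd : ∀ᵐ ω ∂μ, ∀ t ∈ Set.Icc 0 T, (Yhat t ω).PosDef := by
    filter_upwards [hY, hP.posDef] with ω h1 h2
    exact h1.posDef hT hlam (h2 0 ⟨le_rfl, hT⟩).inv
  have hnn : ∀ᵐ ω ∂μ, 0 ≤ CDKF.cost T W WT (fun t => P t ω) := by
    filter_upwards [hP.posDef] with ω h
    exact CDKF.cost_nonneg hT hW fun t ht => (h t ht).posSemidef
  have hup := hP.condLExp_cost_le hT hW hlam hN hPhat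
  have hlow := hP.le_condLExp_cost hT hW hlam hN hY
  have hPT : StronglyMeasurable (P T) := hP.stronglyMeasurable ⟨hT, le_rfl⟩
  have hbounds : ∀ᵐ ω ∂μ,
      condLExp (CDKF.sigmaGen (P 0)) μ
        (fun ω' => ENNReal.ofReal (CDKF.cost T W WT (fun t => P t ω'))) ω < ∞ ∧
      CDKF.cost T W WT (fun t => (Yhat t ω)⁻¹) ≤
        (condLExp (CDKF.sigmaGen (P 0)) μ
          (fun ω' => ENNReal.ofReal (CDKF.cost T W WT (fun t => P t ω'))) ω).toReal ∧
      (condLExp (CDKF.sigmaGen (P 0)) μ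
          (fun ω' => ENNReal.ofReal (CDKF.cost T W WT (fun t => P t ω'))) ω).toReal ≤
        CDKF.cost T W WT (fun t => Phat t ω) := by
    filter_upwards [hup, hlow, hPhat] with ω h1 h2 h3
    -- Finiteness follows from the upper bound by a real surrogate cost, with no moment assumption
    -- on `P 0`.
    have hfin := h1.trans_lt ENNReal.ofReal_lt_top
    exact ⟨hfin, (ENNReal.ofReal_le_iff_le_toReal hfin.ne).1 h2,
      ENNReal.toReal_le_of_le_ofReal (CDKF.cost_nonneg hT hW h3.posSemidef) h1⟩
  refine ⟨?_, hW.aemeasurable_cost hT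
    (hP.aestronglyMeasurable_prod hT Measure.AbsolutelyContinuous.rfl)
    hPT.aestronglyMeasurable, hbounds, fun hInt => ?_⟩
  · filter_upwards [hYpd, hY, hPhat, hP.ae_isCovPath hN, hnn] with ω h1 h2 h3 h4 h5
    obtain ⟨C, -, hC⟩ := h4.cadlag.exists_norm_bound
    exact ⟨h1, hW.intervalIntegrable_frob_of_continuousOn hT
        (CDKF.continuousOn_inv h2.continuousOn h1),
      hW.intervalIntegrable_frob hT h4.cadlag.aestronglyMeasurable hC,
      hW.intervalIntegrable_frob_of_continuousOn hT h3.continuousOn, h5⟩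
  · have hβ : Integrable (fun ω => c * (1 + ‖P 0 ω‖)) μ :=
      ((integrable_const _).add (CDKF.integrable_norm_of_entries hInt)).const_mul c
    have hJ : Integrable (fun ω => CDKF.cost T W WT (fun t => P t ω)) μ :=
      (hW.integral_cost hT (hP.aestronglyMeasurable_prod hT Measure.AbsolutelyContinuous.rfl)
        (fun t ht => (hP.stronglyMeasurable ht).aestronglyMeasurable) hβ hPc).1
    refine ⟨hJ, ?_⟩
    -- For an integrable nonnegative cost the two notions of conditional expectation agree, so the
    -- bounds transfer.
    filter_upwards [hbounds, condLExp_ofReal (CDKF.sigmaGen (P 0)) hJ hnn,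
      condExp_nonneg (m := CDKF.sigmaGen (P 0)) hnn] with ω h1 h2 h3
    rw [h2, ENNReal.toReal_ofReal h3] at h1
    exact h1.2
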